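/- Let $\underline L=(L,\beta)$ be a positive-definite even lattice of rank $\mathrm{rk}$: $L$ is a free $\mathbb Z$-module of rank $\mathrm{rk}$ and $\beta:L\times L\to\mathbb Z$ is symmetric bilinear, positive definite, with $\beta(x,x)$ even for all $x\in L$. Put $\beta(x)=\frac12\beta(x,x)$, extend $\beta$ to $L\otimes\mathbb Q$ and $L\otimes\mathbb C$, let $L^\#=\{y\in L\otimes\mathbb Q:\beta(y,x)\in\mathbb Z\ \forall x\in L\}$ and $\det(\underline L)=|L^\#/L|=|\det G|$ for a Gram matrix $G$. Write $e(x)=e^{2\pi i x}$ and $e_c(x)=e(x/c)$, and $\mathfrak H$ for the upper half-plane. The Jacobi group $J=\mathrm{SL}_2(\mathbb Z)\ltimes(L\times L)$ has the law $(A,h)(A',h')=(AA',h^{A'}+h')$, where $(x,y)^A=(ax+cy,bx+dy)$ for $A=\left(\begin{smallmatrix}a&b\\c&d\end{smallmatrix}\right)$. For $k\in\mathbb Z$ it acts on functions $\phi$ on $\mathfrak H\times(L\otimes\mathbb C)$ by $\phi|(A,h)=(\phi|A)|h$, where $$\phi|A(\tau,z)=\phi\Big(A\tau,\frac{z}{c\tau+d}\Big)(c\tau+d)^{-k}e\Big(\frac{-c\beta(z)}{c\tau+d}\Big),\qquad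 \phi|(x,y)(\tau,z)=\phi(\tau,z+x\tau+y)\,e(\tau\beta(x)+\beta(x,z)).$$ $J_{k,\underline L}$ is the space of holomorphic $\phi$ on $\mathfrak H\times(L\otimes\mathbb C)$ that are invariant under $J$ and have a Fourier expansion $\phi(\tau,z)=\sum c(m,s)\,e(m\tau+\beta(s,z))$ over $m\in\mathbb Z$, $s\in L^\#$, $m\ge\beta(s)$. Such a $\phi$ is a cusp form if $c(\beta(s),s)=0$ whenever $\beta(s)\in\mathbb Z$. With $\tau=u+iv$ and $z=x+iy$, the Petersson scalar product is $$\langle\phi,\psi\rangle=\int\phi\,\overline\psi\,v^{k}e^{-4\pi\beta(y)/v}\,v^{-\mathrm{rk}-2}\,du\,dv\,dx\,dy,$$ the integral being over a fundamental domain for the action $(A,(x,y))(\tau,z)=\big(A\tau,\frac{z+x\tau+y}{c\tau+d}\big)$ of $J$ on $\mathfrak H\times(L\otimes\mathbb C)$. Let $k$ be an integer with $k>\frac{\mathrm{rk}}2+2$ and let $r\in L^\#$ with $\beta(r)\in\mathbb Z$. Put $g_r(\tau,z)=e(\tau\beta(r)+\beta(r,z))$, $\Gamma=\mathrm{SL}_2(\mathbb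 Z)$, $\Gamma_\infty=\{\left(\begin{smallmatrix}1&m\\0&1\end{smallmatrix}\right):m\in\mathbb Z\}$ and $J_\infty=\{(A,(0,\mu)):A\in\Gamma_\infty,\ \mu\in L\}$. The function $g_r|\gamma$ depends only on the coset $J_\infty\gamma$. The Jacobi--Eisenstein series is $$E_r=\frac12\sum_{\gamma\in J_\infty\backslash J}g_r|\gamma=\frac12\sum_{A\in\Gamma_\infty\backslash\Gamma}F_A,\qquad F_A=\sum_{\gamma}g_r|\gamma,$$ the sum in $F_A$ being over the cosets $J_\infty\gamma$ that map to $\Gamma_\infty A$ under $(A',h)\mapsto A'$. The summation over $J_\infty\backslash J$ is understood in this order: first within each $F_A$, then over $A$. Then: (i) For each $A$ the series defining $F_A$ converges absolutely and uniformly on compact subsets of $\mathfrak H\times(L\otimes\mathbb C)$, and so does the series $\sum_{A\in\Gamma_\infty\backslash\Gamma}F_A$. If moreover $k>\mathrm{rk}+2$, then the series $\sum_{\gamma\in J_\infty\backslash J}g_r|\gamma$ itself converges absolutely and uniformly on compact subsets, with sum $2E_r$. The function $E_r$ is an element of $J_{k,\underline L}$. It is orthogonal to cusp forms: for every cusp form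 $\phi\in J_{k,\underline L}$ the integral defining $\langle\phi,E_r\rangle$ converges absolutely and equals $0$. (ii) $E_r$ has the Fourier expansion $$E_r(\tau,z)=\frac12\sum_{\substack{r'\in L^\#\\\beta(r')\in\mathbb Z}}\big(\delta(r,r')+(-1)^k\delta(-r,r')\big)e(\tau\beta(r')+\beta(r',z))+\sum_{\substack{r'\in L^\#,\ D'\in\mathbb Q,\ D'<0\\ D'\equiv\beta(r')\bmod\mathbb Z}}G_r(D',r')\,e\big((\beta(r')-D')\tau+\beta(r',z)\big),$$ both series converging absolutely. Here $\delta(r,r')=1$ if $r'\equiv r\bmod L$ and $\delta(r,r')=0$ otherwise, and $$G_r(D',r')=\frac{(2\pi)^{k-\frac{\mathrm{rk}}2}i^k}{2\det(\underline L)^{\frac12}\Gamma\left(k-\frac{\mathrm{rk}}2\right)}(-D')^{k-\frac{\mathrm{rk}}2-1}\sum_{c\ge1}c^{-k}\big(H_{\underline L,c}(r,D',r')+(-1)^kH_{\underline L,c}(-r,D',r')\big),$$ where the series over $c$ converges absolutely and $$H_{\underline L,c}(r,D',r')=\sum_{\lambda\in L/cL}\ \sum_{d\in(\mathbb Z/c\mathbb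 Z)^\times}e_c\big(\beta(\lambda+r)d^{-1}+(\beta(r')-D')d+\beta(r',\lambda+r)\big).$$ -/

import Mathlib

open UpperHalfPlane MeasureTheory Matrix
open scoped MatrixGroups Modular

noncomputable section

/-- A positive-definite even lattice of rank `n`, in coordinates with respect to a `ℤ`-basis:
the underlying module is `ℤⁿ` and the bilinear form is `β(x, y) = xᵗ G y`, with `G` the Gram
matrix. -/
structure EvenLattice (n : ℕ) where
  gram : Matrix (Fin n) (Fin n) ℤ
  symm : gram.IsSymm
  even : ∀ x : Fin n → ℤ, Even (x ⬝ᵥ gram *ᵥ x)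
  pos : ∀ x : Fin n → ℤ, x ≠ 0 → 0 < x ⬝ᵥ gram *ᵥ x

/-- `e(x) = exp(2πix)`. -/
def eFun (x : ℂ) : ℂ := Complex.exp (2 * Real.pi * Complex.I * x)

theorem eFun_add_int (x : ℂ) (m : ℤ) : eFun (x + m) = eFun x := by
  unfold eFun
  rw [mul_add, Complex.exp_add]
  have : Complex.exp (2 * Real.pi * Complex.I * m) = 1 :=
    Complex.exp_eq_one_iff.mpr ⟨m, by ring⟩
  rw [this, mul_one]

theorem eFun_add (x y : ℂ) : eFun (x + y) = eFun x * eFun y := by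
  unfold eFun
  rw [mul_add, Complex.exp_add]

/-- Elements of `L = ℤⁿ` inside `L ⊗ R = Rⁿ`. -/
def intVec {n : ℕ} (R : Type*) [IntCast R] (x : Fin n → ℤ) : Fin n → R := fun i => (x i : R)

/-- Elements of `L ⊗ ℚ = ℚⁿ` inside `L ⊗ ℂ = ℂⁿ`. -/
def ratVec {n : ℕ} (x : Fin n → ℚ) : Fin n → ℂ := fun i => (x i : ℂ)

namespace EvenLattice

variable {n : ℕ} (L : EvenLattice n)

/-- The extension of `β` to `L ⊗ R = Rⁿ`. -/
def bil {R : Type*} [CommRing R] (x y : Fin n → R) : R :=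
  x ⬝ᵥ (L.gram.map (Int.cast : ℤ → R)) *ᵥ y

/-- The quadratic form `β(x) = β(x, x) / 2` on `L ⊗ K = Kⁿ`. -/
def quad {K : Type*} [Field K] (x : Fin n → K) : K := L.bil x x / 2

/-- `det(L) = |det G|`, the order of `L^# / L`. -/
def det : ℝ := |(L.gram.det : ℝ)|

/-- The dual lattice `L^# ⊆ L ⊗ ℚ`. -/
def dual : Set (Fin n → ℚ) :=
  {y | ∀ x : Fin n → ℤ, ∃ m : ℤ, L.bil y (intVec ℚ x) = m}

/-- The elements `r` of `L^#` that are isotropic: `β(r) ∈ ℤ`. -/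
def isotropic : Set (Fin n → ℚ) :=
  {r | r ∈ L.dual ∧ ∃ m : ℤ, L.quad r = m}

end EvenLattice

/-- The Jacobi group `SL₂(ℤ) ⋉ (L × L)`, with elements `(A, (x, y))`; here `L = ℤⁿ`. -/
@[ext] structure JacobiGroup (n : ℕ) where
  mat : SL(2, ℤ)
  x : Fin n → ℤ
  y : Fin n → ℤ

namespace JacobiGroup

variable {n : ℕ}

/-- `(A, h) (A', h') = (A A', h ^ A' + h')`, with `(x, y) ^ A = (a x + c y, b x + d y)`. -/
instance : Mul (JacobiGroup n) where
  mul g g' :=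
    { mat := g.mat * g'.mat
      x := g'.mat 0 0 • g.x + g'.mat 1 0 • g.y + g'.x
      y := g'.mat 0 1 • g.x + g'.mat 1 1 • g.y + g'.y }

instance : One (JacobiGroup n) where
  one := { mat := 1, x := 0, y := 0 }

instance : Inv (JacobiGroup n) where
  inv g :=
    { mat := g.mat⁻¹
      x := -(g.mat⁻¹ 0 0 • g.x + g.mat⁻¹ 1 0 • g.y)
      y := -(g.mat⁻¹ 0 1 • g.x + g.mat⁻¹ 1 1 • g.y) }

@[simp] theorem mul_mat (g h : JacobiGroup n) : (g * h).mat = g.mat * h.mat := rfl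
@[simp] theorem mul_x (g h : JacobiGroup n) :
    (g * h).x = h.mat 0 0 • g.x + h.mat 1 0 • g.y + h.x := rfl
@[simp] theorem mul_y (g h : JacobiGroup n) :
    (g * h).y = h.mat 0 1 • g.x + h.mat 1 1 • g.y + h.y := rfl
@[simp] theorem one_mat : (1 : JacobiGroup n).mat = 1 := rfl
@[simp] theorem one_x : (1 : JacobiGroup n).x = 0 := rfl
@[simp] theorem one_y : (1 : JacobiGroup n).y = 0 := rfl
@[simp] theorem inv_mat (g : JacobiGroup n) : (g⁻¹).mat = g.mat⁻¹ := rfl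
@[simp] theorem inv_x (g : JacobiGroup n) :
    (g⁻¹).x = -(g.mat⁻¹ 0 0 • g.x + g.mat⁻¹ 1 0 • g.y) := rfl
@[simp] theorem inv_y (g : JacobiGroup n) :
    (g⁻¹).y = -(g.mat⁻¹ 0 1 • g.x + g.mat⁻¹ 1 1 • g.y) := rfl

instance : Group (JacobiGroup n) :=
  Group.ofLeftAxioms
    (by
      intro a b c
      ext i
      · simp [mul_assoc]
      · simp [Matrix.mul_apply, Fin.sum_univ_two]; ring
      · simp [Matrix.mul_apply, Fin.sum_univ_two]; ring)
    (by
      intro a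
      ext i <;> simp)
    (by
      intro a
      have hd : a.mat 0 0 * a.mat 1 1 - a.mat 0 1 * a.mat 1 0 = 1 := by
        rw [← Matrix.det_fin_two]; exact a.mat.det_coe
      ext i
      · simp
      · simp [Matrix.adjugate_fin_two]; linear_combination (-a.x i) * hd
      · simp [Matrix.adjugate_fin_two]; linear_combination (-a.y i) * hd)

/-- `J_L(ℤ)_∞ = {((1, m; 0, 1), (0, μ))}`. -/
def parabolic (n : ℕ) : Subgroup (JacobiGroup n) where
  carrier := {g | g.mat 0 0 = 1 ∧ g.mat 1 0 = 0 ∧ g.mat 1 1 = 1 ∧ g.x = 0}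
  one_mem' := by simp
  mul_mem' := by
    rintro a b ⟨h1, h2, h3, h4⟩ ⟨h5, h6, h7, h8⟩
    simp_all [Matrix.mul_apply, Fin.sum_univ_two]
  inv_mem' := by
    rintro a ⟨h1, h2, h3, h4⟩
    simp_all [Matrix.SpecialLinearGroup.SL2_inv_expl]

end JacobiGroup

/-- `SL₂(ℤ)_∞ = {(1, m; 0, 1)}`. -/
def slParabolic : Subgroup SL(2, ℤ) where
  carrier := {A | A 0 0 = 1 ∧ A 1 0 = 0 ∧ A 1 1 = 1}
  one_mem' := by simp
  mul_mem' := by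
    rintro a b ⟨h1, h2, h3⟩ ⟨h5, h6, h7⟩
    simp_all [Matrix.mul_apply, Fin.sum_univ_two]
  inv_mem' := by
    rintro a ⟨h1, h2, h3⟩
    refine ⟨?_, ?_, ?_⟩ <;> simp [Matrix.adjugate_fin_two, h1, h2, h3]

/-- The coset space `J_L(ℤ)_∞ \ J_L(ℤ)`. -/
abbrev JacobiCosets (n : ℕ) : Type := Quotient (QuotientGroup.rightRel (JacobiGroup.parabolic n))

/-- The coset space `SL₂(ℤ)_∞ \ SL₂(ℤ)`. -/
abbrev SLCosets : Type := Quotient (QuotientGroup.rightRel slParabolic)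

/-- The map `J_L(ℤ)_∞ \ J_L(ℤ) → SL₂(ℤ)_∞ \ SL₂(ℤ)` induced by `(A, h) ↦ A`. -/
def JacobiCosets.toSL {n : ℕ} : JacobiCosets n → SLCosets :=
  Quotient.map (fun g => g.mat) (by
    intro a b h
    change QuotientGroup.rightRel _ a b at h
    change QuotientGroup.rightRel _ a.mat b.mat
    rw [QuotientGroup.rightRel_apply] at h ⊢
    exact ⟨h.1, h.2.1, h.2.2.1⟩)

namespace EvenLattice

variable {n : ℕ} (L : EvenLattice n)

/-- The action of `SL₂(ℤ)` on functions on `ℍ × (L ⊗ ℂ)`. -/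
def slashSL (k : ℤ) (φ : ℍ → (Fin n → ℂ) → ℂ) (A : SL(2, ℤ)) : ℍ → (Fin n → ℂ) → ℂ :=
  fun τ z =>
    φ (A • τ) (((A 1 0 : ℂ) * τ + (A 1 1 : ℂ))⁻¹ • z) *
      ((A 1 0 : ℂ) * τ + (A 1 1 : ℂ)) ^ (-k) *
      eFun (-(A 1 0 : ℂ) * L.quad z / ((A 1 0 : ℂ) * τ + (A 1 1 : ℂ)))

/-- The action of the Heisenberg group on functions on `ℍ × (L ⊗ ℂ)`. -/
def slashH (φ : ℍ → (Fin n → ℂ) → ℂ) (x y : Fin n → ℤ) : ℍ → (Fin n → ℂ) → ℂ :=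
  fun τ z =>
    φ τ (z + (τ : ℂ) • intVec ℂ x + intVec ℂ y) *
      eFun ((τ : ℂ) * L.quad (intVec ℂ x) + L.bil (intVec ℂ x) z)

/-- The action `φ|_{k,L} (A, h) = (φ|_{k,L} A)|_{k,L} h` of the Jacobi group. -/
def slash (k : ℤ) (φ : ℍ → (Fin n → ℂ) → ℂ) (g : JacobiGroup n) : ℍ → (Fin n → ℂ) → ℂ :=
  L.slashH (L.slashSL k φ g.mat) g.x g.y

/-- `g_{L,0,r}(τ, z) = e(τ β(r) + β(r, z))`. -/
def gFun (r : Fin n → ℚ) : ℍ → (Fin n → ℂ) → ℂ :=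
  fun τ z => eFun ((τ : ℂ) * L.quad (ratVec r) + L.bil (ratVec r) z)

/-! Facts that make the summand of the Eisenstein series well defined on cosets. -/

theorem bil_add_left {R : Type*} [CommRing R] (x y z : Fin n → R) :
    L.bil (x + y) z = L.bil x z + L.bil y z := by
  simp [bil, add_dotProduct]

theorem bil_add_right {R : Type*} [CommRing R] (x y z : Fin n → R) :
    L.bil x (y + z) = L.bil x y + L.bil x z := by
  simp [bil, mulVec_add, dotProduct_add]

theorem bil_smul_left {R : Type*} [CommRing R] (a : R) (x y : Fin n → R) :
    L.bil (a • x) y = a * L.bil x y := by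
  simp [bil]

theorem bil_smul_right {R : Type*} [CommRing R] (a : R) (x y : Fin n → R) :
    L.bil x (a • y) = a * L.bil x y := by
  simp [bil, mulVec_smul]

theorem bil_comm {R : Type*} [CommRing R] (x y : Fin n → R) : L.bil x y = L.bil y x := by
  have h : (L.gram.map (Int.cast : ℤ → R))ᵀ = L.gram.map (Int.cast : ℤ → R) := by
    rw [← Matrix.transpose_map, L.symm]
  unfold bil
  rw [dotProduct_comm, ← vecMul_transpose, h, ← dotProduct_mulVec]

theorem bil_intVec (x y : Fin n → ℤ) :
    L.bil (intVec ℂ x) (intVec ℂ y) = ((L.bil x y : ℤ) : ℂ) := by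
  simp [bil, intVec, dotProduct, mulVec]

theorem bil_ratVec (x y : Fin n → ℚ) :
    L.bil (ratVec x) (ratVec y) = ((L.bil x y : ℚ) : ℂ) := by
  simp [bil, ratVec, dotProduct, mulVec]

theorem quad_intVec (x : Fin n → ℤ) : ∃ m : ℤ, L.quad (intVec ℂ x) = m := by
  obtain ⟨m, hm⟩ := L.even x
  refine ⟨m, ?_⟩
  have : L.bil x x = m + m := by 
    rw [← hm, bil, show L.gram.map (Int.cast : ℤ → ℤ) = L.gram by ext; simp]
  rw [quad, bil_intVec, this]
  push_cast
  ring

theorem quad_add (x y : Fin n → ℂ) : L.quad (x + y) = L.quad x + L.quad y + L.bil x y := by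
  simp only [quad, bil_add_left, bil_add_right, L.bil_comm y x]
  ring

theorem quad_smul (a : ℂ) (x : Fin n → ℂ) : L.quad (a • x) = a ^ 2 * L.quad x := by
  simp only [quad, bil_smul_left, bil_smul_right]
  ring

theorem gFun_add_int {r : Fin n → ℚ} (hr : r ∈ L.isotropic) (m : ℤ) (μ : Fin n → ℤ)
    (τ τ' : ℍ) (hτ : (τ' : ℂ) = τ + m) (z : Fin n → ℂ) :
    L.gFun r τ' (z + intVec ℂ μ) = L.gFun r τ z := by
  obtain ⟨hd, s, hs⟩ := hr
  obtain ⟨t, ht⟩ := hd μ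
  have h1 : L.quad (ratVec r) = (s : ℂ) := by
    have : L.bil r r = 2 * s := by rw [← hs, quad]; ring
    rw [quad, bil_ratVec, this]; push_cast; ring
  have h2 : L.bil (ratVec r) (intVec ℂ μ) = (t : ℂ) := by
    have : intVec ℂ μ = ratVec (intVec ℚ μ) := by ext i; simp [intVec, ratVec]
    rw [this, bil_ratVec, ht]; simp
  unfold gFun
  rw [hτ, bil_add_right, h1, h2]
  symm
  rw [← eFun_add_int _ (m * s + t)]
  congr 1
  push_cast
  ring

/-- `g_{L,0,r}|_{k,L} γ` depends only on the coset of `γ` in `J_L(ℤ)_∞ \ J_L(ℤ)`. -/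
theorem slash_gFun_mul {r : Fin n → ℚ} (hr : r ∈ L.isotropic) (k : ℤ) (p g : JacobiGroup n)
    (hp : p ∈ JacobiGroup.parabolic n) :
    L.slash k (L.gFun r) (p * g) = L.slash k (L.gFun r) g := by
  obtain ⟨h00, h10, h11, hx⟩ := hp
  funext τ z
  set c : ℤ := g.mat 1 0 with hc
  set d : ℤ := g.mat 1 1 with hd
  set m : ℤ := p.mat 0 1 with hm
  have hc' : (p * g).mat 1 0 = c := by
    simp [Matrix.mul_apply, Fin.sum_univ_two, h10, h11, hc]
  have hd' : (p * g).mat 1 1 = d := by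
    simp [Matrix.mul_apply, Fin.sum_univ_two, h10, h11, hd]
  have hx' : (p * g).x = c • p.y + g.x := by simp [hx, hc]
  have hy' : (p * g).y = d • p.y + g.y := by simp [hx, hd]
  have hτ : (((p * g).mat • τ : ℍ) : ℂ) = ((g.mat • τ : ℍ) : ℂ) + m := by
    rw [JacobiGroup.mul_mat, mul_smul, UpperHalfPlane.coe_specialLinearGroup_apply]
    simp [h00, h10, h11, hm]
  have hj : (c : ℂ) * τ + d ≠ 0 := by
    have := UpperHalfPlane.denom_ne_zero (g.mat : GL (Fin 2) ℝ) τ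
    simpa [UpperHalfPlane.denom, hc, hd] using this
  set j : ℂ := (c : ℂ) * τ + d with hjd
  set w : Fin n → ℂ := z + (τ : ℂ) • intVec ℂ g.x + intVec ℂ g.y with hw
  have hix : intVec ℂ (p * g).x = (c : ℂ) • intVec ℂ p.y + intVec ℂ g.x := by
    ext i; simp [intVec, hx']
  have hiy : intVec ℂ (p * g).y = (d : ℂ) • intVec ℂ p.y + intVec ℂ g.y := by
    ext i; simp [intVec, hy']
  have hw' : z + (τ : ℂ) • intVec ℂ (p * g).x + intVec ℂ (p * g).y =
      w + j • intVec ℂ p.y := by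
    rw [hix, hiy, hw, hjd]
    module
  have hz : j⁻¹ • (w + j • intVec ℂ p.y) = j⁻¹ • w + intVec ℂ p.y := by
    rw [smul_add, smul_smul, inv_mul_cancel₀ hj, one_smul]
  obtain ⟨q, hq⟩ := L.quad_intVec p.y
  have hb := L.bil_intVec g.y p.y
  set b : ℤ := L.bil g.y p.y with hbd
  unfold slash slashH slashSL
  rw [hw', hc', hd', ← hc, ← hd, ← hjd, ← hw, hz, L.gFun_add_int hr m p.y _ _ hτ]
  have key : eFun (-(c : ℂ) * L.quad (w + j • intVec ℂ p.y) / j) *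
      eFun ((τ : ℂ) * L.quad (intVec ℂ (p * g).x) + L.bil (intVec ℂ (p * g).x) z) =
      eFun (-(c : ℂ) * L.quad w / j) *
      eFun ((τ : ℂ) * L.quad (intVec ℂ g.x) + L.bil (intVec ℂ g.x) z) := by
    rw [← eFun_add, ← eFun_add, ← eFun_add_int _ (c * d * q + c * b)]
    congr 1
    have hcomm : L.bil w (intVec ℂ p.y) =
        L.bil (intVec ℂ p.y) z + τ * L.bil (intVec ℂ p.y) (intVec ℂ g.x) + b := by
      rw [hw, bil_add_left, bil_add_left, bil_smul_left, hb, L.bil_comm z,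
        L.bil_comm (intVec ℂ g.x)]
    rw [hix, L.quad_add w, L.quad_add ((c : ℂ) • _), quad_smul, quad_smul, bil_smul_right, bil_smul_left,
      L.bil_add_left ((c : ℂ) • _), bil_smul_left, hcomm, hq]
    push_cast
    field_simp
    rw [hjd]
    ring
  linear_combination (L.gFun r (g.mat • τ) (j⁻¹ • w) * j ^ (-k)) * key

/-- The summand `g_{L,0,r}|_{k,L} γ` as a function of `γ ∈ J_L(ℤ)_∞ \ J_L(ℤ)`. -/
def seriesTerm (k : ℤ) (r : L.isotropic) (p : JacobiCosets n) : ℍ → (Fin n → ℂ) → ℂ :=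
  Quotient.liftOn p (fun g => L.slash k (L.gFun r) g) (by
    intro a b h
    change QuotientGroup.rightRel _ a b at h
    rw [QuotientGroup.rightRel_apply] at h
    have := L.slash_gFun_mul r.2 k (b * a⁻¹) a h
    rw [inv_mul_cancel_right] at this
    exact this.symm)

/-- The partial sum of the series over the cosets `J_L(ℤ)_∞ (A, h)` with a fixed
`SL₂(ℤ)_∞ A`. -/
def fiberSum (k : ℤ) (r : L.isotropic) (q : SLCosets) : ℍ → (Fin n → ℂ) → ℂ :=
  fun τ z => ∑' p : {p : JacobiCosets n // p.toSL = q}, L.seriesTerm k r p τ z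

/-- The Jacobi–Eisenstein series `E_{k,L,r}`: one half of the sum of `g_{L,0,r}|_{k,L} γ` over
`γ ∈ J_L(ℤ)_∞ \ J_L(ℤ)`, summed first over the Heisenberg part and then over
`SL₂(ℤ)_∞ \ SL₂(ℤ)`. -/
def eisenstein (k : ℤ) (r : L.isotropic) : ℍ → (Fin n → ℂ) → ℂ :=
  fun τ z => 1 / 2 * ∑' q : SLCosets, L.fiberSum k r q τ z

/-- `φ(τ, z) = ∑ c(m, r) e(m τ + β(r, z))`, the sum being over all `m ∈ ℤ` and `r ∈ L^#` with
`m ≥ β(r)`. -/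
def HasFourierExpansion (φ : ℍ → (Fin n → ℂ) → ℂ) (c : ℤ → (Fin n → ℚ) → ℂ) : Prop :=
  ∀ (τ : ℍ) (z : Fin n → ℂ), HasSum
    (fun p : {p : ℤ × (Fin n → ℚ) // p.2 ∈ L.dual ∧ L.quad p.2 ≤ p.1} =>
      c p.1.1 p.1.2 * eFun ((p.1.1 : ℂ) * τ + L.bil (ratVec p.1.2) z)) (φ τ z)

/-- `φ ∈ J_{k,L}`. -/
structure IsJacobiForm (k : ℤ) (φ : ℍ → (Fin n → ℂ) → ℂ) : Prop where
  holomorphic : DifferentiableOn ℂ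
    (fun w : ℂ × (Fin n → ℂ) => φ (UpperHalfPlane.ofComplex w.1) w.2) {w | 0 < w.1.im}
  invariant : ∀ g : JacobiGroup n, L.slash k φ g = φ
  fourier : ∃ c, L.HasFourierExpansion φ c

/-- `φ ∈ S_{k,L}`: the coefficients `C(0, r) = c(β(r), r)` vanish. -/
structure IsCuspForm (k : ℤ) (φ : ℍ → (Fin n → ℂ) → ℂ) : Prop extends L.IsJacobiForm k φ where
  cusp : ∃ c, L.HasFourierExpansion φ c ∧
    ∀ r ∈ L.dual, ∀ m : ℤ, L.quad r = m → c m r = 0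

/-- `ω_{φ,ψ}(τ, z) = φ(τ, z) conj(ψ(τ, z)) v ^ k exp(-4π β(y) / v)`, `v = Im τ`, `y = Im z`. -/
def omega (k : ℤ) (φ ψ : ℍ → (Fin n → ℂ) → ℂ) (τ : ℍ) (z : Fin n → ℂ) : ℂ :=
  φ τ z * (starRingEnd ℂ) (ψ τ z) *
    (((τ.im ^ k * Real.exp (-4 * Real.pi * L.quad (fun i => (z i).im) / τ.im) : ℝ)) : ℂ)

/-- The pairs `(τ, z)` with `τ` in the standard fundamental domain of `SL₂(ℤ)` and `z` in the
fundamental parallelotope of `(L ⊗ ℂ) / (τ L + L)`. -/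
def jacobiDomain (n : ℕ) : Set (ℍ × (Fin n → ℂ)) :=
  {w | w.1 ∈ 𝒟 ∧ ∃ p q : Fin n → ℝ, (∀ i, p i ∈ Set.Ico (0 : ℝ) 1 ∧ q i ∈ Set.Ico (0 : ℝ) 1) ∧
    ∀ i, w.2 i = p i * (w.1 : ℂ) + q i}

/-- The integrand `ω_{φ,ψ}(τ, z) v ^ (-n)`. Since `volume` on `ℍ` is `v ^ (-2) du dv`, integrating
it against `volume` integrates `ω_{φ,ψ}` against `dV_L = v ^ (-n-2) du dv dx dy`. -/
def petIntegrand (k : ℤ) (φ ψ : ℍ → (Fin n → ℂ) → ℂ) (w : ℍ × (Fin n → ℂ)) : ℂ :=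
  L.omega k φ ψ w.1 w.2 * ((w.1.im ^ (-(n : ℤ)) : ℝ) : ℂ)

/-- The Petersson scalar product: the integral over `jacobiDomain n / {id, ι}`, where `ι` is the
reflection `z ↦ -z`. Passing to the quotient divides the integral by the order of `{id, ι}`. -/
def petersson (k : ℤ) (φ ψ : ℍ → (Fin n → ℂ) → ℂ) : ℂ :=
  ((({id, fun z => -z} : Set ((Fin n → ℂ) → (Fin n → ℂ))).ncard : ℂ))⁻¹ *
    ∫ w in jacobiDomain n, L.petIntegrand k φ ψ w

open Classical in
/-- `δ(r, r')`: equal to `1` if `r' ≡ r mod L` and to `0` otherwise. -/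
def delta (r r' : Fin n → ℚ) : ℂ :=
  if ∃ x : Fin n → ℤ, r' - r = intVec ℚ x then 1 else 0

/-- The lattice sum
`H_{L,c}(r, D', r') = ∑ e_c(β(λ + r) d⁻¹ + (β(r') - D') d + β(r', λ + r))`
over `λ ∈ L / cL` and `d ∈ (ℤ / cℤ)ˣ`, with `e_c(x) = e(x / c)`. -/
def latticeSum (c : ℕ) [NeZero c] (r : Fin n → ℚ) (D' : ℚ) (r' : Fin n → ℚ) : ℂ :=
  ∑ l : Fin n → ZMod c, ∑ d : (ZMod c)ˣ,
    let v : Fin n → ℚ := (fun i => ((l i).val : ℚ)) + r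
    eFun (((L.quad v * ((d⁻¹ : (ZMod c)ˣ) : ZMod c).val +
      (L.quad r' - D') * (d : ZMod c).val + L.bil r' v : ℚ) : ℂ) / c)

/-- The `c`-th term of the series in `G_r(D', r')`. -/
def coeffTerm (k : ℤ) (r : Fin n → ℚ) (D' : ℚ) (r' : Fin n → ℚ) (c : ℕ+) : ℂ :=
  ((c : ℕ) : ℂ) ^ (-k) *
    (L.latticeSum c r D' r' + (-1) ^ k * L.latticeSum c (-r) D' r')

/-- The coefficient `G_r(D', r')`. -/
def coeff (k : ℤ) (r : Fin n → ℚ) (D' : ℚ) (r' : Fin n → ℚ) : ℂ :=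
  (((2 * Real.pi) ^ ((k : ℝ) - n / 2) : ℝ) : ℂ) * Complex.I ^ k /
      (2 * ((Real.sqrt L.det * Real.Gamma ((k : ℝ) - n / 2) : ℝ) : ℂ)) *
    (((-(D' : ℝ)) ^ ((k : ℝ) - n / 2 - 1) : ℝ) : ℂ) *
    ∑' c : ℕ+, L.coeffTerm k r D' r' c

/-- The pairs `(D', r')` in the support of `L` with `D' < 0`. -/
def negSupport : Set (ℚ × (Fin n → ℚ)) :=
  {p | p.2 ∈ L.dual ∧ p.1 < 0 ∧ ∃ m : ℤ, p.1 - L.quad p.2 = m}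

/-- The term indexed by `r'` of the singular part. -/
def singularTerm (k : ℤ) (r : Fin n → ℚ) (τ : ℍ) (z : Fin n → ℂ) (r' : L.isotropic) : ℂ :=
  (delta r r' + (-1) ^ k * delta (-r) r') *
    eFun ((τ : ℂ) * L.quad (ratVec (r' : Fin n → ℚ)) + L.bil (ratVec (r' : Fin n → ℚ)) z)

/-- The term indexed by `(D', r')` of the non-singular part. -/
def nonsingularTerm (k : ℤ) (r : Fin n → ℚ) (τ : ℍ) (z : Fin n → ℂ) (p : L.negSupport) : ℂ :=
  L.coeff k r p.1.1 p.1.2 *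
    eFun ((L.quad (ratVec p.1.2) - (p.1.1 : ℂ)) * τ + L.bil (ratVec p.1.2) z)

end EvenLattice

/-- The series `∑ f i` converges absolutely and uniformly on every compact subset of
`ℍ × (L ⊗ ℂ)`, with sum `F`. -/
def ConvergesAbsUnif {n : ℕ} {ι : Type*} (f : ι → ℍ → (Fin n → ℂ) → ℂ)
    (F : ℍ → (Fin n → ℂ) → ℂ) : Prop :=
  ∀ K : Set (ℍ × (Fin n → ℂ)), IsCompact K →
    SummableUniformlyOn (fun i w => ‖f i w.1 w.2‖) K ∧
      HasSumUniformlyOn (fun i w => f i w.1 w.2) (fun w => F w.1 w.2) K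

end

/-!
Write `n` for the rank and `t = τ + d / c`. The partial sum `F_A` is the transform `θ|A` of the theta
series `θ = ∑_λ e(τ β(r + λ) + β(r + λ, z))` (`fiberSum_eq_slashSL`).

*Convergence.* Let `A` have bottom row `(c, d)` with `c > 0`. If `λ` is split by its class modulo `c`,
each class gives a theta series at `-1 / t`, and the theta transformation formula (`theta_transform`,
from Poisson summation and Gaussian integrals) turns `F_A` into a constant times
`c^{-k} (-i t)^{-(k - n/2)} ∑_s W(s) e(τ β(s) + β(s, z))`, where `s` runs through the dual lattice and
`W(s)` is a Gauss sum over `L / cL` (`tsum_slashSL_pos`). The Gauss sums have square root cancellation,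
`|W(s)| ≤ const · c^{n/2}` (`norm_gaussSum_le`). Hence `|F_A| ≤ C |cτ + d|^{-(k - n/2)} Θ(τ, z)` with
`Θ = ∑_s |e(τ β(s) + β(s, z))|` (`exists_norm_fiberSum_le`), and the series of the `F_A` converges like
the classical Eisenstein series of weight `k - n/2 > 2`. For `k > n + 2` no cancellation is needed:
by `exists_term_bound` the terms are dominated by `N^{-k} exp(-a |λ|² / N²)` with `N = max(|c|, |d|)`,
and the sum over `λ` is `O(N^{n-k})`.

*Modularity.* The theta series is invariant under the Heisenberg group, and `SL₂(ℤ)` permutes the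
cosets. Holomorphy follows from Weierstrass' theorem in several variables
(`differentiableOn_tsum_of_locally_bounded`), and the expansion required of a Jacobi form is a
rearrangement of the Fourier expansion.

*Fourier expansion.* In the transformed series the `d` in a fixed class modulo `c` are summed by
Lipschitz' formula (`tsum_lipschitz`), and the sum over the classes recombines the Gauss sums into
`H_c` (`tsum_posTerm_index`). The cosets `± 1` give the singular part. Passing from `A` to `-A`
replaces `r` by `-r` and produces the factor `(-1)^k` (`fiberSum_neg`).

*Orthogonality.* In real coordinates `z = p τ + q` the Petersson integrand becomes a function on
`ℍ × (ℝ / ℤ)ⁿ × (ℝ / ℤ)ⁿ` on which `SL₂(ℤ)` acts by automorphisms of the torus (`petIntegrand_real`,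
`setIntegral_unitBox_coordAct`). A cusp form decays exponentially on the fundamental domain
(`exists_cusp_bound`), so the integral against `∑ F_A` converges absolutely and unfolds to an integral
over the strip `0 ≤ Re τ < 1` against the theta series (`hasSum_setIntegral_fd`,
`integral_omegaReal_eisenstein`). There the integrals over `q` and `Re τ` annihilate every product of
exponentials except those with equal exponents, and at the exponents of the theta series the
coefficients of a cusp form vanish (`integral_horizontal_eq_zero`).
-/

/-! ### The exponential `e(x)` and the automorphy factor -/

theorem norm_eFun (x : ℂ) : ‖eFun x‖ = Real.exp (-2 * Real.pi * x.im) := by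
  rw [eFun, Complex.norm_exp]
  congr 1
  simp [Complex.mul_re, Complex.mul_im]

@[simp] theorem eFun_zero : eFun 0 = 1 := by simp [eFun]

theorem eFun_eq_of_eq_add_int {x y : ℂ} (m : ℤ) (h : x = y + m) : eFun x = eFun y := by
  rw [h, eFun_add_int]

theorem eFun_sum {ι : Type*} (s : Finset ι) (f : ι → ℂ) :
    eFun (∑ i ∈ s, f i) = ∏ i ∈ s, eFun (f i) := by
  simp only [eFun, Finset.mul_sum, Complex.exp_sum]

theorem norm_eFun_ofReal (x : ℝ) : ‖eFun x‖ = 1 := by simp [norm_eFun]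

theorem conj_eFun (x : ℂ) : (starRingEnd ℂ) (eFun x) = eFun (-(starRingEnd ℂ) x) := by
  rw [eFun, eFun, ← Complex.exp_conj]
  congr 1
  simp only [map_mul, Complex.conj_ofReal, Complex.conj_I, map_ofNat]
  ring

theorem differentiable_eFun : Differentiable ℂ eFun := by
  unfold eFun; fun_prop

theorem continuous_eFun : Continuous eFun := differentiable_eFun.continuous

/-- The automorphy factor `cτ + d`. -/
def jfac (A : SL(2, ℤ)) (τ : ℍ) : ℂ := (A 1 0 : ℂ) * τ + (A 1 1 : ℂ)

theorem jfac_ne_zero (A : SL(2, ℤ)) (τ : ℍ) : jfac A τ ≠ 0 := by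
  have := UpperHalfPlane.denom_ne_zero (A : GL (Fin 2) ℝ) τ
  simpa [UpperHalfPlane.denom, jfac] using this

theorem coe_smul_eq (A : SL(2, ℤ)) (τ : ℍ) :
    ((A • τ : ℍ) : ℂ) = ((A 0 0 : ℂ) * τ + (A 0 1 : ℂ)) / jfac A τ := by
  rw [UpperHalfPlane.coe_specialLinearGroup_apply]; simp [jfac]

theorem SL_det (A : SL(2, ℤ)) : A 0 0 * A 1 1 - A 0 1 * A 1 0 = 1 := by
  rw [← Matrix.det_fin_two]; exact A.det_coe

theorem SL_det_complex (A : SL(2, ℤ)) :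
    (A 0 0 : ℂ) * A 1 1 - (A 0 1 : ℂ) * A 1 0 = 1 := by exact_mod_cast SL_det A

theorem SL_mul_apply (A B : SL(2, ℤ)) (i j : Fin 2) :
    (A * B) i j = A i 0 * B 0 j + A i 1 * B 1 j := by
  simp [Matrix.mul_apply, Fin.sum_univ_two]

theorem jfac_mul (A B : SL(2, ℤ)) (τ : ℍ) : jfac (A * B) τ = jfac A (B • τ) * jfac B τ := by
  have hB := jfac_ne_zero B τ
  rw [jfac, jfac, coe_smul_eq]
  field_simp
  simp [jfac, Matrix.mul_apply, Fin.sum_univ_two]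
  ring

theorem im_smul_eq (A : SL(2, ℤ)) (τ : ℍ) : (A • τ).im = τ.im / Complex.normSq (jfac A τ) := by
  rw [ModularGroup.im_smul_eq_div_normSq]
  simp [jfac, UpperHalfPlane.denom]

namespace EvenLattice

variable {n : ℕ} (L : EvenLattice n)

/-! ### The action of the Jacobi group on functions -/

theorem quad_neg (x : Fin n → ℂ) : L.quad (-x) = L.quad x := by
  have := L.quad_smul (-1) x
  simpa using this

theorem slashSL_eq (k : ℤ) (φ : ℍ → (Fin n → ℂ) → ℂ) (A : SL(2, ℤ)) (τ : ℍ) (z : Fin n → ℂ) :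
    L.slashSL k φ A τ z = φ (A • τ) ((jfac A τ)⁻¹ • z) * jfac A τ ^ (-k) *
      eFun (-(A 1 0 : ℂ) * L.quad z / jfac A τ) := rfl

theorem slashSL_mul (k : ℤ) (φ : ℍ → (Fin n → ℂ) → ℂ) (A B : SL(2, ℤ)) :
    L.slashSL k φ (A * B) = L.slashSL k (L.slashSL k φ A) B := by
  funext τ z
  have hB := jfac_ne_zero B τ
  have hA := jfac_ne_zero A (B • τ)
  have e1 : (jfac A (B • τ))⁻¹ • (jfac B τ)⁻¹ • z = (jfac A (B • τ) * jfac B τ)⁻¹ • z := by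
    rw [smul_smul, mul_inv]
  have e2 : eFun (-(((A * B) 1 0 : ℤ) : ℂ) * L.quad z / (jfac A (B • τ) * jfac B τ)) =
      eFun (-(A 1 0 : ℂ) * L.quad ((jfac B τ)⁻¹ • z) / jfac A (B • τ)) *
        eFun (-(B 1 0 : ℂ) * L.quad z / jfac B τ) := by
    rw [← eFun_add, L.quad_smul]
    congr 1
    have h3 : (((A * B) 1 0 : ℤ) : ℂ) * jfac B τ =
        A 1 0 + (B 1 0 : ℂ) * jfac A (B • τ) * jfac B τ := by
      rw [mul_assoc, ← jfac_mul]
      have hd := SL_det_complex B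
      simp only [jfac, SL_mul_apply]
      push_cast
      linear_combination (A 1 0 : ℂ) * hd
    field_simp
    linear_combination (-L.quad z) * h3
  rw [slashSL_eq, slashSL_eq, slashSL_eq, jfac_mul, mul_smul, e1, mul_zpow, e2]
  ring

theorem intVec_add {R : Type*} [Ring R] (x y : Fin n → ℤ) :
    intVec R (x + y) = intVec R x + intVec R y := by ext i; simp [intVec]

theorem intVec_smul (a : ℤ) (x : Fin n → ℤ) :
    intVec ℂ (a • x) = (a : ℂ) • intVec ℂ x := by ext i; simp [intVec]

@[simp] theorem intVec_zero {R : Type*} [Ring R] : intVec R (0 : Fin n → ℤ) = 0 := by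
  ext i; simp [intVec]

theorem slashH_slashH (φ : ℍ → (Fin n → ℂ) → ℂ) (x y x' y' : Fin n → ℤ) :
    L.slashH (L.slashH φ x y) x' y' = L.slashH φ (x + x') (y + y') := by
  funext τ z
  have hb := L.bil_intVec x y'
  have e1 : z + (τ : ℂ) • intVec ℂ (x + x') + intVec ℂ (y + y') =
      z + (τ : ℂ) • intVec ℂ x' + intVec ℂ y' + (τ : ℂ) • intVec ℂ x + intVec ℂ y := by
    rw [intVec_add, intVec_add]; module
  unfold slashH
  rw [e1, mul_assoc, ← eFun_add]
  congr 1
  refine eFun_eq_of_eq_add_int (L.bil x y') ?_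
  rw [intVec_add, quad_add]
  simp only [bil_add_right, bil_add_left, bil_smul_right, hb]
  ring

theorem slashH_slashSL (k : ℤ) (φ : ℍ → (Fin n → ℂ) → ℂ) (A : SL(2, ℤ)) (x y : Fin n → ℤ) :
    L.slashH (L.slashSL k φ A) (A 0 0 • x + A 1 0 • y) (A 0 1 • x + A 1 1 • y) =
      L.slashSL k (L.slashH φ x y) A := by
  funext τ z
  have hA := jfac_ne_zero A τ
  have hd := SL_det_complex A
  have hb := L.bil_intVec x y
  obtain ⟨qx, hqx⟩ := L.quad_intVec x
  obtain ⟨qy, hqy⟩ := L.quad_intVec y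
  unfold slashH
  rw [slashSL_eq, slashSL_eq, intVec_add, intVec_add]
  simp only [intVec_smul]
  have hj : jfac A τ = (A 1 0 : ℂ) * τ + A 1 1 := rfl
  set j := jfac A τ
  have hs := coe_smul_eq A τ
  rw [show jfac A τ = j from rfl] at hs
  clear_value j
  generalize (A • τ : ℍ) = τ' at *
  generalize (A 0 0 : ℤ) = a at *
  generalize (A 0 1 : ℤ) = b at *
  generalize (A 1 0 : ℤ) = c at *
  generalize (A 1 1 : ℤ) = d at *
  have hN : z + (τ : ℂ) • ((a : ℂ) • intVec ℂ x + (c : ℂ) • intVec ℂ y) +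
      ((b : ℂ) • intVec ℂ x + (d : ℂ) • intVec ℂ y) =
      z + ((a : ℂ) * τ + b) • intVec ℂ x + j • intVec ℂ y := by
    rw [hj]; module
  have hz : j⁻¹ • (z + ((a : ℂ) * τ + b) • intVec ℂ x + j • intVec ℂ y) =
      j⁻¹ • z + (τ' : ℂ) • intVec ℂ x + intVec ℂ y := by
    rw [hs, smul_add, smul_add, smul_smul, smul_smul, inv_mul_cancel₀ hA, one_smul]
    congr 3
    field_simp
  rw [hN, hz]
  have key : eFun (-(c : ℂ) * L.quad (z + ((a : ℂ) * τ + b) • intVec ℂ x + j • intVec ℂ y) / j) *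
      eFun ((τ : ℂ) * L.quad ((a : ℂ) • intVec ℂ x + (c : ℂ) • intVec ℂ y) +
        L.bil ((a : ℂ) • intVec ℂ x + (c : ℂ) • intVec ℂ y) z) =
      eFun ((τ' : ℂ) * L.quad (intVec ℂ x) + L.bil (intVec ℂ x) (j⁻¹ • z)) *
      eFun (-(c : ℂ) * L.quad z / j) := by
    rw [← eFun_add, ← eFun_add]
    refine eFun_eq_of_eq_add_int (-(a * b * qx + c * d * qy + c * b * L.bil x y)) ?_
    simp only [quad_add, quad_smul, bil_add_left, bil_smul_left, bil_smul_right,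
      hs, hqx, hqy, hb, L.bil_comm z]
    push_cast
    have h1 : (c : ℂ) * (a * τ + b) + 1 = a * j := by rw [hj]; linear_combination -hd
    field_simp
    linear_combination (-(a * τ + b) * qx - L.bil (intVec ℂ x) z) * h1 - c * j * qy * hj
  linear_combination φ τ' (j⁻¹ • z + (τ' : ℂ) • intVec ℂ x + intVec ℂ y) *
    j ^ (-k) * key

theorem slashH_zero (φ : ℍ → (Fin n → ℂ) → ℂ) : L.slashH φ 0 0 = φ := by
  funext τ z
  simp [slashH, quad, bil]

theorem slashSL_one (k : ℤ) (φ : ℍ → (Fin n → ℂ) → ℂ) : L.slashSL k φ 1 = φ := by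
  funext τ z
  simp [slashSL_eq, jfac]

theorem ratVec_add_intVec (r : Fin n → ℚ) (l : Fin n → ℤ) :
    ratVec (r + intVec ℚ l) = ratVec r + intVec ℂ l := by
  ext i; simp [ratVec, intVec]

theorem slashH_gFun {r : Fin n → ℚ} (l : Fin n → ℤ) :
    L.slashH (L.gFun r) l 0 = L.gFun (r + intVec ℚ l) := by
  funext τ z
  unfold slashH gFun
  rw [← eFun_add, ratVec_add_intVec, quad_add]
  simp only [bil_add_right, bil_add_left, bil_smul_right, intVec_zero, add_zero]
  congr 1
  ring

end EvenLattice

/-! ### Cosets -/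

/-- The coset `SL₂(ℤ)_∞ A`. -/
def SLCosets.mk (A : SL(2, ℤ)) : SLCosets := Quotient.mk _ A

theorem SLCosets.mk_eq_iff {A B : SL(2, ℤ)} :
    SLCosets.mk A = SLCosets.mk B ↔ A 1 0 = B 1 0 ∧ A 1 1 = B 1 1 := by
  have h : SLCosets.mk A = SLCosets.mk B ↔ B * A⁻¹ ∈ slParabolic := by
    rw [← QuotientGroup.rightRel_apply]; exact Quotient.eq
  rw [h]
  have hA := SL_det A
  have hB := SL_det B
  change ((B * A⁻¹) 0 0 = 1 ∧ (B * A⁻¹) 1 0 = 0 ∧ (B * A⁻¹) 1 1 = 1) ↔ _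
  have e : ∀ i, (B * A⁻¹) i 0 = B i 0 * A 1 1 - B i 1 * A 1 0 ∧
      (B * A⁻¹) i 1 = -B i 0 * A 0 1 + B i 1 * A 0 0 := by
    intro i
    rw [SL_mul_apply, SL_mul_apply]
    simp [SpecialLinearGroup.SL2_inv_expl]
    ring
  rw [(e 0).1, (e 1).1, (e 1).2]
  generalize A 0 0 = a at *
  generalize A 0 1 = b at *
  generalize A 1 0 = c at *
  generalize A 1 1 = d at *
  constructor
  · rintro ⟨-, h2, h3⟩
    constructor
    · linear_combination B 1 0 * hA - a * h2 - c * h3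
    · linear_combination B 1 1 * hA - b * h2 - d * h3
  · rintro ⟨rfl, rfl⟩
    refine ⟨by linear_combination hB, by ring, by linear_combination hA⟩

/-- The bottom row `(c, d)` of the matrices in a coset of `SL₂(ℤ)_∞`. -/
noncomputable def SLCosets.row (q : SLCosets) : Fin 2 → ℤ := q.out 1

theorem SLCosets.mk_out (q : SLCosets) : SLCosets.mk q.out = q := Quotient.out_eq q

theorem SLCosets.row_mk (A : SL(2, ℤ)) : (SLCosets.mk A).row = A 1 := by
  have := SLCosets.mk_eq_iff.mp (SLCosets.mk A).mk_out
  ext i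
  fin_cases i
  · exact this.1
  · exact this.2

theorem SLCosets.row_injective : Function.Injective SLCosets.row := by
  intro p q h
  rw [← p.mk_out, ← q.mk_out, SLCosets.mk_eq_iff]
  exact ⟨congrFun h 0, congrFun h 1⟩

theorem SLCosets.row_ne_zero (q : SLCosets) : q.row ≠ 0 := by
  intro h
  have := SL_det q.out
  have h0 : q.out 1 0 = 0 := congrFun h 0
  have h1 : q.out 1 1 = 0 := congrFun h 1
  simp [h0, h1] at this

theorem SL_bottom_row_ne_zero (A : SL(2, ℤ)) : A 1 ≠ 0 := by
  rw [← SLCosets.row_mk]; exact SLCosets.row_ne_zero _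

namespace JacobiCosets

variable {n : ℕ}

/-- The coset `J_∞ g`. -/
def mk (g : JacobiGroup n) : JacobiCosets n := Quotient.mk _ g

theorem mk_eq_iff {g h : JacobiGroup n} :
    mk g = mk h ↔ ∃ p ∈ JacobiGroup.parabolic n, h = p * g := by
  have : mk g = mk h ↔ h * g⁻¹ ∈ JacobiGroup.parabolic n := by
    rw [← QuotientGroup.rightRel_apply]; exact Quotient.eq
  rw [this]
  constructor
  · intro h1; exact ⟨_, h1, by simp⟩
  · rintro ⟨p, hp, rfl⟩; simpa using hp

/-- The map `λ ↦ J_∞ (1, (λ, 0)) (A, 0)`, which parametrizes the fibre over `SL₂(ℤ)_∞ A`. -/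
def ofVec (A : SL(2, ℤ)) (l : Fin n → ℤ) : JacobiCosets n :=
  mk { mat := A, x := A 0 0 • l, y := A 0 1 • l }

theorem ofVec_bijective (A : SL(2, ℤ)) :
    Function.Bijective (fun l : Fin n → ℤ =>
      (⟨ofVec A l, rfl⟩ : {p : JacobiCosets n // p.toSL = SLCosets.mk A})) := by
  have hd := SL_det A
  constructor
  · intro l l' h
    obtain ⟨p, hp, h⟩ := mk_eq_iff.mp (Subtype.mk.inj h)
    have hx := congrArg JacobiGroup.x h
    have hy := congrArg JacobiGroup.y h
    have hp0 : p.x = 0 := hp.2.2.2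
    funext i
    have hx := congrFun hx i
    have hy := congrFun hy i
    simp only [JacobiGroup.mul_x, JacobiGroup.mul_y, hp0, smul_zero, zero_add, Pi.add_apply,
      Pi.smul_apply, smul_eq_mul] at hx hy
    linear_combination A 1 0 * hy - A 1 1 * hx + (l' i - l i) * hd
  · rintro ⟨p, hp⟩
    obtain ⟨g, rfl⟩ := Quotient.exists_rep p
    have hg : SLCosets.mk g.mat = SLCosets.mk A := hp
    have hP : A * g.mat⁻¹ ∈ slParabolic := by
      rw [← QuotientGroup.rightRel_apply]; exact Quotient.eq.mp hg
    refine ⟨A 1 1 • g.x - A 1 0 • g.y, Subtype.ext ?_⟩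
    symm
    refine mk_eq_iff.mpr ⟨{ mat := A * g.mat⁻¹, x := 0, y := g.mat⁻¹ 0 0 • 0 +
      (A 0 1 • g.x - A 0 0 • g.y) }, ⟨hP.1, hP.2.1, hP.2.2, rfl⟩, ?_⟩
    have hrow := SLCosets.mk_eq_iff.mp hg
    ext i
    · simp
    · simp [hrow.1]
      linear_combination (g.x i) * hd
    · simp [hrow.2]
      linear_combination (g.y i) * hd

/-- The fibre of `J_∞ \ J → SL₂(ℤ)_∞ \ SL₂(ℤ)` over `SL₂(ℤ)_∞ A` is a copy of `L = ℤⁿ`. -/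
noncomputable def fiberEquiv (A : SL(2, ℤ)) :
    (Fin n → ℤ) ≃ {p : JacobiCosets n // p.toSL = SLCosets.mk A} :=
  Equiv.ofBijective _ (ofVec_bijective A)

end JacobiCosets

namespace EvenLattice

variable {n : ℕ} (L : EvenLattice n)

theorem seriesTerm_mk (k : ℤ) (r : L.isotropic) (g : JacobiGroup n) :
    L.seriesTerm k r (JacobiCosets.mk g) = L.slash k (L.gFun r) g := rfl

theorem seriesTerm_fiberEquiv (k : ℤ) (r : L.isotropic) (A : SL(2, ℤ)) (l : Fin n → ℤ) :
    L.seriesTerm k r (JacobiCosets.fiberEquiv A l) =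
      L.slashSL k (L.gFun (r + intVec ℚ l)) A := by
  change L.seriesTerm k r (JacobiCosets.mk _) = _
  rw [seriesTerm_mk, slash]
  have := L.slashH_slashSL k (L.gFun r) A l 0
  rw [slashH_gFun] at this
  rw [← this]
  simp

theorem fiberSum_mk (k : ℤ) (r : L.isotropic) (A : SL(2, ℤ)) (τ : ℍ) (z : Fin n → ℂ) :
    L.fiberSum k r (SLCosets.mk A) τ z =
      ∑' l : Fin n → ℤ, L.slashSL k (L.gFun (r + intVec ℚ l)) A τ z := by
  rw [fiberSum, ← (JacobiCosets.fiberEquiv A).tsum_eq]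
  simp only [seriesTerm_fiberEquiv]

end EvenLattice

namespace EvenLattice

variable {n : ℕ} (L : EvenLattice n)

/-! ### The real quadratic form -/

theorem quad_add_field {K : Type*} [Field K] [CharZero K] (x y : Fin n → K) :
    L.quad (x + y) = L.quad x + L.quad y + L.bil x y := by
  simp only [quad, bil_add_left, bil_add_right, L.bil_comm y x]
  ring

theorem quad_smul_field {K : Type*} [Field K] (a : K) (x : Fin n → K) :
    L.quad (a • x) = a ^ 2 * L.quad x := by
  simp only [quad, bil_smul_left, bil_smul_right]
  ring

theorem bil_map {R S : Type*} [CommRing R] [CommRing S] (f : R →+* S) (x y : Fin n → R) :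
    L.bil (fun i => f (x i)) (fun i => f (y i)) = f (L.bil x y) := by
  simp [bil, dotProduct, mulVec]

theorem quad_map {K K' : Type*} [Field K] [Field K'] (f : K →+* K') (x : Fin n → K) :
    L.quad (fun i => f (x i)) = f (L.quad x) := by
  simp [quad, bil_map, map_ofNat f 2]

theorem gram_det_ne_zero : L.gram.det ≠ 0 := by
  intro h
  obtain ⟨v, hv, hv0⟩ := Matrix.exists_mulVec_eq_zero_iff.mpr h
  have := L.pos v hv
  simp [hv0] at this

theorem gram_map_det {K : Type*} [CommRing K] :
    (L.gram.map (Int.cast : ℤ → K)).det = (L.gram.det : K) := by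
  exact (Int.cast_det L.gram).symm

theorem gram_map_det_ne_zero {K : Type*} [CommRing K] [CharZero K] :
    (L.gram.map (Int.cast : ℤ → K)).det ≠ 0 := by
  rw [gram_map_det]; exact_mod_cast L.gram_det_ne_zero

theorem quad_intVec_nonneg (x : Fin n → ℤ) : 0 ≤ L.quad (intVec ℚ x) := by
  have h1 : L.bil (intVec ℚ x) (intVec ℚ x) = ((x ⬝ᵥ L.gram *ᵥ x : ℤ) : ℚ) := by
    simp [bil, intVec, dotProduct, mulVec]
  rw [quad, h1]
  have : 0 ≤ x ⬝ᵥ L.gram *ᵥ x := by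
    by_cases h : x = 0
    · simp [h]
    · exact (L.pos x h).le
  have : (0 : ℚ) ≤ ((x ⬝ᵥ L.gram *ᵥ x : ℤ) : ℚ) := by exact_mod_cast this
  linarith

theorem quad_rat_nonneg (x : Fin n → ℚ) : 0 ≤ L.quad x := by
  -- clear denominators
  set N : ℕ := ∏ i, (x i).den with hN
  have hNpos : 0 < N := Finset.prod_pos fun i _ => (x i).den_pos
  have hx : ∀ i, ∃ m : ℤ, (N : ℚ) * x i = m := by
    intro i
    obtain ⟨t, ht⟩ := Finset.dvd_prod_of_mem (fun i => (x i).den) (Finset.mem_univ i)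
    refine ⟨t * (x i).num, ?_⟩
    rw [hN, ht]
    push_cast
    have := Rat.mul_den_eq_num (x i)
    linear_combination (t : ℚ) * this
  choose m hm using hx
  have h1 : (N : ℚ) • x = intVec ℚ m := by ext i; simp [intVec, hm]
  have h2 := L.quad_intVec_nonneg m
  rw [← h1, quad_smul_field] at h2
  have : (0 : ℚ) < (N : ℚ) ^ 2 := by positivity
  exact nonneg_of_mul_nonneg_right h2 this

theorem continuous_quad_real : Continuous (fun x : Fin n → ℝ => L.quad x) := by
  unfold quad bil dotProduct mulVec dotProduct
  fun_prop

theorem continuous_quad_complex : Continuous (fun x : Fin n → ℂ => L.quad x) := by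
  unfold quad bil dotProduct mulVec dotProduct
  fun_prop

theorem quad_real_nonneg (x : Fin n → ℝ) : 0 ≤ L.quad x := by
  have hd : DenseRange (Pi.map (fun _ : Fin n => (Rat.cast : ℚ → ℝ))) :=
    DenseRange.piMap fun _ => Rat.isDenseEmbedding_coe_real.dense
  refine hd.induction_on (p := fun x : Fin n → ℝ => 0 ≤ L.quad x) x
    (isClosed_le continuous_const L.continuous_quad_real) ?_
  intro y
  have := L.quad_map (Rat.castHom ℝ) y
  change 0 ≤ L.quad (fun i => (Rat.castHom ℝ) (y i))
  rw [this]
  simpa using L.quad_rat_nonneg y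

theorem quad_real_pos {x : Fin n → ℝ} (hx : x ≠ 0) : 0 < L.quad x := by
  refine lt_of_le_of_ne (L.quad_real_nonneg x) fun h => hx ?_
  have hsym : (L.gram.map (Int.cast : ℤ → ℝ)).IsHermitian := by
    rw [Matrix.IsHermitian, Matrix.conjTranspose_eq_transpose_of_trivial, ← Matrix.transpose_map,
      L.symm]
  have hb : ∀ y : Fin n → ℝ, 0 ≤ y ⬝ᵥ L.gram.map (Int.cast : ℤ → ℝ) *ᵥ y := by
    intro y
    have := L.quad_real_nonneg y
    rw [quad, bil] at this
    linarith
  have hP : (L.gram.map (Int.cast : ℤ → ℝ)).PosSemidef :=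
    Matrix.PosSemidef.of_dotProduct_mulVec_nonneg hsym (by simpa using hb)
  have h0 : L.gram.map (Int.cast : ℤ → ℝ) *ᵥ x = 0 := by
    rw [← hP.dotProduct_mulVec_zero_iff]
    rw [quad, bil] at h
    simpa using (show x ⬝ᵥ L.gram.map (Int.cast : ℤ → ℝ) *ᵥ x = 0 by linarith)
  exact Matrix.eq_zero_of_mulVec_eq_zero L.gram_map_det_ne_zero h0

/-- The form is bounded below by a multiple of the square of the sup norm. -/
theorem exists_quad_lower_bound : ∃ ε > 0, ∀ x : Fin n → ℝ, ε * ‖x‖ ^ 2 ≤ L.quad x := by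
  by_cases hn : (Metric.sphere (0 : Fin n → ℝ) 1).Nonempty
  · obtain ⟨x₀, hx₀, hmin⟩ := (isCompact_sphere (0 : Fin n → ℝ) 1).exists_isMinOn hn
      L.continuous_quad_real.continuousOn
    have hx₀' : x₀ ≠ 0 := by
      rintro rfl; simp at hx₀
    refine ⟨L.quad x₀, L.quad_real_pos hx₀', fun x => ?_⟩
    by_cases hx : x = 0
    · subst hx; simpa using L.quad_real_nonneg 0
    have hx' : ‖x‖ ≠ 0 := norm_ne_zero_iff.mpr hx
    have h1 : L.quad x₀ ≤ L.quad (‖x‖⁻¹ • x) := by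
      apply hmin
      simp [norm_smul, hx']
    rw [quad_smul_field] at h1
    have : L.quad x = ‖x‖ ^ 2 * (‖x‖⁻¹ ^ 2 * L.quad x) := by field_simp
    rw [this, mul_comm]
    gcongr
  · refine ⟨1, one_pos, fun x => ?_⟩
    have : x = 0 := by
      by_contra hx
      exact hn ⟨‖x‖⁻¹ • x, by simp [norm_smul, norm_ne_zero_iff.mpr hx]⟩
    subst this
    simpa using L.quad_real_nonneg 0

/-! ### The dual lattice -/

/-- The element `G⁻¹ m` of the dual lattice. -/
noncomputable def dualVec (m : Fin n → ℤ) : Fin n → ℚ :=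
  (L.gram.map (Int.cast : ℤ → ℚ))⁻¹ *ᵥ intVec ℚ m

theorem gram_mulVec_dualVec (m : Fin n → ℤ) :
    L.gram.map (Int.cast : ℤ → ℚ) *ᵥ L.dualVec m = intVec ℚ m := by
  rw [dualVec, mulVec_mulVec, Matrix.mul_nonsing_inv, one_mulVec]
  exact isUnit_iff_ne_zero.mpr L.gram_map_det_ne_zero

theorem bil_dualVec (m : Fin n → ℤ) (x : Fin n → ℚ) :
    L.bil (L.dualVec m) x = intVec ℚ m ⬝ᵥ x := by
  rw [bil_comm, bil, gram_mulVec_dualVec, dotProduct_comm]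

theorem dualVec_mem (m : Fin n → ℤ) : L.dualVec m ∈ L.dual := by
  intro x
  refine ⟨m ⬝ᵥ x, ?_⟩
  rw [bil_dualVec]
  simp [dotProduct, intVec]

theorem gram_mulVec_real_dualVec (m : Fin n → ℤ) :
    L.gram.map (Int.cast : ℤ → ℝ) *ᵥ (fun i => (L.dualVec m i : ℝ)) = intVec ℝ m := by
  ext i
  have := congrFun (L.gram_mulVec_dualVec m) i
  have := congrArg (Rat.cast : ℚ → ℝ) this
  simpa [mulVec, dotProduct, intVec] using this

theorem bil_real_dualVec (m : Fin n → ℤ) (x : Fin n → ℝ) :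
    L.bil (fun i => (L.dualVec m i : ℝ)) x = intVec ℝ m ⬝ᵥ x := by
  rw [bil_comm, bil, gram_mulVec_real_dualVec, dotProduct_comm]

/-- The parametrization `m ↦ G⁻¹ m` of the dual lattice by `ℤⁿ`. -/
noncomputable def dualEquiv : (Fin n → ℤ) ≃ L.dual :=
  Equiv.ofBijective (fun m => ⟨L.dualVec m, L.dualVec_mem m⟩) (by
    constructor
    · intro m m' h
      have h1 := congrArg (fun v => L.gram.map (Int.cast : ℤ → ℚ) *ᵥ v) (Subtype.mk.inj h)
      simp only [gram_mulVec_dualVec] at h1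
      ext i
      simpa [intVec] using congrFun h1 i
    · rintro ⟨y, hy⟩
      choose m hm using fun i : Fin n => hy (Pi.single i 1)
      refine ⟨m, Subtype.ext ?_⟩
      have h1 : L.gram.map (Int.cast : ℤ → ℚ) *ᵥ y = intVec ℚ m := by
        ext i
        have h2 := hm i
        have h3 : intVec ℚ (Pi.single i 1 : Fin n → ℤ) = Pi.single i 1 := by
          ext j; by_cases hj : j = i
          · subst hj; simp [intVec]
          · simp [intVec, hj]
        rw [bil_comm, bil, h3, single_one_dotProduct] at h2
        simpa [intVec] using h2
      change L.dualVec m = y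
      rw [dualVec, ← h1, mulVec_mulVec, Matrix.nonsing_inv_mul, one_mulVec]
      exact isUnit_iff_ne_zero.mpr L.gram_map_det_ne_zero)

@[simp] theorem dualEquiv_apply (m : Fin n → ℤ) : (L.dualEquiv m : Fin n → ℚ) = L.dualVec m := rfl

/-- Positive definiteness in the coordinates `m ↦ G⁻¹ m` of the dual lattice, with a real shift `p`. -/
theorem exists_dual_lower_bound : ∃ ε > 0, ∀ (m : Fin n → ℤ) (p : Fin n → ℝ),
    ε * ‖intVec ℝ m + L.gram.map (Int.cast : ℤ → ℝ) *ᵥ p‖ ^ 2 ≤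
      L.quad ((fun i => (L.dualVec m i : ℝ)) + p) := by
  obtain ⟨ε, hε, h⟩ := L.exists_quad_lower_bound
  set f : (Fin n → ℝ) →L[ℝ] (Fin n → ℝ) :=
    LinearMap.toContinuousLinearMap (Matrix.mulVecLin (L.gram.map (Int.cast : ℤ → ℝ))) with hf
  have hM : 0 < ‖f‖ + 1 := by positivity
  refine ⟨ε / (‖f‖ + 1) ^ 2, by positivity, fun m p => ?_⟩
  refine le_trans ?_ (h _)
  have h1 : intVec ℝ m + L.gram.map (Int.cast : ℤ → ℝ) *ᵥ p =
      f ((fun i => (L.dualVec m i : ℝ)) + p) := by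
    rw [map_add, ← gram_mulVec_real_dualVec]; rfl
  have h2 : ‖f ((fun i => (L.dualVec m i : ℝ)) + p)‖ ≤
      (‖f‖ + 1) * ‖(fun i => (L.dualVec m i : ℝ)) + p‖ :=
    (f.le_opNorm _).trans (by gcongr; linarith)
  rw [h1, div_mul_eq_mul_div, div_le_iff₀ (by positivity)]
  calc ε * ‖f ((fun i => (L.dualVec m i : ℝ)) + p)‖ ^ 2
      ≤ ε * ((‖f‖ + 1) * ‖(fun i => (L.dualVec m i : ℝ)) + p‖) ^ 2 := by gcongr
    _ = _ := by ring

end EvenLattice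

/-! ### Gaussian sums over `ℤⁿ` -/

theorem summable_pi_prod {g : ℤ → ℝ} (hg : Summable g) (h0 : ∀ x, 0 ≤ g x) (n : ℕ) :
    Summable (fun m : Fin n → ℤ => ∏ i, g (m i)) := by
  induction n with
  | zero => exact (hasSum_fintype _).summable
  | succ n ih =>
    rw [← (Fin.consEquiv (fun _ => ℤ)).summable_iff]
    have := hg.mul_of_nonneg ih h0 (fun m => Finset.prod_nonneg fun i _ => h0 _)
    refine this.congr fun x => ?_
    simp [Fin.consEquiv, Fin.prod_univ_succ]

theorem norm_intVec_real {n : ℕ} (m : Fin n → ℤ) : ‖intVec ℝ m‖ = ‖m‖ := by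
  rw [Pi.norm_def, Pi.norm_def]
  congr 2

theorem summable_exp_neg_norm_sq {n : ℕ} {a : ℝ} (ha : 0 < a) :
    Summable (fun m : Fin n → ℤ => Real.exp (-a * ‖m‖ ^ 2)) := by
  rcases Nat.eq_zero_or_pos n with rfl | hn
  · exact (hasSum_fintype _).summable
  have hn' : (0 : ℝ) < n := by exact_mod_cast hn
  have h1 : Summable (fun j : ℤ => Real.exp (-(a / n) * (j : ℝ) ^ 2)) := by
    have hb : 0 < a / n := by positivity
    have key : Summable (fun j : ℕ => Real.exp (-(a / n) * (j : ℝ) ^ 2)) := by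
      refine Summable.of_nonneg_of_le (fun _ => (Real.exp_pos _).le) (fun j => ?_)
        (Real.summable_exp_nat_mul_iff.mpr (neg_lt_zero.mpr hb))
      have : (j : ℝ) ≤ (j : ℝ) ^ 2 := by exact_mod_cast Nat.le_self_pow (two_ne_zero) j
      exact Real.exp_le_exp.mpr (by nlinarith)
    refine Summable.of_nat_of_neg (by simpa using key) (by simpa using key)
  refine Summable.of_nonneg_of_le (fun _ => (Real.exp_pos _).le) (fun m => ?_)
    (summable_pi_prod h1 (fun _ => (Real.exp_pos _).le) n)
  rw [← Real.exp_sum]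
  gcongr
  have h2 : ∑ i, ((m i : ℝ)) ^ 2 ≤ n * ‖m‖ ^ 2 := by
    have : ∀ i ∈ Finset.univ, ((m i : ℝ)) ^ 2 ≤ ‖m‖ ^ 2 := by
      intro i _
      rw [← sq_abs]
      gcongr
      exact (Int.norm_eq_abs _).symm.trans_le (norm_le_pi_norm m i)
    simpa using Finset.sum_le_sum this
  rw [← Finset.mul_sum, neg_mul, neg_mul, neg_le_neg_iff, div_mul_eq_mul_div, div_le_iff₀ hn']
  calc a * ∑ i, ((m i : ℝ)) ^ 2 ≤ a * (n * ‖m‖ ^ 2) := by gcongr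
    _ = _ := by ring

/-- Division with remainder by `c` in `ℤⁿ`: every vector is `c μ + l` with `l` a vector of
representatives modulo `c`. -/
def blockEquiv (n c : ℕ) [NeZero c] : (Fin n → ZMod c) × (Fin n → ℤ) ≃ (Fin n → ℤ) where
  toFun x := fun i => c * x.2 i + (x.1 i).val
  invFun m := (fun i => (m i : ZMod c), fun i => m i / c)
  left_inv := by
    rintro ⟨l, q⟩
    have hc : (c : ℤ) ≠ 0 := by exact_mod_cast NeZero.ne c
    ext i
    · simp
    · change (c * q i + ((l i).val : ℤ)) / c = q i
      rw [Int.mul_add_ediv_left _ _ hc, Int.ediv_eq_zero_of_lt (by positivity)]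
      · simp
      · exact_mod_cast ZMod.val_lt (l i)
  right_inv := by
    intro m
    ext i
    simp only [ZMod.val_intCast]
    exact Int.mul_ediv_add_emod (m i) c

theorem blockEquiv_apply {n c : ℕ} [NeZero c] (l : Fin n → ZMod c) (q : Fin n → ℤ) :
    blockEquiv n c (l, q) = fun i => c * q i + (l i).val := rfl

/-- `∑_m exp(-a ‖m‖² / N²) = O(Nⁿ)`. -/
theorem exists_sum_exp_le {n : ℕ} {a : ℝ} (ha : 0 < a) : ∃ C > 0, ∀ N : ℕ, 0 < N →
    Summable (fun m : Fin n → ℤ => Real.exp (-a * (‖m‖ / N) ^ 2)) ∧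
      ∑' m : Fin n → ℤ, Real.exp (-a * (‖m‖ / N) ^ 2) ≤ C * (N : ℝ) ^ n := by
  have hs := summable_exp_neg_norm_sq (n := n) (half_pos ha)
  refine ⟨Real.exp a * ∑' m : Fin n → ℤ, Real.exp (-(a / 2) * ‖m‖ ^ 2), ?_, fun N hN => ?_⟩
  · have := hs.tsum_pos (fun _ => (Real.exp_pos _).le) 0 (Real.exp_pos _)
    positivity
  have : NeZero N := ⟨hN.ne'⟩
  have hN' : (0 : ℝ) < N := by exact_mod_cast hN
  have hle : ∀ x : (Fin n → ZMod N) × (Fin n → ℤ),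
      Real.exp (-a * (‖blockEquiv n N x‖ / N) ^ 2) ≤
        (fun _ => Real.exp a) x.1 * (fun q => Real.exp (-(a / 2) * ‖q‖ ^ 2)) x.2 := by
    rintro ⟨l, q⟩
    rw [← Real.exp_add]
    gcongr
    -- `q` is the integral part of `m / N`, so `‖q‖ ≤ ‖m‖ / N + 1`; each `q` occurs `Nⁿ` times.
    have h1 : (‖q‖ : ℝ) ≤ ‖blockEquiv n N (l, q)‖ / N + 1 := by
      rw [← sub_le_iff_le_add, le_div_iff₀ hN', sub_mul, one_mul, sub_le_iff_le_add]
      have e : (N : ℤ) • q = blockEquiv n N (l, q) - fun i => ((l i).val : ℤ) := by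
        ext i; simp [blockEquiv_apply]
      have e1 : ‖(N : ℤ) • q‖ = ‖q‖ * N := by
        rw [norm_smul]; simp [mul_comm]
      rw [← e1, e]
      refine (norm_sub_le _ _).trans ?_
      gcongr
      refine (pi_norm_le_iff_of_nonneg hN'.le).mpr fun i => ?_
      simp only [Int.norm_natCast]
      exact_mod_cast (ZMod.val_lt (l i)).le
    have h2 : (‖q‖ : ℝ) ^ 2 ≤ (‖blockEquiv n N (l, q)‖ / N + 1) ^ 2 := by gcongr
    nlinarith [mul_le_mul_of_nonneg_left h2 ha.le,
      mul_nonneg ha.le (sq_nonneg (‖blockEquiv n N (l, q)‖ / N - 1 : ℝ))]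
  have hsum : Summable (fun x : (Fin n → ZMod N) × (Fin n → ℤ) =>
      (fun _ => Real.exp a) x.1 * (fun q => Real.exp (-(a / 2) * ‖q‖ ^ 2)) x.2) :=
    Summable.mul_of_nonneg (f := fun _ : Fin n → ZMod N => Real.exp a)
      (hasSum_fintype _).summable hs (fun _ => (Real.exp_pos _).le) (fun _ => (Real.exp_pos _).le)
  have hsum' := Summable.of_nonneg_of_le (fun _ => (Real.exp_pos _).le) hle hsum
  refine ⟨(blockEquiv n N).summable_iff.mp hsum', ?_⟩
  rw [← (blockEquiv n N).tsum_eq]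
  refine (hsum'.tsum_le_tsum hle hsum).trans ?_
  rw [hsum.tsum_prod]
  simp only [tsum_mul_left, tsum_fintype, Finset.sum_const, Finset.card_univ, Fintype.card_pi,
    Finset.prod_const, ZMod.card, Fintype.card_fin, nsmul_eq_mul]
  push_cast
  linarith

theorem norm_sq_shift_le {E : Type*} [SeminormedAddCommGroup E] (x y : E) :
    ‖x‖ ^ 2 / 2 - ‖y‖ ^ 2 ≤ ‖x + y‖ ^ 2 := by
  have h1 : ‖x‖ ≤ ‖x + y‖ + ‖y‖ := by simpa using norm_sub_le (x + y) y
  have h2 : ‖x‖ ^ 2 ≤ (‖x + y‖ + ‖y‖) ^ 2 := by gcongr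
  nlinarith [sq_nonneg (‖x + y‖ - ‖y‖)]

/-- Gaussian sums over translates of `ℤⁿ` are bounded uniformly in the translation. -/
theorem exists_sum_exp_shift_le {n : ℕ} {a : ℝ} (ha : 0 < a) : ∃ C > 0, ∀ x : Fin n → ℝ,
    Summable (fun m : Fin n → ℤ => Real.exp (-a * ‖intVec ℝ m + x‖ ^ 2)) ∧
      ∑' m : Fin n → ℤ, Real.exp (-a * ‖intVec ℝ m + x‖ ^ 2) ≤ C := by
  have hs := summable_exp_neg_norm_sq (n := n) (half_pos ha)
  refine ⟨∑' m : Fin n → ℤ, Real.exp a * Real.exp (-(a / 2) * ‖m‖ ^ 2), ?_, fun x => ?_⟩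
  · rw [tsum_mul_left]
    have := hs.tsum_pos (fun _ => (Real.exp_pos _).le) 0 (Real.exp_pos _)
    positivity
  have hle : ∀ m : Fin n → ℤ,
      Real.exp (-a * ‖intVec ℝ (Equiv.subRight (fun i => ⌊x i⌋) m) + x‖ ^ 2) ≤
        Real.exp a * Real.exp (-(a / 2) * ‖m‖ ^ 2) := by
    intro m
    rw [← Real.exp_add]
    gcongr
    have e : intVec ℝ (Equiv.subRight (fun i => ⌊x i⌋) m) + x =
        intVec ℝ m + fun i => Int.fract (x i) := by
      ext i; simp [intVec, ← Int.self_sub_floor]; ring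
    have h1 := norm_sq_shift_le (intVec ℝ m) (fun i => Int.fract (x i))
    have h2 : ‖(fun i => Int.fract (x i))‖ ≤ 1 := by
      refine (pi_norm_le_iff_of_nonneg zero_le_one).mpr fun i => ?_
      rw [Real.norm_of_nonneg (Int.fract_nonneg _)]
      exact (Int.fract_lt_one _).le
    have h3 : ‖(fun i => Int.fract (x i))‖ ^ 2 ≤ 1 := pow_le_one₀ (norm_nonneg _) h2
    rw [e]
    rw [norm_intVec_real] at h1
    nlinarith
  have hsum' := Summable.of_nonneg_of_le (fun _ => (Real.exp_pos _).le) hle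
    (hs.mul_left (Real.exp a))
  refine ⟨(Equiv.summable_iff (Equiv.subRight (fun i => ⌊x i⌋))).mp hsum', ?_⟩
  rw [← (Equiv.subRight (fun i => ⌊x i⌋)).tsum_eq]
  exact hsum'.tsum_le_tsum hle (hs.mul_left (Real.exp a))

/-! ### Real coordinates on `ℍ × (L ⊗ ℂ)` -/

/-- The inclusion `L ⊗ ℝ → L ⊗ ℂ`. -/
def realVec {n : ℕ} (x : Fin n → ℝ) : Fin n → ℂ := fun i => (x i : ℂ)

/-- The inclusion `L ⊗ ℚ → L ⊗ ℝ`. -/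
def ratVecReal {n : ℕ} (x : Fin n → ℚ) : Fin n → ℝ := fun i => (x i : ℝ)

/-- The point `p τ + q` of `L ⊗ ℂ` with real coordinates `p`, `q`. -/
def realPt {n : ℕ} (τ : ℍ) (p q : Fin n → ℝ) : Fin n → ℂ := (τ : ℂ) • realVec p + realVec q

/-- The coordinate `p` of `z = p τ + q`. -/
noncomputable def coordP {n : ℕ} (τ : ℍ) (z : Fin n → ℂ) : Fin n → ℝ := fun i => (z i).im / τ.im

/-- The coordinate `q` of `z = p τ + q`. -/
noncomputable def coordQ {n : ℕ} (τ : ℍ) (z : Fin n → ℂ) : Fin n → ℝ :=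
  fun i => (z i).re - (z i).im / τ.im * τ.re

theorem realPt_coord {n : ℕ} (τ : ℍ) (z : Fin n → ℂ) : realPt τ (coordP τ z) (coordQ τ z) = z := by
  have := τ.im_pos.ne'
  ext i
  apply Complex.ext
  · simp [realPt, coordP, coordQ, realVec]; ring
  · simp [realPt, coordP, coordQ, realVec]; field_simp

theorem realPt_im {n : ℕ} (τ : ℍ) (p q : Fin n → ℝ) (i : Fin n) :
    (realPt τ p q i).im = τ.im * p i := by
  simp [realPt, realVec]

theorem coordP_realPt {n : ℕ} (τ : ℍ) (p q : Fin n → ℝ) : coordP τ (realPt τ p q) = p := by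
  have := τ.im_pos.ne'
  ext i
  rw [coordP, realPt_im]
  field_simp

theorem coordQ_realPt {n : ℕ} (τ : ℍ) (p q : Fin n → ℝ) : coordQ τ (realPt τ p q) = q := by
  have := τ.im_pos.ne'
  ext i
  rw [coordQ, realPt_im]
  simp [realPt, realVec]
  field_simp
  ring

theorem realVec_add {n : ℕ} (x y : Fin n → ℝ) : realVec (x + y) = realVec x + realVec y := by
  ext i; simp [realVec]

theorem ratVec_eq_realVec {n : ℕ} (x : Fin n → ℚ) : ratVec x = realVec (ratVecReal x) := by
  ext i; simp [realVec, ratVecReal, ratVec]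

theorem intVec_eq_realVec {n : ℕ} (x : Fin n → ℤ) : intVec ℂ x = realVec (intVec ℝ x) := by
  ext i; simp [realVec, intVec]

/-- In real coordinates `A` acts on `z = p τ + q` through an automorphism of `ℤⁿ × ℤⁿ`. -/
theorem realPt_smul {n : ℕ} (A : SL(2, ℤ)) (τ : ℍ) (p q : Fin n → ℝ) :
    (jfac A τ)⁻¹ • realPt τ p q = realPt (A • τ) ((A 1 1 : ℝ) • p - (A 1 0 : ℝ) • q)
      ((A 0 0 : ℝ) • q - (A 0 1 : ℝ) • p) := by
  have hj := jfac_ne_zero A τ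
  have hd := SL_det_complex A
  ext i
  simp only [realPt, realVec, Pi.smul_apply, Pi.add_apply, smul_eq_mul, Pi.sub_apply,
    coe_smul_eq A τ]
  push_cast
  field_simp
  rw [jfac]
  linear_combination (-(τ : ℂ) * p i - q i) * hd

theorem continuous_coordP {n : ℕ} :
    Continuous (fun w : ℍ × (Fin n → ℂ) => coordP w.1 w.2) := by
  unfold coordP
  refine continuous_pi fun i => ?_
  refine Continuous.div ?_ (UpperHalfPlane.continuous_im.comp continuous_fst)
    fun w => w.1.im_pos.ne'
  fun_prop

theorem continuous_coordQ {n : ℕ} :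
    Continuous (fun w : ℍ × (Fin n → ℂ) => coordQ w.1 w.2) := by
  have h1 : Continuous (fun w : ℍ × (Fin n → ℂ) => fun i => coordP w.1 w.2 i * w.1.re) := by
    have := UpperHalfPlane.continuous_re.comp (continuous_fst (X := ℍ) (Y := Fin n → ℂ))
    refine continuous_pi fun i => ?_
    exact ((continuous_apply i).comp continuous_coordP).mul this
  have h2 : Continuous (fun w : ℍ × (Fin n → ℂ) => fun i => (w.2 i).re) := by fun_prop
  exact h2.sub h1

theorem continuous_realPt {n : ℕ} :
    Continuous (fun w : ℍ × (Fin n → ℝ) × (Fin n → ℝ) => realPt w.1 w.2.1 w.2.2) := by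
  unfold realPt realVec
  have := UpperHalfPlane.continuous_coe.comp
    (continuous_fst (X := ℍ) (Y := (Fin n → ℝ) × (Fin n → ℝ)))
  refine Continuous.add (this.smul ?_) ?_ <;> fun_prop

namespace EvenLattice

variable {n : ℕ} (L : EvenLattice n)

theorem quad_realVec (x : Fin n → ℝ) : L.quad (realVec x) = (L.quad x : ℝ) :=
  L.quad_map Complex.ofRealHom x

theorem bil_realVec (x y : Fin n → ℝ) : L.bil (realVec x) (realVec y) = (L.bil x y : ℝ) :=
  L.bil_map Complex.ofRealHom x y

theorem quad_ratVecReal (x : Fin n → ℚ) : L.quad (ratVecReal x) = ((L.quad x : ℚ) : ℝ) :=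
  L.quad_map (Rat.castHom ℝ) x

theorem quad_ratVec (x : Fin n → ℚ) : L.quad (ratVec x) = ((L.quad x : ℚ) : ℂ) := by
  rw [ratVec_eq_realVec, quad_realVec, quad_ratVecReal]; simp

theorem quad_realPt (τ : ℍ) (p q : Fin n → ℝ) : L.quad (realPt τ p q) =
    (τ : ℂ) ^ 2 * (L.quad p : ℝ) + (L.quad q : ℝ) + τ * (L.bil p q : ℝ) := by
  rw [realPt, quad_add, quad_smul, bil_smul_left, quad_realVec, quad_realVec, bil_realVec]

/-- In real coordinates `z = p τ + q` the modulus of `e(τ β(s) + β(s, z))` is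
`exp(-2π v (β(s + p) - β(p)))`. -/
theorem norm_gFun_realPt (s : Fin n → ℚ) (τ : ℍ) (p q : Fin n → ℝ) :
    ‖L.gFun s τ (realPt τ p q)‖ = Real.exp (2 * Real.pi * τ.im * L.quad p) *
      Real.exp (-2 * Real.pi * τ.im * L.quad (ratVecReal s + p)) := by
  rw [gFun, norm_eFun, ← Real.exp_add, ratVec_eq_realVec, realPt, bil_add_right, bil_smul_right,
    quad_realVec, bil_realVec, bil_realVec, quad_add_field]
  congr 1
  simp
  ring

theorem quad_smul_sub_smul (a c : ℝ) (p q : Fin n → ℝ) : L.quad (a • p - c • q) =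
    a ^ 2 * L.quad p + c ^ 2 * L.quad q - a * c * L.bil p q := by
  rw [sub_eq_add_neg, ← _root_.neg_smul, quad_add_field, quad_smul_field, quad_smul_field,
    bil_smul_left, bil_smul_right]
  ring

/-- The modulus of the automorphy factor `e(-c β(z) / (cτ + d))` in real coordinates. -/
theorem norm_eFun_automorphy (A : SL(2, ℤ)) (τ : ℍ) (p q : Fin n → ℝ) :
    ‖eFun (-(A 1 0 : ℂ) * L.quad (realPt τ p q) / jfac A τ)‖ =
      Real.exp (2 * Real.pi * τ.im * L.quad p) * Real.exp (-2 * Real.pi * (A • τ).im *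
        L.quad ((A 1 1 : ℝ) • p - (A 1 0 : ℝ) • q)) := by
  rw [norm_eFun, ← Real.exp_add]
  congr 1
  have hN : Complex.normSq (jfac A τ) ≠ 0 := by
    simpa [Complex.normSq_eq_zero] using jfac_ne_zero A τ
  rw [quad_smul_sub_smul, im_smul_eq, Complex.div_im, quad_realPt]
  have h1 : (jfac A τ).re = A 1 0 * τ.re + A 1 1 := by simp [jfac]
  have h2 : (jfac A τ).im = A 1 0 * τ.im := by simp [jfac]
  have h3 : Complex.normSq (jfac A τ) = (A 1 0 * τ.re + A 1 1) ^ 2 + (A 1 0 * τ.im) ^ 2 := by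
    rw [Complex.normSq_apply, h1, h2]; ring
  rw [h3] at hN
  rw [h1, h2, h3]
  generalize hD : (A 1 0 * τ.re + A 1 1) ^ 2 + (A 1 0 * τ.im) ^ 2 = D at *
  simp [pow_two]
  field_simp
  rw [← hD]
  ring

theorem norm_slashSL_realPt (k : ℤ) (φ : ℍ → (Fin n → ℂ) → ℂ) (A : SL(2, ℤ)) (τ : ℍ)
    (p q : Fin n → ℝ) : ‖L.slashSL k φ A τ (realPt τ p q)‖ =
      ‖φ (A • τ) (realPt (A • τ) ((A 1 1 : ℝ) • p - (A 1 0 : ℝ) • q)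
        ((A 0 0 : ℝ) • q - (A 0 1 : ℝ) • p))‖ * ‖jfac A τ‖ ^ (-k) *
      (Real.exp (2 * Real.pi * τ.im * L.quad p) * Real.exp (-2 * Real.pi * (A • τ).im *
        L.quad ((A 1 1 : ℝ) • p - (A 1 0 : ℝ) • q))) := by
  rw [slashSL_eq, norm_mul, norm_mul, norm_eFun_automorphy, realPt_smul, norm_zpow]

/-- The factors `exp(± 2π v β(·))` of the automorphy factor and of `g_s` cancel at the point `A τ`. -/
theorem norm_slashSL_gFun (k : ℤ) (s : Fin n → ℚ) (A : SL(2, ℤ)) (τ : ℍ)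
    (p q : Fin n → ℝ) : ‖L.slashSL k (L.gFun s) A τ (realPt τ p q)‖ =
      ‖jfac A τ‖ ^ (-k) * Real.exp (2 * Real.pi * τ.im * L.quad p) *
        Real.exp (-2 * Real.pi * (A • τ).im *
          L.quad (ratVecReal s + ((A 1 1 : ℝ) • p - (A 1 0 : ℝ) • q))) := by
  rw [norm_slashSL_realPt, norm_gFun_realPt]
  set X := (A 1 1 : ℝ) • p - (A 1 0 : ℝ) • q
  have : Real.exp (2 * Real.pi * (A • τ).im * L.quad X) *
      Real.exp (-2 * Real.pi * (A • τ).im * L.quad X) = 1 := by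
    rw [← Real.exp_add, ← Real.exp_zero]; congr 1; ring
  linear_combination ‖jfac A τ‖ ^ (-k) * Real.exp (2 * Real.pi * τ.im * L.quad p) *
        Real.exp (-2 * Real.pi * (A • τ).im * L.quad (ratVecReal s + X)) * this

/-! ### The majorant `∑ |e(τ β(s) + β(s, z))|` -/

/-- The sum of `|e(τ β(s) + β(s, z))|` over `s ∈ L^#`. -/
noncomputable def absTheta (τ : ℍ) (z : Fin n → ℂ) : ℝ :=
  ∑' m : Fin n → ℤ, ‖L.gFun (L.dualVec m) τ z‖

/-- The Gaussian decay is uniform in the real coordinates and in `Im τ ≥ B`; what remains is the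
factor `exp(2π v β(p))` of `norm_gFun_realPt`. -/
theorem exists_absTheta_bound {B : ℝ} (hB : 0 < B) : ∃ C > 0, ∀ (τ : ℍ) (z : Fin n → ℂ),
    B ≤ τ.im → L.absTheta τ z ≤ C * Real.exp (2 * Real.pi * τ.im * L.quad (coordP τ z)) := by
  obtain ⟨ε, hε, h⟩ := L.exists_dual_lower_bound
  obtain ⟨C, hC, hsum⟩ := exists_sum_exp_shift_le (n := n) (a := 2 * Real.pi * B * ε)
    (by positivity)
  refine ⟨C, hC, fun τ z hτ => ?_⟩
  set p := coordP τ z with hp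
  have hz : realPt τ p (coordQ τ z) = z := realPt_coord τ z
  have hle : ∀ m : Fin n → ℤ, ‖L.gFun (L.dualVec m) τ z‖ ≤
      Real.exp (2 * Real.pi * τ.im * L.quad p) * Real.exp (-(2 * Real.pi * B * ε) *
        ‖intVec ℝ m + L.gram.map (Int.cast : ℤ → ℝ) *ᵥ p‖ ^ 2) := by
    intro m
    rw [← hz, norm_gFun_realPt]
    gcongr ?_ * Real.exp ?_
    have h1 := h m p
    have h2 : 0 ≤ L.quad (ratVecReal (L.dualVec m) + p) := L.quad_real_nonneg _
    have h3 : B * (ε * ‖intVec ℝ m + L.gram.map (Int.cast : ℤ → ℝ) *ᵥ p‖ ^ 2) ≤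
        τ.im * L.quad (ratVecReal (L.dualVec m) + p) :=
      mul_le_mul hτ h1 (by positivity) τ.im_pos.le
    have := mul_le_mul_of_nonneg_left h3 Real.two_pi_pos.le
    linarith
  obtain ⟨s1, s2⟩ := hsum (L.gram.map (Int.cast : ℤ → ℝ) *ᵥ p)
  have s3 := s1.mul_left (Real.exp (2 * Real.pi * τ.im * L.quad p))
  calc L.absTheta τ z ≤ _ := (Summable.of_nonneg_of_le (fun _ => norm_nonneg _) hle s3).tsum_le_tsum
        hle s3
    _ = Real.exp (2 * Real.pi * τ.im * L.quad p) * _ := tsum_mul_left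
    _ ≤ _ := by rw [mul_comm]; gcongr

theorem summable_norm_gFun_dual (τ : ℍ) (z : Fin n → ℂ) :
    Summable (fun m : Fin n → ℤ => ‖L.gFun (L.dualVec m) τ z‖) := by
  obtain ⟨ε, hε, h⟩ := L.exists_dual_lower_bound
  obtain ⟨C, hC, hsum⟩ := exists_sum_exp_shift_le (n := n) (a := 2 * Real.pi * τ.im * ε)
    (by have := τ.im_pos; positivity)
  set p := coordP τ z with hp
  have hz : realPt τ p (coordQ τ z) = z := realPt_coord τ z
  refine Summable.of_nonneg_of_le (fun _ => norm_nonneg _) (fun m => ?_)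
    ((hsum (L.gram.map (Int.cast : ℤ → ℝ) *ᵥ p)).1.mul_left
      (Real.exp (2 * Real.pi * τ.im * L.quad p)))
  rw [← hz, norm_gFun_realPt]
  gcongr ?_ * Real.exp ?_
  have h3 := mul_le_mul_of_nonneg_left (h m p) (mul_pos Real.two_pi_pos τ.im_pos).le
  have : L.quad (ratVecReal (L.dualVec m) + p) = L.quad ((fun i => (L.dualVec m i : ℝ)) + p) := rfl
  rw [this]
  linarith

/-! ### Uniform bounds for the terms of the Eisenstein series -/

/-- On a compact set the terms of the series are dominated by
`N^{-k} exp(-a ‖λ‖² / N²)` with `N = max(|c|, |d|)`. -/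
theorem exists_term_bound (k : ℤ) (hk : 0 ≤ k) (r : Fin n → ℚ) {K : Set (ℍ × (Fin n → ℂ))}
    (hK : IsCompact K) : ∃ C > 0, ∃ a > 0, ∀ (A : SL(2, ℤ)) (l : Fin n → ℤ), ∀ w ∈ K,
      ‖L.slashSL k (L.gFun (r + intVec ℚ l)) A w.1 w.2‖ ≤
        C * ‖A 1‖ ^ (-k) * Real.exp (-a * (‖l‖ / ‖A 1‖) ^ 2) := by
  rcases K.eq_empty_or_nonempty with rfl | hne
  · exact ⟨1, one_pos, 1, one_pos, by simp⟩
  obtain ⟨ε, hε, hq⟩ := L.exists_quad_lower_bound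
  -- uniform bounds for the coordinates of points of `K`
  obtain ⟨w₁, -, hρ⟩ := hK.exists_isMinOn hne (f := fun w => EisensteinSeries.r w.1)
    (by
      refine Continuous.continuousOn ?_
      unfold EisensteinSeries.r EisensteinSeries.r1
      have hi := UpperHalfPlane.continuous_im.comp (continuous_fst (X := ℍ) (Y := Fin n → ℂ))
      have hr := UpperHalfPlane.continuous_re.comp (continuous_fst (X := ℍ) (Y := Fin n → ℂ))
      refine hi.min (Real.continuous_sqrt.comp ?_)
      refine Continuous.div (hi.pow 2) ((hr.pow 2).add (hi.pow 2)) fun w => ?_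
      have := w.1.im_pos
      positivity)
  obtain ⟨w₂, -, hv⟩ := hK.exists_isMinOn hne (f := fun w => w.1.im)
    (UpperHalfPlane.continuous_im.comp continuous_fst).continuousOn
  obtain ⟨w₃, -, hp⟩ := hK.exists_isMaxOn hne (f := fun w => ‖coordP w.1 w.2‖)
    continuous_coordP.norm.continuousOn
  obtain ⟨w₄, -, hqq⟩ := hK.exists_isMaxOn hne (f := fun w => ‖coordQ w.1 w.2‖)
    continuous_coordQ.norm.continuousOn
  obtain ⟨w₅, -, hE⟩ := hK.exists_isMaxOn hne
    (f := fun w => Real.exp (2 * Real.pi * w.1.im * L.quad (coordP w.1 w.2)))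
    (by
      refine Continuous.continuousOn ?_
      have hi := UpperHalfPlane.continuous_im.comp (continuous_fst (X := ℍ) (Y := Fin n → ℂ))
      exact Real.continuous_exp.comp ((continuous_const.mul hi).mul
        (L.continuous_quad_real.comp continuous_coordP)))
  obtain ⟨w₆, -, hτ⟩ := hK.exists_isMaxOn hne (f := fun w => ‖(w.1 : ℂ)‖)
    (UpperHalfPlane.continuous_coe.comp continuous_fst).norm.continuousOn
  set ρ := EisensteinSeries.r w₁.1
  set v := w₂.1.im
  set P := ‖coordP w₃.1 w₃.2‖
  set Q := ‖coordQ w₄.1 w₄.2‖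
  set E := Real.exp (2 * Real.pi * w₅.1.im * L.quad (coordP w₅.1 w₅.2))
  set T := ‖(w₆.1 : ℂ)‖
  have hρ0 : 0 < ρ := EisensteinSeries.r_pos _
  have hv0 : 0 < v := w₂.1.im_pos
  have hE0 : 0 < E := Real.exp_pos _
  have hT0 : 0 ≤ T := norm_nonneg _
  set δ := v / (T + 1) ^ 2 with hδ
  have hδ0 : 0 < δ := by positivity
  set b := 2 * Real.pi * δ * ε with hb
  have hb0 : 0 < b := by positivity
  set R := ‖ratVecReal r‖ + P + Q with hR
  have hR0 : 0 ≤ R := by positivity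
  refine ⟨ρ ^ (-k) * E * Real.exp (b * R ^ 2), by positivity, b / 2, by positivity, ?_⟩
  rintro A l ⟨τ, z⟩ hw
  have hρ' : ρ ≤ EisensteinSeries.r τ := hρ hw
  have hv' : v ≤ τ.im := hv hw
  have hp' : ‖coordP τ z‖ ≤ P := hp hw
  have hq' : ‖coordQ τ z‖ ≤ Q := hqq hw
  have hE' : Real.exp (2 * Real.pi * τ.im * L.quad (coordP τ z)) ≤ E := hE hw
  have hτ' : ‖(τ : ℂ)‖ ≤ T := hτ hw
  set N := ‖A 1‖ with hN
  have hN1 : 1 ≤ N := by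
    have h0 : 0 < ‖A 1‖ := norm_pos_iff.mpr (SL_bottom_row_ne_zero A)
    rw [EisensteinSeries.norm_eq_max_natAbs] at hN h0
    rw [hN]
    exact_mod_cast h0
  have hN0 : 0 < N := by linarith
  have hc : |(A 1 0 : ℝ)| ≤ N := by
    have := norm_le_pi_norm (A 1) 0
    simpa [Int.norm_eq_abs] using this
  have hd : |(A 1 1 : ℝ)| ≤ N := by
    have := norm_le_pi_norm (A 1) 1
    simpa [Int.norm_eq_abs] using this
  -- `|cτ + d|` is comparable to `N`, so `Im (A τ)` is at least a multiple of `1 / N²`.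
  have hj1 : ρ * N ≤ ‖jfac A τ‖ :=
    (mul_le_mul_of_nonneg_right hρ' hN0.le).trans
      (EisensteinSeries.r_mul_max_le τ (SL_bottom_row_ne_zero A))
  have hj2 : ‖jfac A τ‖ ≤ (T + 1) * N := by
    calc ‖jfac A τ‖ ≤ ‖(A 1 0 : ℂ) * τ‖ + ‖(A 1 1 : ℂ)‖ := norm_add_le _ _
      _ = |(A 1 0 : ℝ)| * ‖(τ : ℂ)‖ + |(A 1 1 : ℝ)| := by
        rw [norm_mul, Complex.norm_intCast, Complex.norm_intCast]
      _ ≤ N * T + N := by gcongr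
      _ = _ := by ring
  have him : δ / N ^ 2 ≤ (A • τ).im := by
    rw [im_smul_eq, Complex.normSq_eq_norm_sq, hδ, div_div, ← mul_pow]
    have := jfac_ne_zero A τ
    gcongr
  rw [show z = realPt τ (coordP τ z) (coordQ τ z) from (realPt_coord τ z).symm, norm_slashSL_gFun]
  set x := ratVecReal r + ((A 1 1 : ℝ) • coordP τ z - (A 1 0 : ℝ) • coordQ τ z) with hx
  have hxe : ratVecReal (r + intVec ℚ l) + ((A 1 1 : ℝ) • coordP τ z - (A 1 0 : ℝ) • coordQ τ z) =
      intVec ℝ l + x := by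
    ext i; simp [hx, ratVecReal, intVec]; ring
  have hxn : ‖x‖ ≤ R * N := by
    calc ‖x‖ ≤ ‖ratVecReal r‖ + (‖(A 1 1 : ℝ) • coordP τ z‖ + ‖(A 1 0 : ℝ) • coordQ τ z‖) :=
          (norm_add_le _ _).trans (by gcongr; exact norm_sub_le _ _)
      _ ≤ ‖ratVecReal r‖ * N + (N * P + N * Q) := by
        rw [norm_smul, norm_smul, Real.norm_eq_abs, Real.norm_eq_abs]
        gcongr
        exact le_mul_of_one_le_right (norm_nonneg _) hN1
      _ = R * N := by rw [hR]; ring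
  rw [hxe]
  have h1 := norm_sq_shift_le (intVec ℝ l) x
  rw [norm_intVec_real] at h1
  have h2 : ‖x‖ ^ 2 ≤ (R * N) ^ 2 := by gcongr
  have h3 := hq (intVec ℝ l + x)
  have h4 : (δ / N ^ 2) * (ε * (‖l‖ ^ 2 / 2 - (R * N) ^ 2)) ≤
      (A • τ).im * L.quad (intVec ℝ l + x) := by
    have h5 : ε * (‖l‖ ^ 2 / 2 - (R * N) ^ 2) ≤ L.quad (intVec ℝ l + x) :=
      le_trans (by gcongr; linarith) h3
    calc _ ≤ (δ / N ^ 2) * L.quad (intVec ℝ l + x) := by gcongr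
      _ ≤ _ := by
        have := L.quad_real_nonneg (intVec ℝ l + x)
        gcongr
  have h6 : -2 * Real.pi * (A • τ).im * L.quad (intVec ℝ l + x) ≤
      b * R ^ 2 + -(b / 2) * (‖l‖ / N) ^ 2 := by
    have h7 : b * R ^ 2 + -(b / 2) * (‖l‖ / N) ^ 2 =
        -(2 * Real.pi) * ((δ / N ^ 2) * (ε * (‖l‖ ^ 2 / 2 - (R * N) ^ 2))) := by
      rw [hb]; field_simp; ring
    rw [h7]
    have := mul_le_mul_of_nonneg_left h4 Real.two_pi_pos.le
    linarith
  have h8 : ‖jfac A τ‖ ^ (-k) ≤ ρ ^ (-k) * N ^ (-k) := by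
    rw [← mul_zpow, _root_.zpow_neg, _root_.zpow_neg]
    gcongr ?_⁻¹
    exact zpow_le_zpow_left₀ hk (by positivity) hj1
  calc ‖jfac A τ‖ ^ (-k) * Real.exp (2 * Real.pi * τ.im * L.quad (coordP τ z)) *
        Real.exp (-2 * Real.pi * (A • τ).im * L.quad (intVec ℝ l + x))
      ≤ (ρ ^ (-k) * N ^ (-k)) * E * Real.exp (b * R ^ 2 + -(b / 2) * (‖l‖ / N) ^ 2) := by
        gcongr
    _ = _ := by rw [Real.exp_add]; ring

end EvenLattice

/-! ### Poisson summation on `ℝⁿ` -/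

theorem exists_ioc_intVec {n : ℕ} (x : Fin n → ℝ) :
    ∃ m : Fin n → ℤ, ∀ i, x i ∈ Set.Ioc ((m i : ℝ)) (m i + 1) := by
  refine ⟨fun i => ⌈x i⌉ - 1, fun i => ⟨?_, ?_⟩⟩
  · push_cast; linarith [Int.ceil_lt_add_one (x i)]
  · push_cast; linarith [Int.le_ceil (x i)]

/-- An integral over `ℝⁿ` is the sum of the integrals of the translates over the unit cube. -/
theorem hasSum_integral_cube {n : ℕ} {h : (Fin n → ℝ) → ℂ} (hi : Integrable h) :
    HasSum (fun m : Fin n → ℤ => ∫ x in {x : Fin n → ℝ | ∀ i, x i ∈ Set.Ioc (0 : ℝ) (0 + 1)},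
      h (x + intVec ℝ m)) (∫ x, h x) := by
  set s : (Fin n → ℤ) → Set (Fin n → ℝ) :=
    fun m => {x | ∀ i, x i ∈ Set.Ioc ((m i : ℝ)) (m i + 1)} with hs
  have hmeas : ∀ m, MeasurableSet (s m) := fun m =>
    MeasurableSet.univ_pi' fun i => measurableSet_Ioc
  have hdisj : Pairwise (Function.onFun Disjoint s) := by
    intro m m' hmm
    rw [Function.onFun, Set.disjoint_left]
    intro x hx hx'
    apply hmm
    ext i
    have h1 := hx i
    have h2 := hx' i
    have h3 : (m i : ℝ) < m' i + 1 := h1.1.trans_le h2.2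
    have h4 : (m' i : ℝ) < m i + 1 := h2.1.trans_le h1.2
    have h3' : m i < m' i + 1 := by exact_mod_cast h3
    have h4' : m' i < m i + 1 := by exact_mod_cast h4
    lia
  have hU : (⋃ m, s m) = Set.univ := by
    refine Set.eq_univ_of_forall fun x => ?_
    obtain ⟨m, hm⟩ := exists_ioc_intVec x
    exact Set.mem_iUnion.mpr ⟨m, hm⟩
  have := hasSum_integral_iUnion (f := h) (μ := volume) hmeas hdisj (by rw [hU]; exact hi.integrableOn)
  rw [hU, setIntegral_univ] at this
  refine this.congr_fun fun m => ?_
  have hp := (measurePreserving_add_right (volume : Measure (Fin n → ℝ))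
    (intVec ℝ m)).setIntegral_preimage_emb (measurableEmbedding_addRight _) h (s m)
  rw [← hp]
  congr 2
  ext x
  simp only [hs, intVec, Set.mem_preimage, Set.mem_ofPred_eq, Set.mem_Ioc, Pi.add_apply]
  refine forall_congr' fun i => ?_
  constructor <;> rintro ⟨h1, h2⟩ <;> constructor <;> linarith

/-- Poisson summation on `ℝⁿ`. -/
theorem poisson_pi {n : ℕ} {f : (Fin n → ℝ) → ℂ} (hf : Continuous f) (hfi : Integrable f)
    (hu : ∀ R : ℝ, ∃ u : (Fin n → ℤ) → ℝ, Summable u ∧ ∀ m x, ‖x‖ ≤ R → ‖f (x + intVec ℝ m)‖ ≤ u m)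
    (hF : Summable fun m : Fin n → ℤ => ∫ x, eFun (-(∑ i, (m i : ℂ) * x i)) * f x) :
    HasSum (fun m : Fin n → ℤ => ∫ x, eFun (-(∑ i, (m i : ℂ) * x i)) * f x)
      (∑' m : Fin n → ℤ, f (intVec ℝ m)) := by
  set P : (Fin n → ℝ) → ℂ := fun x => ∑' m : Fin n → ℤ, f (x + intVec ℝ m) with hP
  have hPc : Continuous P := by
    rw [continuous_iff_continuousAt]
    intro x
    obtain ⟨u, hu1, hu2⟩ := hu (‖x‖ + 1)
    have : ContinuousOn P (Metric.ball 0 (‖x‖ + 1)) :=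
      continuousOn_tsum (fun m => (hf.comp (continuous_id.add continuous_const)).continuousOn) hu1
        fun m y hy => hu2 m y (by simpa using (Metric.mem_ball.mp hy).le)
    exact this.continuousAt (Metric.isOpen_ball.mem_nhds (by simp))
  have hPp : ∀ (x : Fin n → ℝ) (m : Fin n → ℤ), P (x + intVec ℝ m) = P x := by
    intro x m
    rw [hP]
    simp only
    rw [← (Equiv.addRight m).tsum_eq (fun m' => f (x + intVec ℝ m'))]
    refine tsum_congr fun m' => ?_
    congr 1
    simp only [Equiv.coe_addRight, EvenLattice.intVec_add]
    abel
  set mk : (Fin n → ℝ) → UnitAddTorus (Fin n) := fun x i => (x i : UnitAddCircle) with hmk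
  have hq : IsOpenQuotientMap mk :=
    IsOpenQuotientMap.piMap (fun _ : Fin n => QuotientAddGroup.isOpenQuotientMap_mk)
  -- `Ft` is the function on the torus induced by the periodization `P`.
  set Ft : UnitAddTorus (Fin n) → ℂ := fun θ => P (fun i => (AddCircle.equivIoc 1 0 (θ i)).1)
    with hFt
  have hFP : ∀ x, Ft (mk x) = P x := by
    intro x
    have : ∀ i, ∃ m : ℤ, x i + m = (AddCircle.equivIoc (1 : ℝ) 0 (mk x i)).1 := by
      intro i
      have h1 : ((AddCircle.equivIoc (1 : ℝ) 0 (mk x i)).1 : UnitAddCircle) = (x i : UnitAddCircle) :=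
        AddCircle.coe_equivIoc
      rw [← sub_eq_zero, ← AddCircle.coe_sub, AddCircle.coe_eq_zero_iff] at h1
      obtain ⟨m, hm⟩ := h1
      refine ⟨m, ?_⟩
      rw [zsmul_eq_mul, mul_one] at hm
      rw [hm]; ring
    choose m hm using this
    rw [hFt]
    simp only
    rw [← hPp x m]
    congr 1
    ext i
    exact (hm i).symm
  have hFc : Continuous Ft := by
    rw [hq.isQuotientMap.continuous_iff]
    exact hPc.congr fun x => (hFP x).symm
  have hcoef : ∀ m : Fin n → ℤ, UnitAddTorus.mFourierCoeff Ft m =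
      ∫ x, eFun (-(∑ i, (m i : ℂ) * x i)) * f x := by
    intro m
    rw [UnitAddTorus.mFourierCoeff_eq_integral Ft m 0]
    have hchar : ∀ x : Fin n → ℝ, UnitAddTorus.mFourier (-m) (fun i => (x i : UnitAddCircle)) =
        eFun (-(∑ i, (m i : ℂ) * x i)) := by
      intro x
      rw [← Finset.sum_neg_distrib, eFun_sum]
      simp only [UnitAddTorus.mFourier, ContinuousMap.coe_mk, fourier_coe_apply, eFun]
      refine Finset.prod_congr rfl fun i _ => ?_
      congr 1
      simp
      ring
    have hcharc : Continuous fun x : Fin n → ℝ => eFun (-(∑ i, (m i : ℂ) * x i)) :=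
      continuous_eFun.comp (by fun_prop)
    have hnorm : ∀ x : Fin n → ℝ, ‖eFun (-(∑ i, (m i : ℂ) * x i))‖ = 1 := by
      intro x
      have : (-(∑ i, (m i : ℂ) * x i)) = ((-(∑ i, (m i : ℝ) * x i) : ℝ) : ℂ) := by push_cast; rfl
      rw [this, norm_eFun_ofReal]
    have hint : Integrable fun x : Fin n → ℝ => eFun (-(∑ i, (m i : ℂ) * x i)) * f x := by
      refine (hfi.bdd_mul hcharc.aestronglyMeasurable (c := 1) ?_)
      exact Filter.Eventually.of_forall fun x => (hnorm x).le
    -- Unfolding: the Fourier coefficient of `P` is an integral over the unit cube of a sum over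
    -- translates, hence the integral of `f` against the character over `ℝⁿ`.
    have h1 := hasSum_integral_cube hint
    obtain ⟨u, hu1, hu2⟩ := hu 1
    set C : Set (Fin n → ℝ) := {x : Fin n → ℝ | ∀ i, x i ∈ Set.Ioc (0 : ℝ) (0 + 1)} with hC
    have hCm : MeasurableSet C := MeasurableSet.univ_pi' fun i => measurableSet_Ioc
    have hCn : ∀ x ∈ C, ‖x‖ ≤ 1 := fun x hx => by
      refine (pi_norm_le_iff_of_nonneg zero_le_one).mpr fun i => ?_
      have := hx i
      rw [Real.norm_of_nonneg this.1.le]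
      linarith [this.2]
    have hCv : volume C = 1 := by
      have : C = Set.pi Set.univ (fun _ : Fin n => Set.Ioc (0 : ℝ) (0 + 1)) := by
        ext x; simp [hC]
      rw [this, Real.volume_pi_Ioc]
      simp
    have hCfin : IsFiniteMeasure (volume.restrict C) := ⟨by simp [hCv]⟩
    have hgm : ∀ m' : Fin n → ℤ, Integrable (fun x => eFun (-(∑ i, (m i : ℂ) * x i)) *
        f (x + intVec ℝ m')) (volume.restrict C) := by
      intro m'
      refine Integrable.mono' (integrable_const (u m')) (Continuous.aestronglyMeasurable
        (hcharc.mul (hf.comp (continuous_id.add continuous_const)))) ?_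
      refine (ae_restrict_iff' hCm).mpr (Filter.Eventually.of_forall fun x hx => ?_)
      rw [norm_mul, hnorm, one_mul]
      exact hu2 m' x (hCn x hx)
    have hper : ∀ (x : Fin n → ℝ) (m' : Fin n → ℤ), eFun (-(∑ i, (m i : ℂ) * (x + intVec ℝ m') i)) =
        eFun (-(∑ i, (m i : ℂ) * x i)) := by
      intro x m'
      refine eFun_eq_of_eq_add_int (-(∑ i, m i * m' i)) ?_
      simp [intVec, mul_add, Finset.sum_add_distrib]
      ring
    have h2 := hasSum_integral_of_summable_integral_norm hgm (by
      refine Summable.of_nonneg_of_le (fun _ => integral_nonneg fun _ => norm_nonneg _)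
        (fun m' => ?_) hu1
      calc _ ≤ ∫ x in C, u m' := by
            refine integral_mono_ae (hgm m').norm (integrable_const _) ?_
            refine (ae_restrict_iff' hCm).mpr (Filter.Eventually.of_forall fun x hx => ?_)
            simp only [norm_mul, hnorm, one_mul]
            exact hu2 m' x (hCn x hx)
        _ = u m' := by simp [Measure.real, hCv])
    have h3 : ∫ x in C, ∑' m' : Fin n → ℤ, eFun (-(∑ i, (m i : ℂ) * x i)) * f (x + intVec ℝ m') =
        ∫ x, eFun (-(∑ i, (m i : ℂ) * x i)) * f x := by
      exact h2.unique (by simpa only [hper] using h1)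
    rw [← h3]
    refine setIntegral_congr_fun hCm fun x _ => ?_
    simp only [hchar, smul_eq_mul, tsum_mul_left]
    congr 1
    exact hFP x
  have hsum := UnitAddTorus.hasSum_mFourier_series_apply_of_summable (f := ⟨Ft, hFc⟩) (by
    rw [show UnitAddTorus.mFourierCoeff (ContinuousMap.mk Ft hFc) = _ from funext hcoef]
    exact hF) (mk 0)
  simp only [ContinuousMap.coe_mk, hcoef] at hsum
  have e0 : ∀ m : Fin n → ℤ, UnitAddTorus.mFourier m (mk 0) = 1 := by
    intro m
    simp [UnitAddTorus.mFourier, hmk]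
  simp only [e0, smul_eq_mul, mul_one, hFP, hP, zero_add] at hsum
  exact hsum

namespace EvenLattice

variable {n : ℕ} (L : EvenLattice n)

/-! ### Gaussian integrals and the theta transformation formula -/

theorem posSemidef_gram : (L.gram.map (Int.cast : ℤ → ℝ)).PosSemidef := by
  have hsym : (L.gram.map (Int.cast : ℤ → ℝ)).IsHermitian := by
    rw [Matrix.IsHermitian, Matrix.conjTranspose_eq_transpose_of_trivial, ← Matrix.transpose_map,
      L.symm]
  refine Matrix.PosSemidef.of_dotProduct_mulVec_nonneg hsym fun y => ?_
  have := L.quad_real_nonneg y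
  rw [quad, bil] at this
  simpa using (show 0 ≤ y ⬝ᵥ L.gram.map (Int.cast : ℤ → ℝ) *ᵥ y by linarith)

/-- A square root of the Gram matrix, which reduces Gaussian integrals for `β` to the standard
Gaussian. -/
theorem exists_gram_factor : ∃ B : Matrix (Fin n) (Fin n) ℝ,
    L.gram.map (Int.cast : ℤ → ℝ) = Bᵀ * B ∧ |B.det| = Real.sqrt L.det := by
  open scoped MatrixOrder in
  obtain ⟨B, hB⟩ := CStarAlgebra.nonneg_iff_eq_star_mul_self.mp L.posSemidef_gram.nonneg
  have hB' : L.gram.map (Int.cast : ℤ → ℝ) = Bᵀ * B := by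
    rw [hB, Matrix.star_eq_conjTranspose, Matrix.conjTranspose_eq_transpose_of_trivial]
  refine ⟨B, hB', ?_⟩
  have h1 : B.det ^ 2 = L.gram.det := by
    rw [← gram_map_det, hB', det_mul, det_transpose, sq]
  rw [EvenLattice.det, ← h1, abs_of_nonneg (sq_nonneg B.det), Real.sqrt_sq_eq_abs]

theorem det_pos : 0 < L.det := by
  rw [EvenLattice.det]
  exact abs_pos.mpr (by exact_mod_cast L.gram_det_ne_zero)

theorem sum_sq_of_factor {B : Matrix (Fin n) (Fin n) ℝ}
    (hB : L.gram.map (Int.cast : ℤ → ℝ) = Bᵀ * B) (w : Fin n → ℂ) :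
    ∑ i, ((B.map (Complex.ofReal) *ᵥ w) i) ^ 2 = L.bil w w := by
  have h1 : L.gram.map (Int.cast : ℤ → ℂ) =
      (B.map (Complex.ofReal))ᵀ * B.map (Complex.ofReal) := by
    have := congrArg (fun M => M.map (Complex.ofReal)) hB
    simp only [Matrix.map_map] at this
    rw [show (Matrix.map (Bᵀ * B) Complex.ofReal) = (Bᵀ).map Complex.ofReal * B.map Complex.ofReal
      from Matrix.map_mul (f := Complex.ofRealHom)] at this
    rw [← Matrix.transpose_map, ← this]
    ext i j; simp
  rw [bil, h1, ← mulVec_mulVec, dotProduct_mulVec, vecMul_transpose]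
  simp [dotProduct, sq]

/-- The Gaussian integral with a complex linear term `w`. -/
theorem gaussian_integral {b : ℂ} (hb : 0 < b.re) (w : Fin n → ℂ) :
    Integrable (fun x : Fin n → ℝ =>
      Complex.exp (-b * L.bil (realVec x) (realVec x) + 2 * b * L.bil w (realVec x))) ∧
    ∫ x : Fin n → ℝ,
      Complex.exp (-b * L.bil (realVec x) (realVec x) + 2 * b * L.bil w (realVec x)) =
      (Real.pi / b) ^ (n / 2 : ℂ) / (Real.sqrt L.det : ℝ) * Complex.exp (b * L.bil w w) := by
  obtain ⟨B, hB, hdet⟩ := L.exists_gram_factor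
  have hs : 0 < Real.sqrt L.det := Real.sqrt_pos.mpr L.det_pos
  have hdet0 : B.det ≠ 0 := by
    intro h; rw [h, abs_zero] at hdet; exact hs.ne hdet
  have hb0 : b ≠ 0 := by rintro rfl; simp at hb
  set c : Fin n → ℂ := (2 * b) • (B.map (Complex.ofReal) *ᵥ w) with hc
  set F : (Fin n → ℝ) → ℂ := fun v => Complex.exp (-b * ∑ i, (v i : ℂ) ^ 2 + ∑ i, c i * v i) with hF
  have hBx : ∀ x : Fin n → ℝ, B.map (Complex.ofReal) *ᵥ realVec x = realVec (B *ᵥ x) := by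
    intro x; ext i; simp [mulVec, dotProduct, realVec]
  have hFx : ∀ x : Fin n → ℝ, F (Matrix.toLin' B x) =
      Complex.exp (-b * L.bil (realVec x) (realVec x) + 2 * b * L.bil w (realVec x)) := by
    intro x
    have h1 := L.sum_sq_of_factor hB (realVec x)
    have h2 : ∑ i, (B.map (Complex.ofReal) *ᵥ w) i * (B.map (Complex.ofReal) *ᵥ realVec x) i =
        L.bil w (realVec x) := by
      have e1 := L.sum_sq_of_factor hB (w + realVec x)
      have e2 := L.sum_sq_of_factor hB w
      simp only [mulVec_add, Pi.add_apply, add_sq, Finset.sum_add_distrib, e2, h1, bil_add_left,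
        bil_add_right, L.bil_comm (realVec x) w, mul_assoc, ← Finset.mul_sum] at e1
      linear_combination e1 / 2
    rw [hF]
    simp only [Matrix.toLin'_apply]
    congr 1
    rw [← h1, ← h2, hBx]
    simp only [hc, Pi.smul_apply, smul_eq_mul, realVec, Finset.mul_sum]
    congr 1
    exact Finset.sum_congr rfl fun i _ => by ring
  have hmap := Real.map_matrix_volume_pi_eq_smul_volume_pi hdet0
  have hemb : MeasurableEmbedding (Matrix.toLin' B : (Fin n → ℝ) → (Fin n → ℝ)) := by
    have := ((Matrix.toLin' B).toContinuousLinearMap).continuous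
    refine Continuous.measurableEmbedding this ?_
    intro x y hxy
    have : B *ᵥ (x - y) = 0 := by
      rw [mulVec_sub, sub_eq_zero]; simpa using hxy
    exact sub_eq_zero.mp (Matrix.eq_zero_of_mulVec_eq_zero hdet0 this)
  have hFint : Integrable F := GaussianFourier.integrable_cexp_neg_mul_sum_add hb c
  simp only [← hFx]
  constructor
  · refine (hemb.integrable_map_iff (g := F)).mp ?_
    rw [hmap]
    exact hFint.smul_measure ENNReal.ofReal_ne_top
  · rw [← hemb.integral_map (g := F), hmap, integral_smul_measure, hF,
      GaussianFourier.integral_cexp_neg_mul_sum_add hb c]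
    have h3 : ∑ i, c i ^ 2 = (2 * b) ^ 2 * L.bil w w := by
      rw [← L.sum_sq_of_factor hB w, Finset.mul_sum]
      exact Finset.sum_congr rfl fun i _ => by simp [hc, mul_pow]
    rw [h3, Fintype.card_fin, abs_inv, hdet, ENNReal.toReal_ofReal (by positivity)]
    have : (2 * b) ^ 2 * L.bil w w / (4 * b) = b * L.bil w w := by field_simp; ring
    rw [this, Complex.real_smul]
    push_cast
    ring

theorem dualVec_neg (m : Fin n → ℤ) : L.dualVec (-m) = -L.dualVec m := by
  have : intVec ℚ (-m) = -intVec ℚ m := by ext i; simp [intVec]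
  rw [dualVec, dualVec, this, mulVec_neg]

theorem bil_complex_dualVec (m : Fin n → ℤ) (x : Fin n → ℝ) :
    L.bil (ratVec (L.dualVec m)) (realVec x) = ∑ i, (m i : ℂ) * x i := by
  have := L.bil_real_dualVec m x
  rw [ratVec_eq_realVec, bil_realVec]
  unfold ratVecReal
  rw [this]
  simp [dotProduct, intVec]

theorem norm_eFun_gaussian (t : ℍ) (p q x : Fin n → ℝ) :
    ‖eFun (-L.quad (realPt t p q - realVec x) / t)‖ =
      Real.exp (2 * Real.pi * t.im * L.quad p) *
        Real.exp (-2 * Real.pi * (t.im / Complex.normSq t) * L.quad (x - q)) := by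
  have hsub : realPt t p q - realVec x = realPt t p (q - x) := by
    rw [realPt, realPt, sub_eq_add_neg, sub_eq_add_neg, realVec_add, add_assoc]
    congr 2
    ext i; simp [realVec]
  have hneg : L.quad (q - x) = L.quad (x - q) := by
    rw [← neg_sub, ← neg_one_smul ℝ, quad_smul_field]; ring
  have ht : Complex.normSq t ≠ 0 := by simp [t.ne_zero]
  rw [hsub, quad_realPt, norm_eFun, ← Real.exp_add, hneg, Complex.div_im]
  congr 1
  have h3 : Complex.normSq t = t.re ^ 2 + t.im ^ 2 := by
    rw [Complex.normSq_apply]; simp [sq]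
  rw [h3] at ht ⊢
  generalize hD : t.re ^ 2 + t.im ^ 2 = D at *
  simp [pow_two]
  field_simp
  rw [← hD]
  ring

/-- The integrand of the Fourier transform in `theta_transform`, with exponent in the form required
by `gaussian_integral`. -/
theorem gaussian_exponent (t : ℍ) (z : Fin n → ℂ) (m : Fin n → ℤ) (x : Fin n → ℝ) :
    eFun (-(∑ i, (m i : ℂ) * x i)) * eFun (-L.quad (z - realVec x) / t) =
      eFun (-L.quad z / t) *
      Complex.exp (-(Real.pi * Complex.I / t) * L.bil (realVec x) (realVec x) +
        2 * (Real.pi * Complex.I / t) * L.bil (z - (t : ℂ) • ratVec (L.dualVec m)) (realVec x)) := by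
  have ht := t.ne_zero
  rw [← eFun_add, ← bil_complex_dualVec, eFun, eFun, ← Complex.exp_add]
  congr 1
  have h1 : L.quad (z - realVec x) = L.quad z + L.bil (realVec x) (realVec x) / 2 -
      L.bil z (realVec x) := by
    rw [sub_eq_add_neg, quad_add, quad_neg, ← neg_one_smul ℂ (realVec x), bil_smul_right, quad,
      quad]
    ring
  have h2 : L.bil (z - (t : ℂ) • ratVec (L.dualVec m)) (realVec x) = L.bil z (realVec x) -
      t * L.bil (ratVec (L.dualVec m)) (realVec x) := by
    rw [sub_eq_add_neg, ← _root_.neg_smul, bil_add_left, bil_smul_left]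
    ring
  rw [h1, h2]
  field_simp
  ring

/-- Transformation formula for the theta functions of `L` under `τ ↦ -1/τ`. -/
theorem theta_transform (t : ℍ) (z : Fin n → ℂ) :
    ∑' m : Fin n → ℤ, eFun (-L.quad (z - intVec ℂ m) / t) =
      (-Complex.I * t) ^ (n / 2 : ℂ) / (Real.sqrt L.det : ℝ) *
        ∑' m : Fin n → ℤ, L.gFun (L.dualVec m) t z := by
  have ht := t.ne_zero
  have hb : 0 < (Real.pi * Complex.I / (t : ℂ)).re := by
    rw [Complex.div_re]
    have h1 : 0 < Complex.normSq t := Complex.normSq_pos.mpr ht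
    have h2 := t.im_pos
    simp
    positivity
  have hbt : Real.pi / (Real.pi * Complex.I / (t : ℂ)) = -Complex.I * t := by
    have : (Real.pi : ℂ) ≠ 0 := by exact_mod_cast Real.pi_ne_zero
    field_simp
    simp
  set f : (Fin n → ℝ) → ℂ := fun x => eFun (-L.quad (z - realVec x) / t) with hf
  have hint : ∀ m : Fin n → ℤ, Integrable (fun x => eFun (-(∑ i, (m i : ℂ) * x i)) * f x) ∧
      ∫ x, eFun (-(∑ i, (m i : ℂ) * x i)) * f x =
        (-Complex.I * t) ^ (n / 2 : ℂ) / (Real.sqrt L.det : ℝ) * L.gFun (L.dualVec (-m)) t z := by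
    intro m
    obtain ⟨g1, g2⟩ := L.gaussian_integral hb (z - (t : ℂ) • ratVec (L.dualVec m))
    simp only [hf, gaussian_exponent]
    refine ⟨g1.const_mul _, ?_⟩
    rw [integral_const_mul, g2, hbt]
    have e : eFun (-L.quad z / t) * Complex.exp (Real.pi * Complex.I / t *
        L.bil (z - (t : ℂ) • ratVec (L.dualVec m)) (z - (t : ℂ) • ratVec (L.dualVec m))) =
        L.gFun (L.dualVec (-m)) t z := by
      have h0 : ratVec (L.dualVec (-m)) = -ratVec (L.dualVec m) := by
        ext i; simp [dualVec_neg, ratVec]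
      rw [gFun, h0, quad_neg, eFun, eFun, ← Complex.exp_add]
      congr 1
      rw [sub_eq_add_neg, ← _root_.neg_smul, ← neg_one_smul ℂ (ratVec (L.dualVec m))]
      simp only [bil_add_left, bil_add_right, bil_smul_left, bil_smul_right, quad,
        L.bil_comm z (ratVec (L.dualVec m))]
      field_simp
      ring
    rw [← e]
    ring
  have hcont : Continuous f := by
    refine continuous_eFun.comp (Continuous.div_const ?_ _)
    refine (L.continuous_quad_complex.comp (continuous_const.sub ?_)).neg
    unfold realVec
    fun_prop
  have hsum : Summable fun m : Fin n → ℤ => L.gFun (L.dualVec (-m)) t z :=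
    ((Equiv.neg (Fin n → ℤ)).summable_iff (f := fun m => L.gFun (L.dualVec m) t z)).mpr
      (L.summable_norm_gFun_dual t z).of_norm
  have hP := poisson_pi hcont (by simpa using (hint 0).1) (fun R => by
      obtain ⟨ε, hε, hq⟩ := L.exists_quad_lower_bound
      set p := coordP t z
      set q := coordQ t z
      have hz : realPt t p q = z := realPt_coord t z
      set a := 2 * Real.pi * (t.im / Complex.normSq t) * ε with ha
      have ha0 : 0 < a := by
        have h1 : 0 < Complex.normSq t := Complex.normSq_pos.mpr ht
        have h2 := t.im_pos
        positivity
      refine ⟨fun m => Real.exp (2 * Real.pi * t.im * L.quad p) * Real.exp (a * (R + ‖q‖) ^ 2) *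
        Real.exp (-(a / 2) * ‖m‖ ^ 2),
        (summable_exp_neg_norm_sq (half_pos ha0)).mul_left _, fun m x hx => ?_⟩
      rw [hf]
      simp only
      rw [← hz, norm_eFun_gaussian, _root_.mul_assoc (Real.exp _), ← Real.exp_add (a * (R + ‖q‖) ^ 2)]
      gcongr ?_ * Real.exp ?_
      have h1 := norm_sq_shift_le (intVec ℝ m) (x - q)
      have h2 : ‖x - q‖ ^ 2 ≤ (R + ‖q‖) ^ 2 := by
        gcongr; exact (norm_sub_le _ _).trans (by gcongr)
      have h3 := hq (x + intVec ℝ m - q)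
      rw [show x + intVec ℝ m - q = intVec ℝ m + (x - q) by abel] at h3 ⊢
      rw [norm_intVec_real] at h1
      have h4 : ε * (‖m‖ ^ 2 / 2 - (R + ‖q‖) ^ 2) ≤ L.quad (intVec ℝ m + (x - q)) :=
        le_trans (by gcongr; linarith) h3
      have h5 : 0 < 2 * Real.pi * (t.im / Complex.normSq t) := by
        rw [ha] at ha0; exact pos_of_mul_pos_left ha0 hε.le
      have h6 := mul_le_mul_of_nonneg_left h4 h5.le
      rw [ha]
      linarith)
    (by simp only [(hint _).2]; exact hsum.mul_left _)
  simp only [(hint _).2] at hP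
  have e1 : ∀ m : Fin n → ℤ, f (intVec ℝ m) = eFun (-L.quad (z - intVec ℂ m) / t) := by
    intro m; rw [intVec_eq_realVec]
  simp only [e1] at hP
  rw [← hP.tsum_eq, tsum_mul_left]
  congr 1
  exact (Equiv.neg (Fin n → ℤ)).tsum_eq (fun m => L.gFun (L.dualVec m) t z)

end EvenLattice

namespace EvenLattice

variable {n : ℕ} (L : EvenLattice n)

/-! ### Gauss sums of the lattice -/

theorem bil_rat_intVec (x y : Fin n → ℤ) : L.bil (intVec ℚ x) (intVec ℚ y) = ((L.bil x y : ℤ) : ℚ) := by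
  simp [bil, intVec, dotProduct, mulVec]

theorem quad_rat_intVec (x : Fin n → ℤ) : ∃ m : ℤ, L.quad (intVec ℚ x) = m := by
  obtain ⟨m, hm⟩ := L.quad_intVec x
  refine ⟨m, ?_⟩
  have : intVec ℂ x = ratVec (intVec ℚ x) := by ext i; simp [intVec, ratVec]
  rw [this, quad_ratVec] at hm
  exact_mod_cast hm

theorem isotropic_add {r : Fin n → ℚ} (hr : r ∈ L.isotropic) (l : Fin n → ℤ) :
    r + intVec ℚ l ∈ L.isotropic := by
  obtain ⟨hd, t, ht⟩ := hr
  constructor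
  · intro x
    obtain ⟨m, hm⟩ := hd x
    exact ⟨m + L.bil l x, by rw [bil_add_left, hm, bil_rat_intVec]; push_cast; rfl⟩
  · obtain ⟨m, hm⟩ := hd l
    obtain ⟨u, hu⟩ := L.quad_rat_intVec l
    exact ⟨t + u + m, by rw [quad_add_field, ht, hm, hu]; push_cast; rfl⟩

theorem isotropic_neg {r : Fin n → ℚ} (hr : r ∈ L.isotropic) : -r ∈ L.isotropic := by
  obtain ⟨hd, t, ht⟩ := hr
  constructor
  · intro x
    obtain ⟨m, hm⟩ := hd x
    refine ⟨-m, ?_⟩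
    rw [← neg_one_smul ℚ r, bil_smul_left, hm]; push_cast; ring
  · refine ⟨t, ?_⟩
    rw [← neg_one_smul ℚ r, quad_smul_field, ht]; ring

/-- The summand `e_c(a β(λ + r) + d β(s) - β(s, λ + r))` of the Gauss sum. -/
noncomputable def gaussTerm (c : ℕ) (a d : ℤ) (s r : Fin n → ℚ) (l : Fin n → ℤ) : ℂ :=
  eFun (((a * L.quad (intVec ℚ l + r) + d * L.quad s - L.bil s (intVec ℚ l + r) : ℚ) : ℂ) / c)

/-- Integral lifts of vectors over `ℤ/c`. -/
def liftVec {n c : ℕ} (l : Fin n → ZMod c) : Fin n → ℤ := fun i => (l i).val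

/-- The Gauss sum `∑ e_c(a β(λ + r) + d β(s) - β(s, λ + r))` over `λ ∈ L / cL`. -/
noncomputable def gaussSum (c : ℕ) [NeZero c] (a d : ℤ) (s r : Fin n → ℚ) : ℂ :=
  ∑ l : Fin n → ZMod c, L.gaussTerm c a d s r (liftVec l)

theorem gaussTerm_add_mul {c : ℕ} [NeZero c] (a d : ℤ) {s r : Fin n → ℚ} (hs : s ∈ L.dual)
    (hr : r ∈ L.isotropic) (l m : Fin n → ℤ) :
    L.gaussTerm c a d s r (l + (c : ℤ) • m) = L.gaussTerm c a d s r l := by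
  have hc : (c : ℂ) ≠ 0 := by exact_mod_cast NeZero.ne c
  have hv := L.isotropic_add hr l
  rw [add_comm] at hv
  obtain ⟨t1, h1⟩ := hv.1 m
  obtain ⟨t2, h2⟩ := L.quad_rat_intVec m
  obtain ⟨t3, h3⟩ := hs m
  have e : intVec ℚ (l + (c : ℤ) • m) + r = (intVec ℚ l + r) + (c : ℚ) • intVec ℚ m := by
    ext i; simp [intVec]; ring
  rw [gaussTerm, gaussTerm, e]
  refine eFun_eq_of_eq_add_int (a * (t1 + c * t2) - t3) ?_
  rw [quad_add_field, quad_smul_field, bil_smul_right, bil_add_right, bil_smul_right, h1, h2, h3]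
  push_cast
  field_simp
  ring

theorem gaussTerm_congr {c : ℕ} [NeZero c] (a d : ℤ) {s r : Fin n → ℚ} (hs : s ∈ L.dual)
    (hr : r ∈ L.isotropic) {l l' : Fin n → ℤ} (h : ∀ i, (l i : ZMod c) = l' i) :
    L.gaussTerm c a d s r l = L.gaussTerm c a d s r l' := by
  have : ∀ i, ∃ m : ℤ, l i = l' i + c * m := by
    intro i
    have := (ZMod.intCast_eq_intCast_iff_dvd_sub (l' i) (l i) c).mp (h i).symm
    obtain ⟨m, hm⟩ := this
    exact ⟨m, by linarith⟩
  choose m hm using this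
  have : l = l' + (c : ℤ) • m := by ext i; simp [hm]
  rw [this, gaussTerm_add_mul L a d hs hr]

theorem gaussTerm_congr_left {c : ℕ} [NeZero c] {a a' : ℤ} (d : ℤ) (s : Fin n → ℚ)
    {r : Fin n → ℚ} (hr : r ∈ L.isotropic) (h : (a : ZMod c) = a') (l : Fin n → ℤ) :
    L.gaussTerm c a d s r l = L.gaussTerm c a' d s r l := by
  have hc : (c : ℂ) ≠ 0 := by exact_mod_cast NeZero.ne c
  obtain ⟨m, hm⟩ := (ZMod.intCast_eq_intCast_iff_dvd_sub a' a c).mp h.symm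
  have hv := L.isotropic_add hr l
  rw [add_comm] at hv
  obtain ⟨t, ht⟩ := hv.2
  have ha : a = a' + c * m := by linarith
  rw [gaussTerm, gaussTerm, ha]
  refine eFun_eq_of_eq_add_int (m * t) ?_
  rw [ht]
  push_cast
  field_simp
  ring

theorem gaussSum_congr_left {c : ℕ} [NeZero c] {a a' : ℤ} (d : ℤ) (s : Fin n → ℚ)
    {r : Fin n → ℚ} (hr : r ∈ L.isotropic) (h : (a : ZMod c) = a') :
    L.gaussSum c a d s r = L.gaussSum c a' d s r :=
  Finset.sum_congr rfl fun _ _ => L.gaussTerm_congr_left d s hr h _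

theorem norm_gaussTerm (c : ℕ) (a d : ℤ) (s r : Fin n → ℚ) (l : Fin n → ℤ) :
    ‖L.gaussTerm c a d s r l‖ = 1 := by
  have : (((a * L.quad (intVec ℚ l + r) + d * L.quad s - L.bil s (intVec ℚ l + r) : ℚ) : ℂ) / c) =
      (((a * L.quad (intVec ℚ l + r) + d * L.quad s - L.bil s (intVec ℚ l + r) : ℚ) : ℝ) / c :
        ℝ) := by push_cast; rfl
  rw [gaussTerm, this, norm_eFun_ofReal]

/-- For `D ≠ 0` the bound does not depend on `c`. -/
theorem card_mul_eq_zero_le {c : ℕ} [NeZero c] {D : ℤ} (hD : D ≠ 0) :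
    (Finset.univ.filter fun x : ZMod c => (D : ZMod c) * x = 0).card ≤ D.natAbs := by
  have hc : 0 < c := Nat.pos_of_ne_zero (NeZero.ne c)
  rw [← Finset.card_range D.natAbs]
  have key : ∀ x : ZMod c, (D : ZMod c) * x = 0 → c ∣ D.natAbs * x.val := by
    intro x hx
    have h1 : ((D * x.val : ℤ) : ZMod c) = 0 := by push_cast; simpa using hx
    rw [ZMod.intCast_zmod_eq_zero_iff_dvd] at h1
    have h2 := Int.natAbs_dvd_natAbs.mpr h1
    rwa [Int.natAbs_mul, Int.natAbs_natCast, Int.natAbs_natCast] at h2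
  refine Finset.card_le_card_of_injOn (fun x => D.natAbs * x.val / c) ?_ ?_
  · intro x hx
    simp only [Finset.coe_filter, Finset.mem_univ, true_and] at hx
    simp only [Finset.coe_range, Set.mem_Iio]
    rw [Nat.div_lt_iff_lt_mul hc]
    exact (Nat.mul_lt_mul_left (Int.natAbs_pos.mpr hD)).mpr (ZMod.val_lt x)
  · intro x hx y hy hxy
    simp only [Finset.coe_filter, Finset.mem_univ, true_and] at hx hy
    simp only at hxy
    have h1 := Nat.div_mul_cancel (key x hx)
    have h2 := Nat.div_mul_cancel (key y hy)
    rw [hxy, h2] at h1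
    exact ZMod.val_injective c (Nat.eq_of_mul_eq_mul_left (Int.natAbs_pos.mpr hD) h1).symm

/-- Multiplication by the adjugate shows that the kernel of `G` modulo `c` is killed by `det G`. -/
theorem card_ker_gram_le (c : ℕ) [NeZero c] :
    (Finset.univ.filter fun l : Fin n → ZMod c =>
      L.gram.map (Int.cast : ℤ → ZMod c) *ᵥ l = 0).card ≤ L.gram.det.natAbs ^ n := by
  have hsub : (Finset.univ.filter fun l : Fin n → ZMod c =>
      L.gram.map (Int.cast : ℤ → ZMod c) *ᵥ l = 0) ⊆
      Fintype.piFinset fun _ : Fin n =>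
        Finset.univ.filter fun x : ZMod c => (L.gram.det : ZMod c) * x = 0 := by
    intro l hl
    simp only [Finset.mem_filter, Finset.mem_univ, true_and, Fintype.mem_piFinset] at hl ⊢
    intro i
    have h1 := congrArg (fun v => (L.gram.map (Int.cast : ℤ → ZMod c)).adjugate *ᵥ v) hl
    simp only [mulVec_mulVec, adjugate_mul, mulVec_zero, smul_mulVec, one_mulVec,
      gram_map_det] at h1
    simpa using congrFun h1 i
  refine (Finset.card_le_card hsub).trans ?_
  rw [Fintype.card_piFinset_const]
  exact Nat.pow_le_pow_left (card_mul_eq_zero_le L.gram_det_ne_zero) n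

open Classical in
/-- Orthogonality of characters of `(ℤ/c)ⁿ`. -/
theorem norm_char_sum_le {c : ℕ} [NeZero c] {a : ZMod c} (ha : IsUnit a) (l : Fin n → ZMod c) :
    ‖∑ l' : Fin n → ZMod c, ZMod.stdAddChar (a * (l' ⬝ᵥ L.gram.map (Int.cast : ℤ → ZMod c) *ᵥ l))‖ ≤
      if L.gram.map (Int.cast : ℤ → ZMod c) *ᵥ l = 0 then (c : ℝ) ^ n else 0 := by
  set v := L.gram.map (Int.cast : ℤ → ZMod c) *ᵥ l with hv
  split_ifs with h
  · simp [h]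
  · set f : (Fin n → ZMod c) →+ ZMod c :=
      { toFun := fun l' => a * (l' ⬝ᵥ v)
        map_zero' := by simp
        map_add' := fun x y => by rw [add_dotProduct, mul_add] } with hf
    have hne : (ZMod.stdAddChar (N := c)).compAddMonoidHom f ≠ 0 := by
      intro h0
      obtain ⟨i, hi⟩ := Function.ne_iff.mp h
      have h1 := DFunLike.congr_fun h0 (Pi.single i 1)
      rw [AddChar.compAddMonoidHom_apply, AddChar.zero_apply, ← AddChar.map_zero_eq_one
        (ZMod.stdAddChar (N := c))] at h1
      have h2 := ZMod.injective_stdAddChar h1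
      have h3 : a * v i = 0 := by simpa [hf] using h2
      exact hi ((ha.mul_right_eq_zero).mp h3)
    have := AddChar.sum_eq_zero_iff_ne_zero.mpr hne
    have h2 : ∑ l' : Fin n → ZMod c, ZMod.stdAddChar (a * (l' ⬝ᵥ v)) = 0 := this
    rw [h2, norm_zero]

/-- The square root cancellation `|W|² ≤ |det|ⁿ cⁿ` in the Gauss sums. -/
theorem norm_gaussSum_sq_le {c : ℕ} [NeZero c] {a : ℤ} (ha : IsUnit (a : ZMod c)) (d : ℤ)
    {s r : Fin n → ℚ} (hs : s ∈ L.dual) (hr : r ∈ L.isotropic) :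
    ‖L.gaussSum c a d s r‖ ^ 2 ≤ L.det ^ n * (c : ℝ) ^ n := by
  classical
  have hc : (c : ℂ) ≠ 0 := by exact_mod_cast NeZero.ne c
  set T : (Fin n → ZMod c) → ℂ := fun l => L.gaussTerm c a d s r (liftVec l) with hT
  -- Weyl differencing: the product of the summands at `l + l'` and `l'` is linear in `l'` up to
  -- a factor of modulus one.
  have hprod : ∀ l : Fin n → ZMod c, ∃ U : ℂ, ‖U‖ = 1 ∧ ∀ l' : Fin n → ZMod c,
      T (l + l') * (starRingEnd ℂ) (T l') =
        U * ZMod.stdAddChar ((a : ZMod c) * (l' ⬝ᵥ L.gram.map (Int.cast : ℤ → ZMod c) *ᵥ l)) := by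
    intro l
    set X : ℚ := a * (L.quad (intVec ℚ (liftVec l)) + L.bil (intVec ℚ (liftVec l)) r) -
      L.bil s (intVec ℚ (liftVec l)) with hX
    refine ⟨eFun ((X : ℂ) / c), ?_, fun l' => ?_⟩
    · rw [show ((X : ℂ) / c) = (((X : ℝ) / c : ℝ) : ℂ) by push_cast; rfl, norm_eFun_ofReal]
    have e1 : T (l + l') = L.gaussTerm c a d s r (liftVec l + liftVec l') := by
      refine L.gaussTerm_congr a d hs hr fun i => ?_
      simp [liftVec]
    have e2 : ((a : ZMod c) * (l' ⬝ᵥ L.gram.map (Int.cast : ℤ → ZMod c) *ᵥ l)) =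
        ((a * L.bil (liftVec l') (liftVec l) : ℤ) : ZMod c) := by
      simp [bil, dotProduct, mulVec, liftVec]
    rw [e1, e2, ZMod.stdAddChar_coe, hT]
    simp only [gaussTerm, conj_eFun]
    rw [show Complex.exp (2 * Real.pi * Complex.I * ((a * L.bil (liftVec l') (liftVec l) : ℤ) : ℂ) / c) =
      eFun (((a * L.bil (liftVec l') (liftVec l) : ℤ) : ℂ) / c) by rw [eFun, mul_div_assoc],
      ← eFun_add, ← eFun_add]
    congr 1
    have e3 : intVec ℚ (liftVec l + liftVec l') + r =
      intVec ℚ (liftVec l) + (intVec ℚ (liftVec l') + r) := by rw [intVec_add]; abel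
    rw [e3, quad_add_field, L.bil_add_right s, hX, L.bil_add_right (intVec ℚ (liftVec l)),
      L.bil_comm (liftVec l'), bil_rat_intVec]
    simp only [map_div₀, Complex.conj_natCast, map_ratCast]
    push_cast
    field_simp
    ring
  have hsq : ((‖L.gaussSum c a d s r‖ ^ 2 : ℝ) : ℂ) =
      ∑ l, ∑ l', T (l + l') * (starRingEnd ℂ) (T l') := by
    rw [Complex.ofReal_pow, ← Complex.mul_conj', Finset.sum_comm]
    have : L.gaussSum c a d s r = ∑ l, T l := rfl
    rw [this, map_sum, Finset.mul_sum]
    refine Finset.sum_congr rfl fun l' _ => ?_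
    rw [← Finset.sum_mul]
    congr 1
    exact (Equiv.sum_comp (Equiv.addRight l') T).symm
  have h1 : ‖L.gaussSum c a d s r‖ ^ 2 ≤ ∑ l : Fin n → ZMod c,
      if L.gram.map (Int.cast : ℤ → ZMod c) *ᵥ l = 0 then (c : ℝ) ^ n else 0 := by
    have h2 : ‖L.gaussSum c a d s r‖ ^ 2 = ‖((‖L.gaussSum c a d s r‖ ^ 2 : ℝ) : ℂ)‖ := by
      rw [Complex.norm_real, Real.norm_of_nonneg (by positivity)]
    rw [h2, hsq]
    refine (norm_sum_le _ _).trans (Finset.sum_le_sum fun l _ => ?_)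
    obtain ⟨U, hU, hUl⟩ := hprod l
    simp only [hUl, ← Finset.mul_sum, norm_mul, hU, one_mul]
    exact L.norm_char_sum_le ha l
  refine h1.trans ?_
  rw [← Finset.sum_filter, Finset.sum_const, nsmul_eq_mul]
  gcongr
  calc _ ≤ ((L.gram.det.natAbs ^ n : ℕ) : ℝ) := by exact_mod_cast L.card_ker_gram_le c
    _ = L.det ^ n := by
      rw [EvenLattice.det, Nat.cast_pow, Nat.cast_natAbs, Int.cast_abs]

/-- Square root cancellation in the Gauss sums. -/
theorem norm_gaussSum_le {c : ℕ} [NeZero c] {a : ℤ} (ha : IsUnit (a : ZMod c)) (d : ℤ)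
    {s r : Fin n → ℚ} (hs : s ∈ L.dual) (hr : r ∈ L.isotropic) :
    ‖L.gaussSum c a d s r‖ ≤ L.det ^ ((n : ℝ) / 2) * (c : ℝ) ^ ((n : ℝ) / 2) := by
  have hc : (0 : ℝ) ≤ c := Nat.cast_nonneg c
  have hd := L.det_pos.le
  refine le_of_sq_le_sq ((L.norm_gaussSum_sq_le ha d hs hr).trans_eq ?_) (by positivity)
  rw [mul_pow, ← Real.rpow_natCast (L.det ^ ((n : ℝ) / 2)), ← Real.rpow_natCast ((c : ℝ) ^ ((n : ℝ) / 2)),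
    ← Real.rpow_mul hd, ← Real.rpow_mul hc]
  norm_num

/-! ### The partial sums of the series for `c > 0` -/

/-- With `t = τ + d / c` one has `A τ = a / c - 1 / (c² t)`, and the exponent of `g_v|A` becomes a
complete square in `z - v / c`. -/
theorem slashSL_gFun_pos (k : ℤ) (v : Fin n → ℚ) {A : SL(2, ℤ)} {c : ℕ} [NeZero c]
    (hA : A 1 0 = c) (τ t : ℍ) (ht : (t : ℂ) = τ + (A 1 1 : ℂ) / c) (z : Fin n → ℂ) :
    L.slashSL k (L.gFun v) A τ z = (c : ℂ) ^ (-k) * (t : ℂ) ^ (-k) *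
      (eFun (((A 0 0 * L.quad v : ℚ) : ℂ) / c) * eFun (-L.quad (z - (c : ℂ)⁻¹ • ratVec v) / t)) := by
  have hc : (c : ℂ) ≠ 0 := by exact_mod_cast NeZero.ne c
  have ht0 := t.ne_zero
  have hd := SL_det_complex A
  have hj : jfac A τ = c * t := by
    rw [jfac, ht, hA]; push_cast; field_simp
  have hs : ((A • τ : ℍ) : ℂ) = (A 0 0 : ℂ) / c - 1 / (c ^ 2 * t) := by
    rw [coe_smul_eq, hj]
    have h3 : (τ : ℂ) = t - (A 1 1 : ℂ) / c := by rw [ht]; ring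
    rw [h3]
    field_simp
    rw [hA] at hd
    push_cast at hd
    linear_combination -hd
  rw [slashSL_eq, hj, mul_zpow, gFun, ← eFun_add]
  have e : eFun (((A • τ : ℍ) : ℂ) * L.quad (ratVec v) + L.bil (ratVec v) ((c * (t : ℂ))⁻¹ • z)) *
      eFun (-(A 1 0 : ℂ) * L.quad z / (c * t)) =
      eFun (((A 0 0 * L.quad v : ℚ) : ℂ) / c + -L.quad (z - (c : ℂ)⁻¹ • ratVec v) / t) := by
    rw [← eFun_add]
    congr 1
    have hq : L.quad (z - (c : ℂ)⁻¹ • ratVec v) = L.quad z +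
        (c : ℂ)⁻¹ ^ 2 * ((L.quad v : ℚ) : ℂ) - (c : ℂ)⁻¹ * L.bil (ratVec v) z := by
      rw [sub_eq_add_neg, ← _root_.neg_smul, quad_add, quad_smul, bil_smul_right, quad_ratVec,
        L.bil_comm z]
      ring
    rw [hs, hA, hq, bil_smul_right, quad_ratVec]
    push_cast
    field_simp
    ring
  rw [← e]
  ring

/-- The effect on `g_s` of the translations `τ ↦ τ + d / c` and `z ↦ z - v / c` is multiplication
by a root of unity, which enters the summands of the Gauss sum. -/
theorem gFun_shift (s v : Fin n → ℚ) (d : ℤ) {c : ℕ} [NeZero c] (τ t : ℍ)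
    (ht : (t : ℂ) = τ + (d : ℂ) / c) (z : Fin n → ℂ) :
    L.gFun s t (z - (c : ℂ)⁻¹ • ratVec v) =
      eFun (((d * L.quad s - L.bil s v : ℚ) : ℂ) / c) * L.gFun s τ z := by
  have hc : (c : ℂ) ≠ 0 := by exact_mod_cast NeZero.ne c
  rw [gFun, gFun, ← eFun_add]
  congr 1
  rw [ht, sub_eq_add_neg, ← _root_.neg_smul, bil_add_right, bil_smul_right, quad_ratVec,
    bil_ratVec]
  push_cast
  field_simp
  ring

theorem summable_norm_slashSL (k : ℤ) (hk : 0 ≤ k) (r : Fin n → ℚ) (A : SL(2, ℤ)) (τ : ℍ)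
    (z : Fin n → ℂ) :
    Summable fun l : Fin n → ℤ => ‖L.slashSL k (L.gFun (r + intVec ℚ l)) A τ z‖ := by
  obtain ⟨C, hC, a, ha, h⟩ := L.exists_term_bound k hk r (K := {(τ, z)}) isCompact_singleton
  have hN : 0 < ‖A 1‖ := norm_pos_iff.mpr (SL_bottom_row_ne_zero A)
  refine Summable.of_nonneg_of_le (fun _ => norm_nonneg _) (fun l => h A l (τ, z) rfl) ?_
  refine Summable.mul_left _ ?_
  refine (summable_exp_neg_norm_sq (n := n) (a := a / ‖A 1‖ ^ 2) (by positivity)).congr fun l => ?_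
  congr 1
  field_simp

/-- For `c > 0` the series is split by the class of `λ` modulo `c`. Within a class it is a theta
series at `-1 / t`, `t = τ + d / c`, and `theta_transform` turns it into a sum over the dual lattice.
The sum of the resulting roots of unity over the classes is a Gauss sum. -/
theorem tsum_slashSL_pos (k : ℤ) (hk : 0 ≤ k) {r : Fin n → ℚ} (hr : r ∈ L.isotropic)
    {A : SL(2, ℤ)} {c : ℕ} [NeZero c] (hA : A 1 0 = c) (τ : ℍ) (z : Fin n → ℂ) :
    ∑' l : Fin n → ℤ, L.slashSL k (L.gFun (r + intVec ℚ l)) A τ z =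
      Complex.I ^ (-k) / (Real.sqrt L.det : ℝ) * (c : ℂ) ^ (-k) *
        (-Complex.I * (τ + (A 1 1 : ℂ) / c)) ^ (-((k : ℂ) - n / 2)) *
        ∑' m : Fin n → ℤ, L.gaussSum c (A 0 0) (A 1 1) (L.dualVec m) r * L.gFun (L.dualVec m) τ z := by
  have hc : (c : ℂ) ≠ 0 := by exact_mod_cast NeZero.ne c
  set t : ℍ := ((A 1 1 : ℝ) / c : ℝ) +ᵥ τ with htdef
  have ht : (t : ℂ) = τ + (A 1 1 : ℂ) / c := by
    rw [htdef, UpperHalfPlane.coe_vadd]; push_cast; ring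
  have ht0 := t.ne_zero
  -- `blockEquiv` writes `λ` as `l + c q` with `l` a representative modulo `c`.
  have hsum := (L.summable_norm_slashSL k hk r A τ z).of_norm
  have hs2 : Summable fun x : (Fin n → ZMod c) × (Fin n → ℤ) =>
      L.slashSL k (L.gFun (r + intVec ℚ (blockEquiv n c x))) A τ z :=
    (blockEquiv n c).summable_iff.mpr hsum
  rw [← (blockEquiv n c).tsum_eq, hs2.tsum_prod, tsum_fintype]
  have hl : ∀ l : Fin n → ZMod c,
      ∑' q : Fin n → ℤ, L.slashSL k (L.gFun (r + intVec ℚ (blockEquiv n c (l, q)))) A τ z =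
      (c : ℂ) ^ (-k) * (t : ℂ) ^ (-k) * ((-Complex.I * t) ^ (n / 2 : ℂ) / (Real.sqrt L.det : ℝ)) *
        ∑' m : Fin n → ℤ, L.gaussTerm c (A 0 0) (A 1 1) (L.dualVec m) r (liftVec l) *
          L.gFun (L.dualVec m) τ z := by
    intro l
    set v := intVec ℚ (liftVec l) + r with hv
    have hvi : v ∈ L.isotropic := by
      rw [hv, add_comm]; exact L.isotropic_add hr _
    have e1 : ∀ q : Fin n → ℤ, r + intVec ℚ (blockEquiv n c (l, q)) = v + (c : ℚ) • intVec ℚ q := by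
      intro q
      ext i; simp [hv, intVec, liftVec, blockEquiv_apply]; ring
    have e2 : ∀ q : Fin n → ℤ, L.slashSL k (L.gFun (v + (c : ℚ) • intVec ℚ q)) A τ z =
        (c : ℂ) ^ (-k) * (t : ℂ) ^ (-k) * eFun (((A 0 0 * L.quad v : ℚ) : ℂ) / c) *
          eFun (-L.quad ((z - (c : ℂ)⁻¹ • ratVec v) - intVec ℂ q) / t) := by
      intro q
      rw [L.slashSL_gFun_pos k _ hA τ t ht]
      have e3 : z - (c : ℂ)⁻¹ • ratVec (v + (c : ℚ) • intVec ℚ q) =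
          (z - (c : ℂ)⁻¹ • ratVec v) - intVec ℂ q := by
        ext i; simp [ratVec, intVec]; field_simp; ring
      -- The root of unity depends only on `l`, because `β(v, q)` and `β(q)` are integers.
      have e4 : eFun (((A 0 0 * L.quad (v + (c : ℚ) • intVec ℚ q) : ℚ) : ℂ) / c) =
          eFun (((A 0 0 * L.quad v : ℚ) : ℂ) / c) := by
        obtain ⟨t1, h1⟩ := hvi.1 q
        obtain ⟨t2, h2⟩ := L.quad_rat_intVec q
        refine eFun_eq_of_eq_add_int (A 0 0 * (t1 + c * t2)) ?_
        rw [quad_add_field, quad_smul_field, bil_smul_right, h1, h2]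
        push_cast
        field_simp
        ring
      rw [e3, e4]
      ring
    simp only [e1, e2]
    rw [tsum_mul_left, theta_transform]
    have e5 : ∀ m : Fin n → ℤ, L.gFun (L.dualVec m) t (z - (c : ℂ)⁻¹ • ratVec v) =
        eFun (((A 1 1 * L.quad (L.dualVec m) - L.bil (L.dualVec m) v : ℚ) : ℂ) / c) *
          L.gFun (L.dualVec m) τ z := fun m => L.gFun_shift _ v (A 1 1) τ t ht z
    have e6 : ∀ m : Fin n → ℤ, L.gaussTerm c (A 0 0) (A 1 1) (L.dualVec m) r (liftVec l) *
        L.gFun (L.dualVec m) τ z = eFun (((A 0 0 * L.quad v : ℚ) : ℂ) / c) *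
        (eFun (((A 1 1 * L.quad (L.dualVec m) - L.bil (L.dualVec m) v : ℚ) : ℂ) / c) *
          L.gFun (L.dualVec m) τ z) := by
      intro m
      rw [gaussTerm, ← mul_assoc, ← eFun_add, ← hv]
      congr 2
      push_cast
      ring
    simp only [e5, e6, tsum_mul_left]
    ring
  simp only [hl]
  rw [← Finset.mul_sum, ← Summable.tsum_finsetSum]
  · have hI : (t : ℂ) ^ (-k) * (-Complex.I * t) ^ (n / 2 : ℂ) =
        Complex.I ^ (-k) * (-Complex.I * (τ + (A 1 1 : ℂ) / c)) ^ (-((k : ℂ) - n / 2)) := by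
      rw [← ht]
      have h0 : -Complex.I * (t : ℂ) ≠ 0 := mul_ne_zero (neg_ne_zero.mpr Complex.I_ne_zero) ht0
      have h1 : (t : ℂ) ^ (-k) = Complex.I ^ (-k) * (-Complex.I * t) ^ (-k) := by
        rw [← mul_zpow]; congr 1; rw [← mul_assoc]; simp
      have h2 : (-Complex.I * (t : ℂ)) ^ (-k) = (-Complex.I * (t : ℂ)) ^ (-(k : ℂ)) := by
        rw [← Complex.cpow_intCast]; push_cast; rfl
      rw [h1, h2, mul_assoc, ← Complex.cpow_add _ _ h0]
      congr 2
      ring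
    have hfin : ∀ m : Fin n → ℤ, ∑ l : Fin n → ZMod c,
        L.gaussTerm c (A 0 0) (A 1 1) (L.dualVec m) r (liftVec l) * L.gFun (L.dualVec m) τ z =
        L.gaussSum c (A 0 0) (A 1 1) (L.dualVec m) r * L.gFun (L.dualVec m) τ z := by
      intro m; rw [gaussSum, Finset.sum_mul]
    simp only [hfin]
    linear_combination ((c : ℂ) ^ (-k) / (Real.sqrt L.det : ℝ) * ∑' m : Fin n → ℤ,
      L.gaussSum c (A 0 0) (A 1 1) (L.dualVec m) r * L.gFun (L.dualVec m) τ z) * hI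
  · intro l _
    refine Summable.of_norm ?_
    simpa only [norm_mul, norm_gaussTerm, one_mul] using L.summable_norm_gFun_dual τ z

end EvenLattice

/-! ### The Weierstrass `M`-test -/

theorem convergesAbsUnif_of_bound {n : ℕ} {ι : Type*} {f : ι → ℍ → (Fin n → ℂ) → ℂ}
    {F : ℍ → (Fin n → ℂ) → ℂ} (hF : ∀ τ z, F τ z = ∑' i, f i τ z)
    (h : ∀ K : Set (ℍ × (Fin n → ℂ)), IsCompact K →
      ∃ u : ι → ℝ, Summable u ∧ ∀ i, ∀ w ∈ K, ‖f i w.1 w.2‖ ≤ u i) :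
    ConvergesAbsUnif f F := by
  intro K hK
  obtain ⟨u, hu, hb⟩ := h K hK
  refine ⟨(HasSumUniformlyOn.of_norm_le_summable (f := fun i (w : ℍ × (Fin n → ℂ)) =>
    ‖f i w.1 w.2‖) hu (fun i w hw => by rw [norm_norm]; exact hb i w hw)).summableUniformlyOn, ?_⟩
  have := HasSumUniformlyOn.of_norm_le_summable (f := fun i (w : ℍ × (Fin n → ℂ)) =>
    f i w.1 w.2) hu hb
  simpa only [hF] using this

namespace EvenLattice

variable {n : ℕ} (L : EvenLattice n)

theorem rank_div_two_add_two_lt {k : ℤ} (hk : (n : ℚ) / 2 + 2 < k) : 2 < (k : ℝ) - n / 2 := by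
  have h : (((n : ℚ) / 2 + 2 : ℚ) : ℝ) < ((k : ℚ) : ℝ) := by exact_mod_cast hk
  push_cast at h
  linarith

theorem weight_pos {k : ℤ} (hk : (n : ℚ) / 2 + 2 < k) : 0 < k := by
  have h : (0 : ℚ) < k := lt_of_le_of_lt (by positivity) hk
  exact_mod_cast h

/-! ### The matrix `-A` -/

/-- Since `-A` acts on `(τ, z)` as `A` followed by `z ↦ -z`, it replaces `s` by `-s`. -/
theorem slashSL_gFun_neg (k : ℤ) (s : Fin n → ℚ) (A : SL(2, ℤ)) (τ : ℍ) (z : Fin n → ℂ) :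
    L.slashSL k (L.gFun s) (-A) τ z = (-1) ^ k * L.slashSL k (L.gFun (-s)) A τ z := by
  have hj : jfac (-A) τ = -jfac A τ := by simp [jfac]; ring
  have h1 : (-A) • τ = A • τ := UpperHalfPlane.ext (by
    rw [coe_smul_eq, coe_smul_eq, hj]; simp; ring_nf
    )
  have hc : (((-A : SL(2, ℤ)) 1 0 : ℤ) : ℂ) = -((A 1 0 : ℤ) : ℂ) := by simp
  have hg : L.gFun s (A • τ) ((-jfac A τ)⁻¹ • z) = L.gFun (-s) (A • τ) ((jfac A τ)⁻¹ • z) := by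
    have : ratVec (-s) = (-1 : ℂ) • ratVec s := by ext i; simp [ratVec]
    rw [gFun, gFun, this, quad_smul, bil_smul_left, bil_smul_right, bil_smul_right, inv_neg]
    congr 1
    ring
  rw [slashSL_eq, slashSL_eq, hj, h1, hc, hg, neg_eq_neg_one_mul (jfac A τ), mul_zpow]
  have h2 : (-1 : ℂ) ^ (-k) = (-1) ^ k := by
    rw [_root_.zpow_neg, ← _root_.inv_zpow]; norm_num
  have h3 : -(-((A 1 0 : ℤ) : ℂ)) * L.quad z / (-1 * jfac A τ) =
      -((A 1 0 : ℤ) : ℂ) * L.quad z / jfac A τ := by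
    rw [neg_one_mul, div_neg, ← neg_div]; ring_nf
  rw [h2, h3]
  ring

/-- The isotropic element `-r`. -/
def isotropicNeg (r : L.isotropic) : L.isotropic := ⟨-r, L.isotropic_neg r.2⟩

theorem fiberSum_neg (k : ℤ) (r : L.isotropic) (A : SL(2, ℤ)) (τ : ℍ) (z : Fin n → ℂ) :
    L.fiberSum k r (SLCosets.mk (-A)) τ z =
      (-1) ^ k * L.fiberSum k (L.isotropicNeg r) (SLCosets.mk A) τ z := by
  rw [fiberSum_mk, fiberSum_mk, ← tsum_mul_left, ← (Equiv.neg (Fin n → ℤ)).tsum_eq]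
  refine tsum_congr fun l => ?_
  rw [slashSL_gFun_neg]
  congr 3
  simp only [isotropicNeg]
  ext i
  simp [intVec]
  ring

theorem fiberSum_mk_pos (k : ℤ) (hk : 0 ≤ k) (r : L.isotropic) {A : SL(2, ℤ)} {c : ℕ} [NeZero c]
    (hA : A 1 0 = c) (τ : ℍ) (z : Fin n → ℂ) :
    L.fiberSum k r (SLCosets.mk A) τ z =
      Complex.I ^ (-k) / (Real.sqrt L.det : ℝ) * (c : ℂ) ^ (-k) *
        (-Complex.I * (τ + (A 1 1 : ℂ) / c)) ^ (-((k : ℂ) - n / 2)) *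
        ∑' m : Fin n → ℤ, L.gaussSum c (A 0 0) (A 1 1) (L.dualVec m) r * L.gFun (L.dualVec m) τ z := by
  rw [fiberSum_mk, L.tsum_slashSL_pos k hk r.2 hA]

theorem fiberSum_one (k : ℤ) (r : L.isotropic) (τ : ℍ) (z : Fin n → ℂ) :
    L.fiberSum k r (SLCosets.mk 1) τ z = ∑' l : Fin n → ℤ, L.gFun (r + intVec ℚ l) τ z := by
  rw [fiberSum_mk]; simp only [slashSL_one]

/-! ### Convergence of the Eisenstein series -/

/-- The translates `r + λ` of an element of the dual lattice, as dual vectors. -/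
theorem exists_shift_dualVec {r : Fin n → ℚ} (hr : r ∈ L.dual) :
    ∃ f : (Fin n → ℤ) → (Fin n → ℤ), Function.Injective f ∧
      ∀ l, L.dualVec (f l) = r + intVec ℚ l := by
  have hm : ∀ l : Fin n → ℤ, r + intVec ℚ l ∈ L.dual := by
    intro l x
    obtain ⟨m, hm⟩ := hr x
    exact ⟨m + L.bil l x, by rw [bil_add_left, hm, bil_rat_intVec]; push_cast; rfl⟩
  have h2 : ∀ l, L.dualVec (L.dualEquiv.symm ⟨_, hm l⟩) = r + intVec ℚ l := by
    intro l
    have := L.dualEquiv.apply_symm_apply ⟨_, hm l⟩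
    exact congrArg Subtype.val this
  refine ⟨fun l => L.dualEquiv.symm ⟨_, hm l⟩, fun l l' h => ?_, h2⟩
  have h3 := (h2 l).symm.trans ((congrArg L.dualVec h).trans (h2 l'))
  ext i
  have := congrFun (add_left_cancel h3) i
  simpa [intVec] using this

theorem summable_norm_gFun_shift {r : Fin n → ℚ} (hr : r ∈ L.dual) (τ : ℍ) (z : Fin n → ℂ) :
    Summable fun l : Fin n → ℤ => ‖L.gFun (r + intVec ℚ l) τ z‖ := by
  obtain ⟨f, hf, h⟩ := L.exists_shift_dualVec hr
  simpa only [Function.comp_def, h] using (L.summable_norm_gFun_dual τ z).comp_injective hf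

theorem tsum_norm_gFun_shift_le {r : Fin n → ℚ} (hr : r ∈ L.dual) (τ : ℍ) (z : Fin n → ℂ) :
    ∑' l : Fin n → ℤ, ‖L.gFun (r + intVec ℚ l) τ z‖ ≤ L.absTheta τ z := by
  obtain ⟨f, hf, h⟩ := L.exists_shift_dualVec hr
  exact (L.summable_norm_gFun_shift hr τ z).tsum_le_tsum_of_inj f hf (fun _ _ => norm_nonneg _)
    (fun l => by rw [h]) (L.summable_norm_gFun_dual τ z)

theorem absTheta_nonneg (τ : ℍ) (z : Fin n → ℂ) : 0 ≤ L.absTheta τ z :=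
  tsum_nonneg fun _ => norm_nonneg _

theorem isUnit_of_SL (A : SL(2, ℤ)) {c : ℕ} (hA : A 1 0 = c) :
    ((A 0 0 : ℤ) : ZMod c) * ((A 1 1 : ℤ) : ZMod c) = 1 := by
  have h := congrArg (Int.cast : ℤ → ZMod c) (SL_det A)
  rw [hA] at h
  simpa using h

/-- The power of `c` gained in `norm_gaussSum_le` combines with the prefactor of `tsum_slashSL_pos`
to a power of `|cτ + d|`. -/
theorem norm_prefactor (k : ℤ) {A : SL(2, ℤ)} {c : ℕ} [NeZero c] (hA : A 1 0 = c) (τ : ℍ) :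
    ‖Complex.I ^ (-k) / (Real.sqrt L.det : ℝ) * (c : ℂ) ^ (-k) *
      (-Complex.I * (τ + (A 1 1 : ℂ) / c)) ^ (-((k : ℂ) - n / 2))‖ *
      (L.det ^ ((n : ℝ) / 2) * (c : ℝ) ^ ((n : ℝ) / 2)) =
    1 / Real.sqrt L.det * L.det ^ ((n : ℝ) / 2) * ‖jfac A τ‖ ^ (-((k : ℝ) - n / 2)) := by
  have hc0 : (c : ℂ) ≠ 0 := by exact_mod_cast NeZero.ne c
  have hcr : (0 : ℝ) < c := by exact_mod_cast Nat.pos_of_ne_zero (NeZero.ne c)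
  set α : ℝ := (k : ℝ) - n / 2 with hα
  have hexp : (-((k : ℂ) - n / 2)) = ((-α : ℝ) : ℂ) := by rw [hα]; push_cast; ring
  have hj : jfac A τ = c * (τ + (A 1 1 : ℂ) / c) := by
    rw [jfac, hA]; push_cast; field_simp
  have hcp : (c : ℝ) ^ (-k) * (c : ℝ) ^ ((n : ℝ) / 2) = (c : ℝ) ^ (-α) := by
    rw [← Real.rpow_intCast, ← Real.rpow_add hcr]
    congr 1; push_cast; rw [hα]; ring
  rw [norm_mul, norm_mul, norm_div, norm_zpow, Complex.norm_I, _root_.one_zpow,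
    Complex.norm_real, Real.norm_of_nonneg (Real.sqrt_nonneg _), hexp, Complex.norm_cpow_real,
    norm_mul, norm_neg, Complex.norm_I, one_mul, norm_zpow, Complex.norm_natCast, hj, norm_mul,
    Complex.norm_natCast, Real.mul_rpow hcr.le (norm_nonneg _), ← hcp]
  ring

/-- The partial sum over a coset of `SL₂(ℤ)_∞` decays like `|cτ + d|^{-(k - n/2)}`. -/
theorem exists_norm_fiberSum_le (k : ℤ) (hk : 0 ≤ k) : ∃ C > 0, ∀ (r : L.isotropic)
    (A : SL(2, ℤ)) (τ : ℍ) (z : Fin n → ℂ), ‖L.fiberSum k r (SLCosets.mk A) τ z‖ ≤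
      C * ‖jfac A τ‖ ^ (-((k : ℝ) - n / 2)) * L.absTheta τ z := by
  have hdet := L.det_pos
  set C₀ : ℝ := 1 / Real.sqrt L.det * L.det ^ ((n : ℝ) / 2) with hC₀
  have hC0 : 0 < C₀ := by positivity
  refine ⟨1 + C₀, by positivity, ?_⟩
  set α : ℝ := (k : ℝ) - n / 2 with hα
  have hpos : ∀ (r : L.isotropic) (A : SL(2, ℤ)) (τ : ℍ) (z : Fin n → ℂ),
      (0 < A 1 0 ∨ A 1 0 = 0 ∧ A 1 1 = 1) → ‖L.fiberSum k r (SLCosets.mk A) τ z‖ ≤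
        (1 + C₀) * ‖jfac A τ‖ ^ (-α) * L.absTheta τ z := by
    intro r A τ z h
    rcases h with h | ⟨h0, h1⟩
    · obtain ⟨c, hc⟩ : ∃ c : ℕ, A 1 0 = c := ⟨(A 1 0).toNat, (Int.toNat_of_nonneg h.le).symm⟩
      have hc0 : c ≠ 0 := by rintro rfl; simp [hc] at h
      have : NeZero c := ⟨hc0⟩
      rw [L.fiberSum_mk_pos k hk r hc]
      have hu : IsUnit ((A 0 0 : ℤ) : ZMod c) := IsUnit.of_mul_eq_one _ (isUnit_of_SL A hc)
      have hG : ‖∑' m : Fin n → ℤ, L.gaussSum c (A 0 0) (A 1 1) (L.dualVec m) r *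
          L.gFun (L.dualVec m) τ z‖ ≤
          L.det ^ ((n : ℝ) / 2) * (c : ℝ) ^ ((n : ℝ) / 2) * L.absTheta τ z := by
        rw [absTheta, ← tsum_mul_left]
        refine tsum_of_norm_bounded ((L.summable_norm_gFun_dual τ z).mul_left _).hasSum fun m => ?_
        rw [norm_mul]
        gcongr
        exact L.norm_gaussSum_le hu _ (L.dualVec_mem m) r.2
      have hT := L.absTheta_nonneg τ z
      rw [norm_mul]
      refine (mul_le_mul_of_nonneg_left hG (norm_nonneg _)).trans_eq ?_ |>.trans
        (mul_le_mul_of_nonneg_right (mul_le_mul_of_nonneg_right (by linarith : C₀ ≤ 1 + C₀)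
          (by positivity)) hT)
      rw [← mul_assoc, L.norm_prefactor k hc]
    -- The coset of the identity, where the partial sum is a theta series.
    · have hA : SLCosets.mk A = SLCosets.mk 1 := SLCosets.mk_eq_iff.mpr (by simp [h0, h1])
      have hj : jfac A τ = 1 := by simp [jfac, h0, h1]
      rw [hA, hj, fiberSum_one, norm_one, Real.one_rpow, mul_one]
      have := L.absTheta_nonneg τ z
      calc _ ≤ L.absTheta τ z :=
            (norm_tsum_le_tsum_norm (L.summable_norm_gFun_shift r.2.1 τ z)).trans
              (L.tsum_norm_gFun_shift_le r.2.1 τ z)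
        _ ≤ _ := le_mul_of_one_le_left this (by linarith)
  intro r A τ z
  -- otherwise `-A` has a bottom row of the form already treated
  by_cases h : 0 < A 1 0 ∨ A 1 0 = 0 ∧ A 1 1 = 1
  · exact hpos r A τ z h
  · have h' : 0 < (-A) 1 0 ∨ (-A) 1 0 = 0 ∧ (-A) 1 1 = 1 := by
      simp only [Matrix.SpecialLinearGroup.coe_neg, Matrix.neg_apply]
      push Not at h
      rcases h.1.lt_or_eq with h0 | h0
      · left; linarith
      · right
        refine ⟨by linarith, ?_⟩
        have hd := SL_det A
        rw [h0, mul_zero, sub_zero] at hd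
        rcases Int.eq_one_or_neg_one_of_mul_eq_one' hd with h1 | h1
        · exact absurd h1.2 (h.2 h0)
        · rw [h1.2]; rfl
    have := hpos (L.isotropicNeg r) (-A) τ z h'
    rw [← neg_neg A, fiberSum_neg, norm_mul, norm_zpow, norm_neg, norm_one, _root_.one_zpow, one_mul]
    refine this.trans_eq ?_
    rw [neg_neg]
    congr 3
    rw [← norm_neg]
    congr 1
    simp [jfac]; ring

theorem continuous_r : Continuous EisensteinSeries.r := by
  unfold EisensteinSeries.r EisensteinSeries.r1
  refine UpperHalfPlane.continuous_im.min (Real.continuous_sqrt.comp ?_)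
  refine Continuous.div (UpperHalfPlane.continuous_im.pow 2)
    ((UpperHalfPlane.continuous_re.pow 2).add (UpperHalfPlane.continuous_im.pow 2)) fun τ => ?_
  have := τ.im_pos
  positivity

/-- The function `absTheta` is bounded on compact sets. -/
theorem exists_absTheta_le_of_isCompact {K : Set (ℍ × (Fin n → ℂ))} (hK : IsCompact K) :
    ∃ C > 0, ∀ w ∈ K, L.absTheta w.1 w.2 ≤ C := by
  rcases K.eq_empty_or_nonempty with rfl | hne
  · exact ⟨1, one_pos, by simp⟩
  obtain ⟨w₂, -, hv⟩ := hK.exists_isMinOn hne (f := fun w => w.1.im)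
    (UpperHalfPlane.continuous_im.comp continuous_fst).continuousOn
  obtain ⟨w₅, -, hE⟩ := hK.exists_isMaxOn hne
    (f := fun w => Real.exp (2 * Real.pi * w.1.im * L.quad (coordP w.1 w.2)))
    (by
      refine Continuous.continuousOn ?_
      have hi := UpperHalfPlane.continuous_im.comp (continuous_fst (X := ℍ) (Y := Fin n → ℂ))
      exact Real.continuous_exp.comp ((continuous_const.mul hi).mul
        (L.continuous_quad_real.comp continuous_coordP)))
  obtain ⟨C, hC, h⟩ := L.exists_absTheta_bound (B := w₂.1.im) w₂.1.im_pos
  refine ⟨C * Real.exp (2 * Real.pi * w₅.1.im * L.quad (coordP w₅.1 w₅.2)), by positivity, ?_⟩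
  intro w hw
  exact (h w.1 w.2 (hv hw)).trans (mul_le_mul_of_nonneg_left (hE hw) hC.le)

theorem summable_row_norm {α : ℝ} (hα : 2 < α) : Summable fun q : SLCosets => ‖q.row‖ ^ (-α) :=
  (EisensteinSeries.summable_one_div_norm_rpow hα).comp_injective SLCosets.row_injective

theorem jfac_rpow_le {α : ℝ} (hα : 0 ≤ α) (A : SL(2, ℤ)) (τ : ℍ) :
    ‖jfac A τ‖ ^ (-α) ≤ EisensteinSeries.r τ ^ (-α) * ‖A 1‖ ^ (-α) :=
  EisensteinSeries.summand_bound τ hα (A 1)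

/-- A summable majorant of the partial sums on a compact set. -/
theorem exists_fiberSum_bound {k : ℤ} (hk : (n : ℚ) / 2 + 2 < k) (r : L.isotropic)
    {K : Set (ℍ × (Fin n → ℂ))} (hK : IsCompact K) :
    ∃ u : SLCosets → ℝ, Summable u ∧ ∀ q, ∀ w ∈ K, ‖L.fiberSum k r q w.1 w.2‖ ≤ u q := by
  have hα := rank_div_two_add_two_lt hk
  set α : ℝ := (k : ℝ) - n / 2 with hαd
  rcases K.eq_empty_or_nonempty with rfl | hne
  · exact ⟨fun _ => 0, summable_zero, by simp⟩
  obtain ⟨C, hC, h⟩ := L.exists_norm_fiberSum_le k (weight_pos hk).le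
  obtain ⟨T, hT, hTK⟩ := L.exists_absTheta_le_of_isCompact hK
  obtain ⟨w₁, -, hρ⟩ := hK.exists_isMinOn hne (f := fun w => EisensteinSeries.r w.1)
    (continuous_r.comp continuous_fst).continuousOn
  set ρ := EisensteinSeries.r w₁.1
  have hρ0 : 0 < ρ := EisensteinSeries.r_pos _
  refine ⟨fun q => C * ρ ^ (-α) * T * ‖q.row‖ ^ (-α), (summable_row_norm hα).mul_left _, ?_⟩
  intro q w hw
  have hb := h r q.out w.1 w.2
  rw [q.mk_out] at hb
  refine hb.trans ?_
  have h1 := jfac_rpow_le (by linarith : 0 ≤ α) q.out w.1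
  have h2 : EisensteinSeries.r w.1 ^ (-α) ≤ ρ ^ (-α) :=
    Real.rpow_le_rpow_of_nonpos hρ0 (hρ hw) (by linarith)
  have h3 := L.absTheta_nonneg w.1 w.2
  calc C * ‖jfac q.out w.1‖ ^ (-α) * L.absTheta w.1 w.2
      ≤ C * (ρ ^ (-α) * ‖q.row‖ ^ (-α)) * T := by
        gcongr
        · exact h1.trans (mul_le_mul_of_nonneg_right h2 (by positivity))
        · exact hTK w hw
    _ = _ := by ring

theorem two_mul_eisenstein (k : ℤ) (r : L.isotropic) (τ : ℍ) (z : Fin n → ℂ) :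
    2 * L.eisenstein k r τ z = ∑' q : SLCosets, L.fiberSum k r q τ z := by
  rw [eisenstein]; ring

theorem convergesAbsUnif_fiberSum {k : ℤ} (hk : (n : ℚ) / 2 + 2 < k) (r : L.isotropic) :
    ConvergesAbsUnif (L.fiberSum k r) (fun τ z => 2 * L.eisenstein k r τ z) :=
  convergesAbsUnif_of_bound (L.two_mul_eisenstein k r) fun _ hK => L.exists_fiberSum_bound hk r hK

theorem convergesAbsUnif_fiber {k : ℤ} (hk : (n : ℚ) / 2 + 2 < k) (r : L.isotropic)
    (q : SLCosets) : ConvergesAbsUnif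
      (fun p : {p : JacobiCosets n // p.toSL = q} => L.seriesTerm k r p) (L.fiberSum k r q) := by
  refine convergesAbsUnif_of_bound (fun τ z => rfl) fun K hK => ?_
  obtain ⟨C, hC, a, ha, h⟩ := L.exists_term_bound k (weight_pos hk).le r hK
  obtain ⟨A, rfl⟩ : ∃ A, SLCosets.mk A = q := ⟨_, q.mk_out⟩
  have hN : 0 < ‖A 1‖ := norm_pos_iff.mpr (SL_bottom_row_ne_zero A)
  refine ⟨fun p => C * ‖A 1‖ ^ (-k) *
    Real.exp (-a * (‖(JacobiCosets.fiberEquiv A).symm p‖ / ‖A 1‖) ^ 2), ?_, fun p w hw => ?_⟩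
  · refine Summable.mul_left _ ?_
    rw [← (JacobiCosets.fiberEquiv A).summable_iff]
    refine (summable_exp_neg_norm_sq (n := n) (a := a / ‖A 1‖ ^ 2) (by positivity)).congr
      fun l => ?_
    simp only [Function.comp_def, Equiv.symm_apply_apply]
    congr 1
    field_simp
  · obtain ⟨l, rfl⟩ := (JacobiCosets.fiberEquiv A).surjective p
    simp only [seriesTerm_fiberEquiv, Equiv.symm_apply_apply]
    exact h A l w hw

/-- The cosets of `J_∞` as pairs of a coset of `SL₂(ℤ)_∞` and a vector `λ`. -/
theorem exists_sigmaEquiv : ∃ e : (Σ _ : SLCosets, (Fin n → ℤ)) ≃ JacobiCosets n,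
    ∀ q l, e ⟨q, l⟩ = JacobiCosets.fiberEquiv q.out l :=
  ⟨(Equiv.sigmaCongrRight fun q : SLCosets => (JacobiCosets.fiberEquiv q.out).trans
    (Equiv.subtypeEquivRight fun p => by rw [q.mk_out])).trans
    (Equiv.sigmaFiberEquiv JacobiCosets.toSL), fun _ _ => rfl⟩

/-- For a row of norm `N` the sum over `λ` is `O(N^{n-k})` by `exists_sum_exp_le`, hence the condition
`k > n + 2`. -/
theorem summable_sigma_majorant (n : ℕ) {k : ℤ} (hk : (n : ℤ) + 2 < k) {a : ℝ} (ha : 0 < a) :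
    Summable fun x : (Σ _ : SLCosets, (Fin n → ℤ)) =>
      ‖x.1.row‖ ^ (-k) * Real.exp (-a * (‖x.2‖ / ‖x.1.row‖) ^ 2) := by
  obtain ⟨C, -, h⟩ := exists_sum_exp_le (n := n) ha
  have hN : ∀ q : SLCosets, 0 < ‖q.row‖ := fun q => norm_pos_iff.mpr q.row_ne_zero
  have h' : ∀ q : SLCosets,
      Summable (fun m : Fin n → ℤ => Real.exp (-a * (‖m‖ / ‖q.row‖) ^ 2)) ∧
      ∑' m : Fin n → ℤ, Real.exp (-a * (‖m‖ / ‖q.row‖) ^ 2) ≤ C * ‖q.row‖ ^ n := by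
    intro q
    have h0 := hN q
    rw [EisensteinSeries.norm_eq_max_natAbs] at h0 ⊢
    exact h _ (by exact_mod_cast h0)
  have hs : Summable fun q : SLCosets => C * ‖q.row‖ ^ (-(((k : ℝ) - n))) :=
    (summable_row_norm (by
      have : (((n : ℤ) + 2 : ℤ) : ℝ) < k := by exact_mod_cast hk
      push_cast at this
      linarith)).mul_left _
  rw [summable_sigma_of_nonneg fun x => by positivity]
  refine ⟨fun q => (h' q).1.mul_left (‖q.row‖ ^ (-k)), ?_⟩
  refine Summable.of_nonneg_of_le (fun q => tsum_nonneg fun l => by positivity) (fun q => ?_) hs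
  have h0 := hN q
  change ∑' l : Fin n → ℤ, ‖q.row‖ ^ (-k) * Real.exp (-a * (‖l‖ / ‖q.row‖) ^ 2) ≤ _
  rw [tsum_mul_left]
  calc _ ≤ ‖q.row‖ ^ (-k) * (C * ‖q.row‖ ^ n) := by
        gcongr
        exact (h' q).2
    _ = C * (‖q.row‖ ^ (-k) * ‖q.row‖ ^ n) := by ring
    _ = _ := by
      rw [← Real.rpow_intCast, ← Real.rpow_natCast, ← Real.rpow_add h0]
      congr 2; push_cast; ring

theorem convergesAbsUnif_seriesTerm {k : ℤ} (hk : (n : ℚ) / 2 + 2 < k) (hk' : (n : ℤ) + 2 < k)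
    (r : L.isotropic) :
    ConvergesAbsUnif (L.seriesTerm k r) (fun τ z => 2 * L.eisenstein k r τ z) := by
  have key : ∀ K : Set (ℍ × (Fin n → ℂ)), IsCompact K →
      ∃ u : JacobiCosets n → ℝ, Summable u ∧ ∀ p, ∀ w ∈ K, ‖L.seriesTerm k r p w.1 w.2‖ ≤ u p := by
    intro K hK
    obtain ⟨C, hC, a, ha, h⟩ := L.exists_term_bound k (weight_pos hk).le r hK
    obtain ⟨e, he'⟩ := exists_sigmaEquiv (n := n)
    refine ⟨_, e.symm.summable_iff.mpr ((summable_sigma_majorant n hk' ha).mul_left C),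
      fun p w hw => ?_⟩
    obtain ⟨⟨q, l⟩, rfl⟩ := e.surjective p
    rw [Function.comp_apply, e.symm_apply_apply, he', seriesTerm_fiberEquiv, ← mul_assoc]
    exact h q.out l w hw
  refine convergesAbsUnif_of_bound (fun τ z => ?_) key
  obtain ⟨u, hu, hb⟩ := key {(τ, z)} isCompact_singleton
  have hsum : Summable fun p => L.seriesTerm k r p τ z :=
    Summable.of_norm_bounded hu fun p => hb p (τ, z) rfl
  have h2 : Summable fun x : (Σ q : SLCosets, {p : JacobiCosets n // p.toSL = q}) =>
      L.seriesTerm k r x.2 τ z := (Equiv.sigmaFiberEquiv JacobiCosets.toSL).summable_iff.mpr hsum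
  rw [two_mul_eisenstein, ← (Equiv.sigmaFiberEquiv JacobiCosets.toSL).tsum_eq]
  exact h2.tsum_sigma.symm

end EvenLattice

/-! ### The Lipschitz summation formula -/

/-- An exponential absorbs a power; the constant is not optimal. -/
theorem rpow_mul_exp_neg_le {a b t : ℝ} (ha : 0 < a) (hb : 0 < b) (ht : 0 ≤ t) :
    t ^ a * Real.exp (-b * t) ≤ (a / b) ^ a := by
  have h1 : t * Real.exp (-(b / a) * t) ≤ a / b := by
    have h2 := Real.add_one_le_exp (b / a * t)
    have h3 : b / a * t ≤ Real.exp (b / a * t) := by linarith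
    rw [neg_mul, Real.exp_neg, ← div_eq_mul_inv, div_le_iff₀ (Real.exp_pos _)]
    calc t = a / b * (b / a * t) := by field_simp
      _ ≤ _ := by gcongr
  calc t ^ a * Real.exp (-b * t) = (t * Real.exp (-(b / a) * t)) ^ a := by
        rw [Real.mul_rpow ht (Real.exp_pos _).le, ← Real.exp_mul]
        congr 2; field_simp
    _ ≤ _ := by gcongr

open ProbabilityTheory in
/-- Euler's integral with a complex parameter. -/
theorem integral_rpow_mul_cexp_neg {α : ℝ} (hα : 0 < α) {s : ℂ} (hs : 0 < s.re) :
    ∫ t in Set.Ioi (0 : ℝ), ((t ^ (α - 1) : ℝ) : ℂ) * Complex.exp (-(s * t)) =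
      Real.Gamma α * s ^ (-(α : ℂ)) := by
  -- the integral is the moment generating function, at `-s`, of the measure `t ^ (α - 1) dt`
  set μ : Measure ℝ := (volume.restrict (Set.Ioi (0 : ℝ))).withDensity
    (fun t => ENNReal.ofReal (t ^ (α - 1))) with hμ
  have hmeas : Measurable fun t : ℝ => ENNReal.ofReal (t ^ (α - 1)) := by fun_prop
  have hfin : ∀ᵐ t ∂(volume.restrict (Set.Ioi (0 : ℝ))), ENNReal.ofReal (t ^ (α - 1)) < ⊤ :=
    Filter.Eventually.of_forall fun _ => ENNReal.ofReal_lt_top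
  have hM : ∀ s : ℂ, complexMGF id μ (-s) =
      ∫ t in Set.Ioi (0 : ℝ), ((t ^ (α - 1) : ℝ) : ℂ) * Complex.exp (-(s * t)) := by
    intro s
    rw [complexMGF, hμ, integral_withDensity_eq_integral_toReal_smul hmeas hfin]
    refine setIntegral_congr_fun measurableSet_Ioi fun t (ht : 0 < t) => ?_
    simp only [id, ENNReal.toReal_ofReal (Real.rpow_nonneg ht.le _), Complex.real_smul]
    rw [neg_mul]
  have hset : Set.Iio 0 ⊆ interior (integrableExpSet id μ) := by
    refine interior_maximal (fun x (hx : x < 0) => ?_) isOpen_Iio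
    rw [integrableExpSet, Set.mem_ofPred_eq, hμ,
      integrable_withDensity_iff_integrable_smul' hmeas hfin]
    have := integrableOn_rpow_mul_exp_neg_mul_rpow (p := 1) (s := α - 1) (b := -x) (by linarith)
      one_pos (by linarith)
    refine this.congr_fun (fun t (ht : 0 < t) => ?_) measurableSet_Ioi
    simp only [id, ENNReal.toReal_ofReal (Real.rpow_nonneg ht.le _), Real.rpow_one, neg_neg,
      smul_eq_mul]
  set U : Set ℂ := {z : ℂ | z.re < 0} with hU
  have hUo : IsOpen U := isOpen_lt Complex.continuous_re continuous_const
  have hF : AnalyticOnNhd ℂ (complexMGF id μ) U :=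
    analyticOnNhd_complexMGF.mono fun z hz => hset hz
  have hG : AnalyticOnNhd ℂ (fun z : ℂ => (Real.Gamma α : ℂ) * (-z) ^ (-(α : ℂ))) U := by
    refine DifferentiableOn.analyticOnNhd (fun z (hz : z.re < 0) => ?_) hUo
    refine DifferentiableAt.differentiableWithinAt ?_
    refine (differentiableAt_const _).mul (differentiableAt_id.neg.cpow
      (differentiableAt_const _) ?_)
    left; simpa using hz
  have hUc : IsPreconnected U := (convex_halfSpace_re_lt 0).isPreconnected
  have heq : ∀ x : ℝ, 0 < x → complexMGF id μ (-(x : ℂ)) =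
      (Real.Gamma α : ℂ) * (-(-(x : ℂ))) ^ (-(α : ℂ)) := by
    intro x hx
    rw [hM]
    have := Complex.integral_cpow_mul_exp_neg_mul_Ioi (a := (α : ℂ)) (by simpa using hα) hx
    rw [neg_neg, ← Complex.Gamma_ofReal, mul_comm (Complex.Gamma _), Complex.cpow_neg,
      ← Complex.inv_cpow _ _ (by rw [Complex.arg_ofReal_of_nonneg hx.le]; exact Real.pi_pos.ne),
      ← one_div, ← this]
    refine setIntegral_congr_fun measurableSet_Ioi fun t (ht : 0 < t) => ?_
    rw [Complex.ofReal_cpow ht.le]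
    push_cast
    rfl
  have hfreq : ∃ᶠ z in nhdsWithin (-1 : ℂ) {-1}ᶜ, complexMGF id μ z =
      (Real.Gamma α : ℂ) * (-z) ^ (-(α : ℂ)) := by
    have ht : Filter.Tendsto (fun m : ℕ => -(((1 + 1 / ((m : ℝ) + 1) : ℝ)) : ℂ)) Filter.atTop
        (nhdsWithin (-1 : ℂ) {-1}ᶜ) := by
      refine tendsto_nhdsWithin_iff.mpr ⟨?_, Filter.Eventually.of_forall fun m => ?_⟩
      · have h1 : Filter.Tendsto (fun m : ℕ => (1 + 1 / ((m : ℝ) + 1) : ℝ)) Filter.atTop (nhds 1) := by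
          simpa using tendsto_const_nhds.add (tendsto_one_div_add_atTop_nhds_zero_nat (𝕜 := ℝ))
        have h2 := ((Complex.continuous_ofReal.tendsto _).comp h1).neg
        simpa using h2
      · simp only [Set.mem_compl_iff, Set.mem_singleton_iff, neg_inj]
        rw [Complex.ofReal_eq_one]
        have : (0 : ℝ) < 1 / ((m : ℝ) + 1) := by positivity
        linarith
    refine ht.frequently (Filter.Frequently.of_forall fun m => ?_)
    exact heq _ (by positivity)
  have := hF.eqOn_of_preconnected_of_frequently_eq hG hUc (z₀ := -1) (by simp [hU]) hfreq
    (show -s ∈ U by simpa [hU] using hs)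
  rw [← hM, this]
  simp

/-- The function `t ↦ t ^ (α - 1) e(t τ)`, extended by `0` to `t ≤ 0`. -/
noncomputable def powExp (α : ℝ) (τ : ℍ) (t : ℝ) : ℂ :=
  ((max t 0 ^ (α - 1) : ℝ) : ℂ) * eFun (t * τ)

theorem powExp_of_nonpos {α : ℝ} (hα : 1 < α) (τ : ℍ) {t : ℝ} (ht : t ≤ 0) : powExp α τ t = 0 := by
  rw [powExp, max_eq_right ht, Real.zero_rpow (by linarith)]; simp

theorem norm_powExp (α : ℝ) (τ : ℍ) (t : ℝ) :
    ‖powExp α τ t‖ = max t 0 ^ (α - 1) * Real.exp (-(2 * Real.pi * τ.im) * t) := by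
  rw [powExp, norm_mul, Complex.norm_real, Real.norm_of_nonneg (by positivity), norm_eFun]
  congr 2
  simp
  ring

theorem continuous_powExp {α : ℝ} (hα : 1 < α) (τ : ℍ) : Continuous (powExp α τ) := by
  unfold powExp
  refine (Complex.continuous_ofReal.comp ?_).mul (continuous_eFun.comp (by fun_prop))
  exact (continuous_id.max continuous_const).rpow_const fun _ => Or.inr (by linarith)

theorem re_neg_I_mul (τ : ℍ) (x : ℝ) : (-Complex.I * ((τ : ℂ) + x)).re = τ.im := by simp

theorem ofReal_mul_cpow {a : ℝ} (ha : 0 < a) {s : ℂ} (hs : s ≠ 0) (w : ℂ) :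
    ((a : ℂ) * s) ^ w = (a : ℂ) ^ w * s ^ w := by
  have ha' : (a : ℂ) ≠ 0 := by exact_mod_cast ha.ne'
  rw [Complex.cpow_def_of_ne_zero (mul_ne_zero ha' hs), Complex.cpow_def_of_ne_zero ha',
    Complex.cpow_def_of_ne_zero hs, Complex.log_ofReal_mul ha hs, add_mul, Complex.exp_add,
    Complex.ofReal_log ha.le]

open FourierTransform in
/-- The Fourier transform of `powExp` by Euler's integral. -/
theorem fourier_powExp {α : ℝ} (hα : 1 < α) (τ : ℍ) (ξ : ℝ) :
    𝓕 (powExp α τ) ξ = (Real.Gamma α / (2 * Real.pi) ^ α : ℝ) *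
      (-Complex.I * (τ + ((-ξ : ℝ) : ℂ))) ^ (-(α : ℂ)) := by
  have hre := re_neg_I_mul τ (-ξ)
  set w := -Complex.I * (τ + ((-ξ : ℝ) : ℂ)) with hw
  have hw0 : w ≠ 0 := by
    intro h; rw [h] at hre; exact τ.im_pos.ne hre
  have hs : 0 < (((2 * Real.pi : ℝ) : ℂ) * w).re := by
    rw [Complex.re_ofReal_mul, hre]; have := τ.im_pos; positivity
  have h1 := integral_rpow_mul_cexp_neg (by linarith : 0 < α) hs
  have h2 : 𝓕 (powExp α τ) ξ = ∫ t in Set.Ioi (0 : ℝ),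
      ((t ^ (α - 1) : ℝ) : ℂ) * Complex.exp (-(((2 * Real.pi : ℝ) : ℂ) * w * t)) := by
    rw [Real.fourier_eq', ← setIntegral_eq_integral_of_forall_compl_eq_zero (s := Set.Ioi 0)]
    · refine setIntegral_congr_fun measurableSet_Ioi fun t (ht : 0 < t) => ?_
      simp only [powExp, max_eq_left ht.le, smul_eq_mul, eFun]
      rw [mul_left_comm, ← Complex.exp_add]
      congr 2
      simp [hw]
      ring
    · intro t ht
      rw [powExp_of_nonpos hα τ (not_lt.mp ht), smul_zero]
  rw [h2, h1, ofReal_mul_cpow Real.two_pi_pos hw0]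
  have h3 : (((2 * Real.pi : ℝ)) : ℂ) ^ (-(α : ℂ)) = (((2 * Real.pi) ^ α : ℝ) : ℂ)⁻¹ := by
    rw [Complex.cpow_neg, Complex.ofReal_cpow Real.two_pi_pos.le]
  rw [h3]
  push_cast
  ring

/-- Lipschitz' formula. -/
theorem tsum_lipschitz {α : ℝ} (hα : 1 < α) (τ : ℍ) (κ : ℝ) :
    ∑' j : ℤ, (-Complex.I * (τ + (j : ℂ))) ^ (-(α : ℂ)) * eFun ((j : ℂ) * κ) =
      ((2 * Real.pi) ^ α / Real.Gamma α : ℝ) * ∑' l : ℤ, powExp α τ (l - κ) := by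
  have hτ := τ.im_pos
  have hΓ := Real.Gamma_pos_of_pos (by linarith : 0 < α)
  have hf : (powExp α τ) =O[Filter.cocompact ℝ] (|·| ^ (-α)) := by
    refine Asymptotics.IsBigO.of_bound (((α - 1 + α) / (2 * Real.pi * τ.im)) ^ (α - 1 + α)) ?_
    have h0 : ∀ᶠ t : ℝ in Filter.cocompact ℝ, t ≠ 0 := by
      have := (isCompact_singleton (x := (0 : ℝ))).compl_mem_cocompact
      filter_upwards [this] with t ht using ht
    filter_upwards [h0] with t ht
    rcases lt_or_gt_of_ne ht with h | h
    · rw [powExp_of_nonpos hα τ h.le, norm_zero]; positivity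
    · rw [norm_powExp, max_eq_left h.le, abs_of_pos h, Real.norm_of_nonneg (by positivity),
        Real.rpow_neg h.le, ← div_eq_mul_inv, le_div_iff₀ (by positivity)]
      calc _ = t ^ (α - 1 + α) * Real.exp (-(2 * Real.pi * τ.im) * t) := by
            rw [Real.rpow_add h]; ring
        _ ≤ _ := rpow_mul_exp_neg_le (by linarith) (by positivity) h.le
  have hFf : (FourierTransform.fourier (powExp α τ)) =O[Filter.cocompact ℝ] (|·| ^ (-α)) := by
    refine Asymptotics.IsBigO.of_bound (Real.Gamma α / (2 * Real.pi) ^ α * (1 / 2) ^ (-α)) ?_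
    have h0 : ∀ᶠ t : ℝ in Filter.cocompact ℝ, 2 * ‖(τ : ℂ)‖ < ‖t‖ :=
      tendsto_norm_cocompact_atTop.eventually_gt_atTop _
    filter_upwards [h0] with t ht
    have hτ0 := norm_nonneg (τ : ℂ)
    have hlow : 1 / 2 * |t| ≤ ‖-Complex.I * (τ + ((-t : ℝ) : ℂ))‖ := by
      rw [norm_mul, norm_neg, Complex.norm_I, one_mul, add_comm]
      have h3 := norm_sub_norm_le (((-t : ℝ) : ℂ)) (-(τ : ℂ))
      rw [norm_neg, sub_neg_eq_add, Complex.norm_real, norm_neg] at h3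
      rw [← Real.norm_eq_abs]
      linarith
    have ht0 : 0 < |t| := by rw [← Real.norm_eq_abs]; linarith
    rw [fourier_powExp hα, norm_mul, Complex.norm_real,
      show (-(α : ℂ)) = ((-α : ℝ) : ℂ) by push_cast; rfl, Complex.norm_cpow_real,
      Real.norm_of_nonneg (by positivity), Real.norm_of_nonneg (by positivity), mul_assoc,
      ← Real.mul_rpow (by norm_num) ht0.le]
    gcongr ?_ * ?_
    exact Real.rpow_le_rpow_of_nonpos (by positivity) hlow (by linarith)
  have hP := Real.tsum_eq_tsum_fourier_of_rpow_decay (continuous_powExp hα τ) hα hf hFf (-κ)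
  have h1 : ∑' l : ℤ, powExp α τ (l - κ) = ∑' l : ℤ, powExp α τ (-κ + l) :=
    tsum_congr fun l => by rw [neg_add_eq_sub]
  rw [h1, hP, ← (Equiv.neg ℤ).tsum_eq, ← tsum_mul_left]
  refine tsum_congr fun j => ?_
  have hpi : (0 : ℝ) < (2 * Real.pi) ^ α := by positivity
  rw [fourier_powExp hα, fourier_coe_apply, ← mul_assoc, ← mul_assoc, ← Complex.ofReal_mul,
    show (2 * Real.pi) ^ α / Real.Gamma α * (Real.Gamma α / (2 * Real.pi) ^ α) = 1 by field_simp]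
  simp only [Equiv.neg_apply, eFun]
  push_cast
  rw [one_mul]
  congr 2
  ring

namespace EvenLattice

variable {n : ℕ} (L : EvenLattice n)

/-! ### The lattice sums in terms of Gauss sums -/

theorem gaussSum_add_mul_right (c : ℕ) [NeZero c] (a u j : ℤ) (s r : Fin n → ℚ) :
    L.gaussSum c a (u + c * j) s r = eFun ((j : ℂ) * L.quad s) * L.gaussSum c a u s r := by
  have hc : (c : ℂ) ≠ 0 := by exact_mod_cast NeZero.ne c
  rw [gaussSum, gaussSum, Finset.mul_sum]
  refine Finset.sum_congr rfl fun l _ => ?_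
  rw [gaussTerm, gaussTerm, ← eFun_add]
  congr 1
  push_cast
  field_simp
  ring

theorem bil_neg_left {R : Type*} [CommRing R] (x y : Fin n → R) : L.bil (-x) y = -L.bil x y := by
  rw [← neg_one_smul R x, bil_smul_left, neg_one_mul]

theorem bil_neg_right {R : Type*} [CommRing R] (x y : Fin n → R) : L.bil x (-y) = -L.bil x y := by
  rw [bil_comm, bil_neg_left, bil_comm]

theorem quad_neg_field {K : Type*} [Field K] (x : Fin n → K) : L.quad (-x) = L.quad x := by
  rw [quad, quad, bil_neg_left, bil_neg_right, neg_neg]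

theorem dual_neg {s : Fin n → ℚ} (hs : s ∈ L.dual) : -s ∈ L.dual := by
  intro x
  obtain ⟨m, hm⟩ := hs x
  exact ⟨-m, by rw [bil_neg_left, hm]; push_cast; rfl⟩

theorem gaussSum_neg_neg (c : ℕ) [NeZero c] (a d : ℤ) {s r : Fin n → ℚ} (hs : s ∈ L.dual)
    (hr : r ∈ L.isotropic) : L.gaussSum c a d (-s) (-r) = L.gaussSum c a d s r := by
  rw [gaussSum, gaussSum, ← Equiv.sum_comp (Equiv.neg (Fin n → ZMod c))]
  refine Finset.sum_congr rfl fun l _ => ?_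
  have h1 : L.gaussTerm c a d (-s) (-r) (liftVec (Equiv.neg _ l)) =
      L.gaussTerm c a d (-s) (-r) (-liftVec l) := by
    refine L.gaussTerm_congr a d (L.dual_neg hs) (L.isotropic_neg hr) fun i => ?_
    simp [liftVec]
  have h2 : intVec ℚ (-liftVec l) + -r = -(intVec ℚ (liftVec l) + r) := by
    ext i; simp [intVec]; ring
  rw [h1, gaussTerm, gaussTerm, h2, quad_neg_field, quad_neg_field, bil_neg_left, bil_neg_right,
    neg_neg]

/-- The sum over `d` of `H_c` is taken outside; the inner sum over `λ` is a Gauss sum with `-r'` in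
place of `r'`. -/
theorem latticeSum_eq (c : ℕ) [NeZero c] (r : Fin n → ℚ) (D : ℚ) (s : Fin n → ℚ) :
    L.latticeSum c r D s = ∑ u : (ZMod c)ˣ, eFun (((-D * ((u : ZMod c).val : ℚ) : ℚ) : ℂ) / c) *
      L.gaussSum c (((u⁻¹ : (ZMod c)ˣ) : ZMod c).val : ℤ) ((u : ZMod c).val : ℤ) (-s) r := by
  have hc : (c : ℂ) ≠ 0 := by exact_mod_cast NeZero.ne c
  rw [latticeSum, Finset.sum_comm]
  refine Finset.sum_congr rfl fun u _ => ?_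
  rw [gaussSum, Finset.mul_sum]
  refine Finset.sum_congr rfl fun l _ => ?_
  have hv : intVec ℚ (liftVec l) = fun i => ((l i).val : ℚ) := by
    ext i; simp [intVec, liftVec]
  rw [gaussTerm, ← eFun_add, hv, quad_neg_field, bil_neg_left]
  dsimp only
  congr 1
  push_cast
  field_simp
  ring

theorem isUnit_val_inv {c : ℕ} [NeZero c] (u : (ZMod c)ˣ) :
    ((((u⁻¹ : (ZMod c)ˣ) : ZMod c).val : ℤ) : ZMod c) = ((u⁻¹ : (ZMod c)ˣ) : ZMod c) := by simp

/-- The lattice sums are `O(c ^ (n / 2 + 1))`. -/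
theorem norm_latticeSum_le (c : ℕ) [NeZero c] {r : Fin n → ℚ} (hr : r ∈ L.isotropic) (D : ℚ)
    {s : Fin n → ℚ} (hs : s ∈ L.dual) :
    ‖L.latticeSum c r D s‖ ≤ L.det ^ ((n : ℝ) / 2) * (c : ℝ) ^ ((n : ℝ) / 2) * c := by
  have hd := L.det_pos
  rw [latticeSum_eq]
  calc _ ≤ ∑ u : (ZMod c)ˣ, L.det ^ ((n : ℝ) / 2) * (c : ℝ) ^ ((n : ℝ) / 2) := by
        refine (norm_sum_le _ _).trans (Finset.sum_le_sum fun u _ => ?_)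
        have h1 : ‖eFun (((-D * ((u : ZMod c).val : ℚ) : ℚ) : ℂ) / c)‖ = 1 := by
          rw [show ((-D * ((u : ZMod c).val : ℚ) : ℚ) : ℂ) / c =
            (((-D * ((u : ZMod c).val : ℚ) : ℚ) : ℝ) / c : ℝ) by push_cast; rfl, norm_eFun_ofReal]
        rw [norm_mul, h1, one_mul]
        refine L.norm_gaussSum_le ?_ _ (L.dual_neg hs) hr
        rw [isUnit_val_inv]
        exact (u⁻¹).isUnit
    _ = (Fintype.card (ZMod c)ˣ : ℝ) * (L.det ^ ((n : ℝ) / 2) * (c : ℝ) ^ ((n : ℝ) / 2)) := by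
      rw [Finset.sum_const, nsmul_eq_mul, Finset.card_univ]
    _ ≤ (c : ℝ) * (L.det ^ ((n : ℝ) / 2) * (c : ℝ) ^ ((n : ℝ) / 2)) := by
      have : Fintype.card (ZMod c)ˣ ≤ c := by
        rw [ZMod.card_units_eq_totient]; exact Nat.totient_le c
      gcongr
    _ = _ := by ring

/-- A common summable majorant for the series `∑ c^{-k} H_c`. -/
theorem exists_latticeSum_majorant {k : ℤ} (hk : (n : ℚ) / 2 + 2 < k) :
    ∃ w : ℕ+ → ℝ, Summable w ∧ ∀ r ∈ L.isotropic, ∀ (D : ℚ), ∀ s ∈ L.dual, ∀ c : ℕ+,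
      ‖((c : ℕ) : ℂ) ^ (-k) * L.latticeSum c r D s‖ ≤ w c := by
  have hα := rank_div_two_add_two_lt hk
  have hd := L.det_pos
  refine ⟨fun c => L.det ^ ((n : ℝ) / 2) * ((c : ℕ) : ℝ) ^ (-((k : ℝ) - n / 2 - 1)), ?_, ?_⟩
  · refine Summable.mul_left _ ?_
    have := (Real.summable_nat_rpow (p := -((k : ℝ) - n / 2 - 1))).mpr (by linarith)
    exact this.comp_injective PNat.coe_injective
  · intro r hr D s hs c
    have hc : (0 : ℝ) < ((c : ℕ) : ℝ) := by exact_mod_cast c.pos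
    rw [norm_mul, norm_zpow, Complex.norm_natCast]
    calc _ ≤ ((c : ℕ) : ℝ) ^ (-k) * (L.det ^ ((n : ℝ) / 2) * ((c : ℕ) : ℝ) ^ ((n : ℝ) / 2) * (c : ℕ)) := by
          gcongr
          exact L.norm_latticeSum_le c hr D hs
      _ = L.det ^ ((n : ℝ) / 2) *
          (((c : ℕ) : ℝ) ^ (-k) * ((c : ℕ) : ℝ) ^ ((n : ℝ) / 2) * ((c : ℕ) : ℝ) ^ (1 : ℝ)) := by
        rw [Real.rpow_one]; ring
      _ = _ := by
        rw [← Real.rpow_intCast, ← Real.rpow_add hc, ← Real.rpow_add hc]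
        congr 2; push_cast; ring

theorem summable_coeffTerm {k : ℤ} (hk : (n : ℚ) / 2 + 2 < k) (r : L.isotropic) (D : ℚ)
    {s : Fin n → ℚ} (hs : s ∈ L.dual) : Summable (L.coeffTerm k r D s) := by
  obtain ⟨w, hw, h⟩ := L.exists_latticeSum_majorant hk
  have h1 := Summable.of_norm_bounded hw fun c => h r r.2 D s hs c
  have h2 := Summable.of_norm_bounded hw fun c => h (-r) (L.isotropic_neg r.2) D s hs c
  refine (h1.add (h2.mul_left ((-1) ^ k))).congr fun c => ?_
  rw [coeffTerm]
  ring

end EvenLattice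

/-! ### Representatives of the cosets -/

theorem exists_SL_of_coprime {c d : ℤ} (h : IsCoprime c d) : ∃ A : SL(2, ℤ), A 1 0 = c ∧ A 1 1 = d := by
  obtain ⟨A, -, hA⟩ := ModularGroup.bottom_row_surj (R := ℤ) (show ![c, d] ∈ _ from h)
  exact ⟨A, congrFun hA 0, congrFun hA 1⟩

/-- The index set of the cosets with `c > 0`: the residue class of `d` modulo `c` and the integer
`j` in `d = u + c j`. -/
abbrev PosIndex : Type := Σ c : ℕ+, (ZMod (c : ℕ))ˣ × ℤ

theorem exists_posSL (i : PosIndex) : ∃ A : SL(2, ℤ), A 1 0 = ((i.1 : ℕ) : ℤ) ∧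
    A 1 1 = ((i.2.1 : ZMod (i.1 : ℕ)).val : ℤ) + ((i.1 : ℕ) : ℤ) * i.2.2 := by
  refine exists_SL_of_coprime ?_
  have h := ZMod.val_coe_unit_coprime i.2.1
  have h2 : IsCoprime ((i.1 : ℕ) : ℤ) ((i.2.1 : ZMod (i.1 : ℕ)).val : ℤ) :=
    (Nat.isCoprime_iff_coprime.mpr h).symm
  exact IsCoprime.add_mul_left_right h2 _

/-- A matrix with bottom row `(c, u + c j)`. -/
noncomputable def posSL (i : PosIndex) : SL(2, ℤ) := (exists_posSL i).choose

theorem posSL_one_zero (i : PosIndex) : posSL i 1 0 = ((i.1 : ℕ) : ℤ) :=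
  (exists_posSL i).choose_spec.1

theorem posSL_one_one (i : PosIndex) :
    posSL i 1 1 = ((i.2.1 : ZMod (i.1 : ℕ)).val : ℤ) + ((i.1 : ℕ) : ℤ) * i.2.2 :=
  (exists_posSL i).choose_spec.2

theorem posSL_injective {i i' : PosIndex} (h0 : posSL i 1 0 = posSL i' 1 0)
    (h1 : posSL i 1 1 = posSL i' 1 1) : i = i' := by
  obtain ⟨c, u, j⟩ := i
  obtain ⟨c', u', j'⟩ := i'
  rw [posSL_one_zero, posSL_one_zero] at h0
  rw [posSL_one_one, posSL_one_one] at h1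
  obtain rfl : c = c' := PNat.coe_injective (by exact_mod_cast h0)
  have hc : (0 : ℤ) < ((c : ℕ) : ℤ) := by exact_mod_cast c.pos
  have hu : ((u : ZMod (c : ℕ)).val : ℤ) = ((u' : ZMod (c : ℕ)).val : ℤ) := by
    have h2 := congrArg (· % ((c : ℕ) : ℤ)) h1
    simp only [Int.add_mul_emod_self_left] at h2
    rwa [Int.emod_eq_of_lt (by positivity) (by exact_mod_cast ZMod.val_lt _),
      Int.emod_eq_of_lt (by positivity) (by exact_mod_cast ZMod.val_lt _)] at h2
  have hj : j = j' := by
    simp only [hu, add_right_inj] at h1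
    exact mul_left_cancel₀ hc.ne' h1
  have hu' : u = u' := Units.ext (ZMod.val_injective _ (by exact_mod_cast hu))
  rw [hu', hj]

theorem posSL_surjective {A : SL(2, ℤ)} (hA : 0 < A 1 0) :
    ∃ i, A 1 0 = posSL i 1 0 ∧ A 1 1 = posSL i 1 1 := by
  obtain ⟨c, hc⟩ : ∃ c : ℕ+, A 1 0 = ((c : ℕ) : ℤ) :=
    ⟨⟨(A 1 0).toNat, by omega⟩, by simp [hA.le]⟩
  have hu : IsUnit ((A 1 1 : ℤ) : ZMod (c : ℕ)) :=
    IsUnit.of_mul_eq_one ((A 0 0 : ℤ) : ZMod (c : ℕ)) (by rw [mul_comm]; exact EvenLattice.isUnit_of_SL A hc)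
  refine ⟨⟨c, hu.unit, A 1 1 / ((c : ℕ) : ℤ)⟩, ?_, ?_⟩
  · rw [posSL_one_zero, hc]
  · rw [posSL_one_one]
    simp only [IsUnit.unit_spec, ZMod.val_intCast]
    rw [Int.emod_add_mul_ediv]

/-- Representatives of the cosets up to sign. -/
noncomputable def baseSL : Unit ⊕ PosIndex → SL(2, ℤ) := Sum.elim (fun _ => 1) posSL

theorem baseSL_pos (x : Unit ⊕ PosIndex) :
    0 < baseSL x 1 0 ∨ baseSL x 1 0 = 0 ∧ baseSL x 1 1 = 1 := by
  rcases x with _ | i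
  · right; simp [baseSL]
  · left
    change 0 < posSL i 1 0
    rw [posSL_one_zero]
    exact_mod_cast i.1.pos

/-- The representative `± A`. -/
noncomputable def signedSL (x : (Unit ⊕ PosIndex) × Bool) : SL(2, ℤ) :=
  if x.2 then -baseSL x.1 else baseSL x.1

/-- A bottom row is `± (0, 1)` or `± (c, d)` with `c > 0`, and `d = u + c j` in a unique way. -/
theorem signedCoset_bijective : Function.Bijective fun x => SLCosets.mk (signedSL x) := by
  have hneg : ∀ (A : SL(2, ℤ)) (j : Fin 2), (-A) 1 j = -A 1 j := fun A j => by simp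
  constructor
  · rintro ⟨x, b⟩ ⟨x', b'⟩ h
    have h := SLCosets.mk_eq_iff.mp h
    have hbase : baseSL x 1 0 = baseSL x' 1 0 → baseSL x 1 1 = baseSL x' 1 1 → x = x' := by
      intro h0 h1
      rcases x with _ | i <;> rcases x' with _ | i'
      · rfl
      · have h2 : (0 : ℤ) = posSL i' 1 0 := by simpa [baseSL] using h0
        rw [posSL_one_zero] at h2
        have := i'.1.pos
        omega
      · have h2 : posSL i 1 0 = 0 := by simpa [baseSL] using h0
        rw [posSL_one_zero] at h2
        have := i.1.pos
        omega
      · rw [posSL_injective h0 h1]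
    have hx := baseSL_pos x
    have hx' := baseSL_pos x'
    cases b <;> cases b' <;> simp only [signedSL, if_true, hneg, Bool.false_eq_true, if_false] at h
    · rw [hbase h.1 h.2]
    · omega
    · omega
    · rw [hbase (by omega) (by omega)]
  · intro q
    obtain ⟨A, rfl⟩ : ∃ A, SLCosets.mk A = q := ⟨_, q.mk_out⟩
    rcases lt_trichotomy (A 1 0) 0 with h | h | h
    · obtain ⟨i, h0, h1⟩ := posSL_surjective (A := -A) (by rw [hneg]; omega)
      refine ⟨(Sum.inr i, true), SLCosets.mk_eq_iff.mpr ?_⟩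
      simp only [signedSL, if_true, hneg, baseSL, Sum.elim_inr] at h0 h1 ⊢
      omega
    · have hd := SL_det A
      rw [h, mul_zero, sub_zero] at hd
      rcases Int.eq_one_or_neg_one_of_mul_eq_one' hd with h1 | h1
      · exact ⟨(Sum.inl (), false), SLCosets.mk_eq_iff.mpr (by simp [signedSL, baseSL, h, h1.2])⟩
      · exact ⟨(Sum.inl (), true), SLCosets.mk_eq_iff.mpr (by simp [signedSL, baseSL, h, h1.2])⟩
    · obtain ⟨i, h0, h1⟩ := posSL_surjective h
      exact ⟨(Sum.inr i, false), SLCosets.mk_eq_iff.mpr ⟨h0.symm, h1.symm⟩⟩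

/-- The cosets of `SL₂(ℤ)_∞` are represented by `± 1` and by `± A` with `c > 0`. -/
noncomputable def signedCosetEquiv : (Unit ⊕ PosIndex) × Bool ≃ SLCosets :=
  Equiv.ofBijective _ signedCoset_bijective

/-! ### The sum over the cosets with `c > 0` -/

/-- The sums of `|powExp|` over the translates of `ℤ` are uniformly bounded. -/
theorem exists_tsum_powExp_le {α : ℝ} (hα : 1 < α) (τ : ℍ) : ∃ C > 0, ∀ κ : ℝ,
    Summable (fun l : ℤ => ‖powExp α τ (l - κ)‖) ∧ ∑' l : ℤ, ‖powExp α τ (l - κ)‖ ≤ C := by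
  have hτ := τ.im_pos
  set a := Real.pi * τ.im with ha
  have ha0 : 0 < a := by positivity
  set C₀ := ((α - 1) / a) ^ (α - 1) with hC₀
  have hC0 : 0 < C₀ := Real.rpow_pos_of_pos (div_pos (by linarith) ha0) _
  have hb : ∀ t : ℝ, ‖powExp α τ t‖ ≤ C₀ * Real.exp (-a * |t|) := by
    intro t
    rcases le_or_gt t 0 with h | h
    · rw [powExp_of_nonpos hα τ h, norm_zero]; positivity
    · rw [norm_powExp, max_eq_left h.le, abs_of_pos h]
      have h1 := rpow_mul_exp_neg_le (by linarith : 0 < α - 1) ha0 h.le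
      calc _ = (t ^ (α - 1) * Real.exp (-a * t)) * Real.exp (-a * t) := by
            rw [mul_assoc (t ^ (α - 1)), ← Real.exp_add]; congr 2; rw [ha]; ring
        _ ≤ _ := by gcongr
  have hs : Summable fun l : ℤ => Real.exp (-a * |(l : ℝ)|) := by
    have hn : Summable fun l : ℕ => Real.exp (-a * (l : ℝ)) := by
      have := Real.summable_exp_nat_mul_iff.mpr (neg_neg_of_pos ha0)
      exact this.congr fun l => by rw [mul_comm]
    refine Summable.of_nat_of_neg ?_ ?_ <;> simpa using hn
  have hs' := hs.mul_left (C₀ * Real.exp a)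
  refine ⟨∑' l : ℤ, C₀ * Real.exp a * Real.exp (-a * |(l : ℝ)|),
    hs'.tsum_pos (fun _ => by positivity) 0 (by positivity), fun κ => ?_⟩
  -- Shifting the summation by `⌊κ⌋` reduces to `κ ∈ [0, 1)`.
  have key : ∀ l : ℤ, ‖powExp α τ (((l + ⌊κ⌋ : ℤ) : ℝ) - κ)‖ ≤
      C₀ * Real.exp a * Real.exp (-a * |(l : ℝ)|) := by
    intro l
    refine (hb _).trans ?_
    rw [mul_assoc, ← Real.exp_add]
    gcongr
    have h1 : |(l : ℝ)| - 1 ≤ |((l + ⌊κ⌋ : ℤ) : ℝ) - κ| := by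
      have e : ((l + ⌊κ⌋ : ℤ) : ℝ) - κ = l - Int.fract κ := by
        push_cast; rw [← Int.self_sub_floor]; ring
      rw [e]
      have h2 := abs_sub_abs_le_abs_sub (l : ℝ) (Int.fract κ)
      have h3 : |Int.fract κ| ≤ 1 := by
        rw [abs_of_nonneg (Int.fract_nonneg κ)]; exact (Int.fract_lt_one κ).le
      linarith
    nlinarith
  have hsum : Summable fun l : ℤ => ‖powExp α τ (((l + ⌊κ⌋ : ℤ) : ℝ) - κ)‖ :=
    Summable.of_nonneg_of_le (fun _ => norm_nonneg _) key hs'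
  refine ⟨(Equiv.addRight ⌊κ⌋).summable_iff.mp hsum, ?_⟩
  rw [← (Equiv.addRight ⌊κ⌋).tsum_eq]
  exact hsum.tsum_le_tsum key hs'

theorem powExp_vadd (α : ℝ) (τ t : ℍ) {x : ℝ} (ht : (t : ℂ) = τ + x) (y : ℝ) :
    powExp α t y = powExp α τ y * eFun (y * x) := by
  rw [powExp, powExp, ht, mul_assoc, ← eFun_add, mul_add]

namespace EvenLattice

variable {n : ℕ} (L : EvenLattice n)

/-- The constant `i^{-k} / √det`. -/
noncomputable def thetaConst (k : ℤ) : ℂ := Complex.I ^ (-k) / (Real.sqrt L.det : ℝ)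

/-- The `m`-th term in the theta expansion of the partial sum over the coset of `posSL i`. -/
noncomputable def posTerm (k : ℤ) (r : Fin n → ℚ) (τ : ℍ) (z : Fin n → ℂ) (i : PosIndex)
    (m : Fin n → ℤ) : ℂ :=
  L.thetaConst k * ((i.1 : ℕ) : ℂ) ^ (-k) *
    (-Complex.I * (τ + (posSL i 1 1 : ℂ) / ((i.1 : ℕ) : ℂ))) ^ (-((k : ℂ) - n / 2)) *
    (L.gaussSum (i.1 : ℕ) (posSL i 0 0) (posSL i 1 1) (L.dualVec m) r * L.gFun (L.dualVec m) τ z)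

theorem fiberSum_posSL {k : ℤ} (hk : 0 ≤ k) (r : L.isotropic) (τ : ℍ) (z : Fin n → ℂ)
    (i : PosIndex) :
    L.fiberSum k r (SLCosets.mk (posSL i)) τ z = ∑' m, L.posTerm k r τ z i m := by
  rw [L.fiberSum_mk_pos k hk r (posSL_one_zero i), ← tsum_mul_left]
  rfl

theorem posSL_coset_injective : Function.Injective fun i => SLCosets.mk (posSL i) := fun _ _ h =>
  posSL_injective (SLCosets.mk_eq_iff.mp h).1 (SLCosets.mk_eq_iff.mp h).2

theorem isUnit_posSL (i : PosIndex) : IsUnit ((posSL i 0 0 : ℤ) : ZMod (i.1 : ℕ)) :=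
  IsUnit.of_mul_eq_one _ (isUnit_of_SL (posSL i) (posSL_one_zero i))

theorem posSL_inv (i : PosIndex) : ((posSL i 0 0 : ℤ) : ZMod (i.1 : ℕ)) =
    (((((i.2.1)⁻¹ : (ZMod (i.1 : ℕ))ˣ) : ZMod (i.1 : ℕ)).val : ℤ) : ZMod (i.1 : ℕ)) := by
  have h := isUnit_of_SL (posSL i) (posSL_one_zero i)
  rw [isUnit_val_inv]
  have h2 : ((posSL i 1 1 : ℤ) : ZMod (i.1 : ℕ)) = i.2.1 := by
    rw [posSL_one_one]; simp
  rw [h2] at h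
  exact Units.eq_inv_of_mul_eq_one_left ((mul_comm _ _).trans h)

/-- Joint summability over the matrices and the dual vectors, which allows the order of the sums to be
changed. -/
theorem summable_norm_posTerm {k : ℤ} (hk : (n : ℚ) / 2 + 2 < k) (r : L.isotropic) (τ : ℍ)
    (z : Fin n → ℂ) :
    Summable fun x : PosIndex × (Fin n → ℤ) => ‖L.posTerm k r τ z x.1 x.2‖ := by
  have hα := rank_div_two_add_two_lt hk
  have hd := L.det_pos
  set C := 1 / Real.sqrt L.det * L.det ^ ((n : ℝ) / 2) with hC
  have h1 : Summable fun i : PosIndex => C * ‖jfac (posSL i) τ‖ ^ (-((k : ℝ) - n / 2)) := by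
    refine Summable.mul_left _ (Summable.of_nonneg_of_le (fun _ => by positivity)
      (fun i => jfac_rpow_le (by linarith) (posSL i) τ) (Summable.mul_left _ ?_))
    have := (summable_row_norm hα).comp_injective posSL_coset_injective
    simpa only [Function.comp_def, SLCosets.row_mk] using this
  refine Summable.of_nonneg_of_le (fun _ => norm_nonneg _) (fun x => ?_)
    (h1.mul_of_nonneg (L.summable_norm_gFun_dual τ z) (fun _ => by positivity)
      fun _ => norm_nonneg _)
  rw [← L.norm_prefactor k (posSL_one_zero x.1), posTerm, norm_mul, norm_mul (gaussSum L _ _ _ _ _),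
    ← mul_assoc]
  gcongr
  · rfl
  · exact L.norm_gaussSum_le (isUnit_posSL _) _ (L.dualVec_mem _) r.2

/-- The series `∑ c^{-k} H_c(r, D, s_m)` with `D = β(s_m) - l`. -/
noncomputable def latticeSeries (k : ℤ) (r : Fin n → ℚ) (m : Fin n → ℤ) (l : ℤ) : ℂ :=
  ∑' c : ℕ+, ((c : ℕ) : ℂ) ^ (-k) * L.latticeSum c r (L.quad (L.dualVec m) - l) (L.dualVec m)

/-- For fixed `c` and fixed class `u` of `d` modulo `c`, the sum over `d = u + c j` is evaluated by
Lipschitz' formula at `τ + u / c`. -/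
theorem tsum_posTerm_fiber {k : ℤ} (hk : (n : ℚ) / 2 + 2 < k) (r : L.isotropic) (τ : ℍ)
    (z : Fin n → ℂ) (m : Fin n → ℤ) (c : ℕ+) (u : (ZMod (c : ℕ))ˣ) :
    ∑' j : ℤ, L.posTerm k r τ z ⟨c, u, j⟩ m = L.thetaConst k *
      ((2 * Real.pi) ^ ((k : ℝ) - n / 2) / Real.Gamma ((k : ℝ) - n / 2) : ℝ) *
      L.gFun (L.dualVec m) τ z * (((c : ℕ) : ℂ) ^ (-k) *
      ∑' l : ℤ, powExp ((k : ℝ) - n / 2) τ (l - (L.quad (L.dualVec m) : ℚ)) *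
        (eFun (((-(L.quad (L.dualVec m) - l) * ((u : ZMod (c : ℕ)).val : ℚ) : ℚ) : ℂ) / (c : ℕ)) *
        L.gaussSum c (((u⁻¹ : (ZMod (c : ℕ))ˣ) : ZMod (c : ℕ)).val : ℤ)
          ((u : ZMod (c : ℕ)).val : ℤ) (L.dualVec m) r)) := by
  have hα := rank_div_two_add_two_lt hk
  have hc : ((c : ℕ) : ℂ) ≠ 0 := by exact_mod_cast c.ne_zero
  set α : ℝ := (k : ℝ) - n / 2 with hαd
  set κ : ℚ := L.quad (L.dualVec m) with hκ
  set x : ℝ := ((u : ZMod (c : ℕ)).val : ℝ) / (c : ℕ) with hx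
  set t : ℍ := x +ᵥ τ with htd
  have ht : (t : ℂ) = τ + x := by rw [htd, UpperHalfPlane.coe_vadd, add_comm]
  set W := L.gaussSum c (((u⁻¹ : (ZMod (c : ℕ))ˣ) : ZMod (c : ℕ)).val : ℤ)
          ((u : ZMod (c : ℕ)).val : ℤ) (L.dualVec m) r with hW
  have h1 : ∀ j : ℤ, L.posTerm k r τ z ⟨c, u, j⟩ m =
      L.thetaConst k * L.gFun (L.dualVec m) τ z * ((c : ℕ) : ℂ) ^ (-k) * W *
        ((-Complex.I * (t + (j : ℂ))) ^ (-(α : ℂ)) * eFun ((j : ℂ) * ((κ : ℝ) : ℂ))) := by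
    intro j
    have e1 := posSL_one_one ⟨c, u, j⟩
    have e2 := L.gaussSum_congr_left (posSL ⟨c, u, j⟩ 1 1) (L.dualVec m) r.2 (posSL_inv ⟨c, u, j⟩)
    simp only at e1 e2
    rw [posTerm]
    simp only
    rw [e2, e1, gaussSum_add_mul_right, ← hW, ← hκ]
    have e3 : (τ : ℂ) + ((((u : ZMod (c : ℕ)).val : ℤ) + ((c : ℕ) : ℤ) * j : ℤ) : ℂ) / (c : ℕ) =
        t + j := by
      rw [ht, hx]; push_cast; field_simp; ring
    have e4 : (-((k : ℂ) - n / 2)) = -(α : ℂ) := by rw [hαd]; push_cast; ring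
    rw [e3, e4, Complex.ofReal_ratCast]
    ring
  simp only [h1]
  -- The Gauss sum at `d = u + c j` is `e(j κ)` times the Gauss sum at `u`, with `κ = β(s)`.
  rw [tsum_mul_left, tsum_lipschitz (by linarith) t (κ : ℝ)]
  have h2 : ∀ l : ℤ, powExp α τ (l - (κ : ℝ)) *
      (eFun (((-(κ - l) * ((u : ZMod (c : ℕ)).val : ℚ) : ℚ) : ℂ) / (c : ℕ)) * W) =
      W * powExp α t (l - (κ : ℝ)) := by
    intro l
    rw [powExp_vadd α τ t ht]
    have : ((((l : ℝ) - (κ : ℝ) : ℝ)) : ℂ) * (x : ℂ) =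
        ((-(κ - l) * ((u : ZMod (c : ℕ)).val : ℚ) : ℚ) : ℂ) / (c : ℕ) := by
      rw [hx]; push_cast; ring
    rw [this]
    ring
  simp only [h2]
  rw [tsum_mul_left]
  ring

theorem norm_eFun_rat_div (x : ℚ) (c : ℕ) : ‖eFun ((x : ℂ) / c)‖ = 1 := by
  rw [show (x : ℂ) / c = (((x : ℝ) / c : ℝ) : ℂ) by push_cast; rfl, norm_eFun_ofReal]

/-- Summing over `u` recombines the Gauss sums into `H_c`. The sign of `r` changes because
`latticeSum` contains `+β(r', λ + r)` and `gaussSum` contains `-β(s, λ + r)`. -/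
theorem tsum_posTerm_index {k : ℤ} (hk : (n : ℚ) / 2 + 2 < k) (r : L.isotropic) (τ : ℍ)
    (z : Fin n → ℂ) (m : Fin n → ℤ) :
    ∑' i, L.posTerm k r τ z i m = L.thetaConst k *
      ((2 * Real.pi) ^ ((k : ℝ) - n / 2) / Real.Gamma ((k : ℝ) - n / 2) : ℝ) *
      ∑' l : ℤ, powExp ((k : ℝ) - n / 2) τ (l - (L.quad (L.dualVec m) : ℚ)) *
        L.gFun (L.dualVec m) τ z * L.latticeSeries k (-r) m l := by
  have hα := rank_div_two_add_two_lt hk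
  set α : ℝ := (k : ℝ) - n / 2 with hαd
  set κ : ℚ := L.quad (L.dualVec m) with hκ
  set K := L.thetaConst k * ((2 * Real.pi) ^ α / Real.Gamma α : ℝ) with hK
  obtain ⟨B, hB, hpow⟩ := exists_tsum_powExp_le (by linarith : 1 < α) τ
  obtain ⟨w, hw, hwb⟩ := L.exists_latticeSum_majorant hk
  have hs : Summable fun i => L.posTerm k r τ z i m := by
    have := (L.summable_norm_posTerm hk r τ z).of_norm.comp_injective
      (Prod.mk_left_injective (α := PosIndex) m)
    exact this
  rw [hs.tsum_sigma]
  have h1 : ∀ c : ℕ+, ∑' x : (ZMod (c : ℕ))ˣ × ℤ, L.posTerm k r τ z ⟨c, x⟩ m =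
      K * L.gFun (L.dualVec m) τ z * ∑' l : ℤ, powExp α τ (l - κ) *
        (((c : ℕ) : ℂ) ^ (-k) * L.latticeSum c (-r) (κ - l) (L.dualVec m)) := by
    intro c
    have hsc : Summable fun x : (ZMod (c : ℕ))ˣ × ℤ => L.posTerm k r τ z ⟨c, x⟩ m :=
      hs.comp_injective sigma_mk_injective
    rw [hsc.tsum_prod, tsum_fintype]
    simp only [L.tsum_posTerm_fiber hk, ← hαd, ← hκ, ← hK]
    rw [← Finset.mul_sum, ← Finset.mul_sum, ← Summable.tsum_finsetSum]
    · rw [← tsum_mul_left]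
      congr 1
      refine tsum_congr fun l => ?_
      rw [← Finset.mul_sum, latticeSum_eq]
      simp only [L.gaussSum_neg_neg c _ _ (L.dualVec_mem m) r.2]
      ring
    · intro u _
      refine Summable.of_norm ?_
      simp only [norm_mul, norm_eFun_rat_div, one_mul]
      exact (hpow κ).1.mul_right _
  simp only [h1]
  rw [tsum_mul_left]
  have hsw : Summable (Function.uncurry fun (l : ℤ) (c : ℕ+) => powExp α τ (l - κ) *
      (((c : ℕ) : ℂ) ^ (-k) * L.latticeSum c (-r) (κ - l) (L.dualVec m))) := by
    refine Summable.of_norm_bounded ((hpow κ).1.mul_of_nonneg hw (fun _ => norm_nonneg _)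
      (fun c => (norm_nonneg _).trans (hwb r r.2 0 _ (L.dualVec_mem m) c))) fun x => ?_
    rw [Function.uncurry, norm_mul]
    gcongr
    exact hwb _ (L.isotropic_neg r.2) _ _ (L.dualVec_mem m) _
  rw [Summable.tsum_comm hsw, mul_assoc]
  congr 1
  rw [← tsum_mul_left]
  refine tsum_congr fun l => ?_
  rw [tsum_mul_left, latticeSeries]
  ring

theorem norm_latticeSeries_le {k : ℤ} (hk : (n : ℚ) / 2 + 2 < k) :
    ∃ C, 0 ≤ C ∧ ∀ r ∈ L.isotropic, ∀ m l, ‖L.latticeSeries k r m l‖ ≤ C := by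
  obtain ⟨w, hw, hwb⟩ := L.exists_latticeSum_majorant hk
  refine ⟨|∑' c, w c|, abs_nonneg _, fun r hr m l => ?_⟩
  exact (tsum_of_norm_bounded hw.hasSum fun c => hwb r hr _ _ (L.dualVec_mem m) c).trans (le_abs_self _)

/-- The Fourier coefficients are bounded by `norm_latticeSeries_le`, so the exponential decay of the
remaining factors suffices. -/
theorem summable_posFourier {k : ℤ} (hk : (n : ℚ) / 2 + 2 < k) (r : L.isotropic) (τ : ℍ)
    (z : Fin n → ℂ) :
    Summable fun x : (Fin n → ℤ) × ℤ => powExp ((k : ℝ) - n / 2) τ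
      (x.2 - (L.quad (L.dualVec x.1) : ℚ)) * L.gFun (L.dualVec x.1) τ z *
        L.latticeSeries k r x.1 x.2 := by
  have hα := rank_div_two_add_two_lt hk
  obtain ⟨B, hB, hpow⟩ := exists_tsum_powExp_le (by linarith : 1 < (k : ℝ) - n / 2) τ
  obtain ⟨C, hC, hH⟩ := L.norm_latticeSeries_le hk
  refine Summable.of_norm_bounded (g := fun x : (Fin n → ℤ) × ℤ =>
    ‖powExp ((k : ℝ) - n / 2) τ (x.2 - (L.quad (L.dualVec x.1) : ℚ))‖ *
      ‖L.gFun (L.dualVec x.1) τ z‖ * C) ?_ fun x => ?_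
  · refine Summable.mul_right _ ?_
    rw [summable_prod_of_nonneg fun x => by positivity]
    refine ⟨fun m => (hpow ((L.quad (L.dualVec m) : ℚ) : ℝ)).1.mul_right
      ‖L.gFun (L.dualVec m) τ z‖, ?_⟩
    refine Summable.of_nonneg_of_le (fun m => tsum_nonneg fun l => by positivity) (fun m => ?_)
      ((L.summable_norm_gFun_dual τ z).mul_left B)
    change ∑' l : ℤ, ‖powExp ((k : ℝ) - n / 2) τ (l - (L.quad (L.dualVec m) : ℚ))‖ *
      ‖L.gFun (L.dualVec m) τ z‖ ≤ _
    rw [tsum_mul_right]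
    gcongr
    exact (hpow _).2
  · rw [norm_mul, norm_mul]
    gcongr
    exact hH r r.2 _ _

/-- The Fourier expansion of the sum over the cosets with `c > 0`. -/
theorem tsum_fiberSum_posSL {k : ℤ} (hk : (n : ℚ) / 2 + 2 < k) (r : L.isotropic) (τ : ℍ)
    (z : Fin n → ℂ) :
    ∑' i, L.fiberSum k r (SLCosets.mk (posSL i)) τ z = L.thetaConst k *
      ((2 * Real.pi) ^ ((k : ℝ) - n / 2) / Real.Gamma ((k : ℝ) - n / 2) : ℝ) *
      ∑' x : (Fin n → ℤ) × ℤ, powExp ((k : ℝ) - n / 2) τ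
        (x.2 - (L.quad (L.dualVec x.1) : ℚ)) * L.gFun (L.dualVec x.1) τ z *
          L.latticeSeries k (-r) x.1 x.2 := by
  simp only [L.fiberSum_posSL (weight_pos hk).le]
  have hs : Summable (Function.uncurry fun (m : Fin n → ℤ) (i : PosIndex) =>
      L.posTerm k r τ z i m) := by
    have := (Equiv.prodComm (Fin n → ℤ) PosIndex).summable_iff.mpr
      (L.summable_norm_posTerm hk r τ z).of_norm
    exact this
  rw [Summable.tsum_comm hs]
  simp only [L.tsum_posTerm_index hk]
  rw [tsum_mul_left]
  exact congrArg _ (L.summable_posFourier hk (L.isotropicNeg r) τ z).tsum_prod.symm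

/-! ### The Fourier expansion of the Eisenstein series -/

theorem summable_fiberSum {k : ℤ} (hk : (n : ℚ) / 2 + 2 < k) (r : L.isotropic) (τ : ℍ)
    (z : Fin n → ℂ) : Summable fun q => L.fiberSum k r q τ z := by
  obtain ⟨u, hu, hb⟩ := L.exists_fiberSum_bound hk r (isCompact_singleton (x := (τ, z)))
  exact Summable.of_norm_bounded hu fun q => hb q (τ, z) rfl

/-- The cosets are grouped into `± 1` and `± A` with `c > 0`; the matrix `-A` contributes the term of
`A` for `-r`, with the factor `(-1)^k`. -/
theorem two_mul_eisenstein_eq {k : ℤ} (hk : (n : ℚ) / 2 + 2 < k) (r : L.isotropic) (τ : ℍ)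
    (z : Fin n → ℂ) :
    2 * L.eisenstein k r τ z =
      (∑' l : Fin n → ℤ, L.gFun (r + intVec ℚ l) τ z +
        (-1) ^ k * ∑' l : Fin n → ℤ, L.gFun (-r + intVec ℚ l) τ z) +
      (∑' i, L.fiberSum k r (SLCosets.mk (posSL i)) τ z +
        (-1) ^ k * ∑' i, L.fiberSum k (L.isotropicNeg r) (SLCosets.mk (posSL i)) τ z) := by
  have hs := L.summable_fiberSum hk r τ z
  have hp : ∀ r : L.isotropic, Summable fun i => L.fiberSum k r (SLCosets.mk (posSL i)) τ z :=
    fun r => (L.summable_fiberSum hk r τ z).comp_injective posSL_coset_injective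
  have hsb : Summable fun x : (Unit ⊕ PosIndex) × Bool =>
      L.fiberSum k r (SLCosets.mk (signedSL x)) τ z := signedCosetEquiv.summable_iff.mpr hs
  have h0 : ∑' q : SLCosets, L.fiberSum k r q τ z =
      ∑' x : (Unit ⊕ PosIndex) × Bool, L.fiberSum k r (SLCosets.mk (signedSL x)) τ z :=
    (signedCosetEquiv.tsum_eq _).symm
  have h1 : ∀ x : Unit ⊕ PosIndex, ∑' b, L.fiberSum k r (SLCosets.mk (signedSL (x, b))) τ z =
      L.fiberSum k r (SLCosets.mk (baseSL x)) τ z +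
        (-1) ^ k * L.fiberSum k (L.isotropicNeg r) (SLCosets.mk (baseSL x)) τ z := by
    intro x
    rw [tsum_fintype, Fintype.sum_bool, add_comm]
    simp only [signedSL, if_true, Bool.false_eq_true, if_false]
    rw [fiberSum_neg]
  rw [two_mul_eisenstein, h0, hsb.tsum_prod]
  simp only [h1]
  rw [Summable.tsum_sum]
  · simp only [baseSL, Sum.elim_inl, Sum.elim_inr, fiberSum_one]
    rw [tsum_fintype, Fintype.sum_unique, (hp r).tsum_add ((hp _).mul_left _), tsum_mul_left]
    rfl
  · exact (hasSum_fintype _).summable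
  · exact (hp r).add ((hp _).mul_left _)

theorem delta_shift (r : Fin n → ℚ) (l : Fin n → ℤ) : delta r (r + intVec ℚ l) = 1 := by
  rw [delta, if_pos ⟨l, by abel⟩]

theorem hasSum_delta (r : L.isotropic) (τ : ℍ) (z : Fin n → ℂ) :
    HasSum (fun r' : L.isotropic => delta (r : Fin n → ℚ) (r' : Fin n → ℚ) * L.gFun r' τ z)
      (∑' l : Fin n → ℤ, L.gFun (r + intVec ℚ l) τ z) := by
  have hinj : Function.Injective
      (fun l : Fin n → ℤ => (⟨r + intVec ℚ l, L.isotropic_add r.2 l⟩ : L.isotropic)) := by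
    intro l l' h
    have := add_left_cancel (congrArg Subtype.val h)
    ext i
    have := congrFun this i
    simpa [intVec] using this
  refine (hinj.hasSum_iff ?_).mp ?_
  · intro r' hr'
    rw [delta, if_neg, zero_mul]
    rintro ⟨l, hl⟩
    exact hr' ⟨l, Subtype.ext (by simp only; rw [← hl]; abel)⟩
  · simp only [Function.comp_def, delta_shift, one_mul]
    exact (L.summable_norm_gFun_shift r.2.1 τ z).of_norm.hasSum

theorem hasSum_singularTerm (k : ℤ) (r : L.isotropic) (τ : ℍ) (z : Fin n → ℂ) :
    HasSum (L.singularTerm k r τ z) (∑' l : Fin n → ℤ, L.gFun (r + intVec ℚ l) τ z +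
        (-1) ^ k * ∑' l : Fin n → ℤ, L.gFun (-r + intVec ℚ l) τ z) := by
  refine ((L.hasSum_delta r τ z).add ((L.hasSum_delta (L.isotropicNeg r) τ z).mul_left
    ((-1) ^ k))).congr_fun fun r' => ?_
  rw [singularTerm, ← gFun, isotropicNeg]
  ring

/-- The pair `(m, l)` belonging to `(D', r')`: `r'` is the `m`-th dual vector and
`l = β(r') - D'`. -/
noncomputable def negSupportIndex (p : L.negSupport) : (Fin n → ℤ) × ℤ :=
  (L.dualEquiv.symm ⟨p.1.2, p.2.1⟩, -p.2.2.2.choose)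

theorem negSupportIndex_fst (p : L.negSupport) : L.dualVec (L.negSupportIndex p).1 = p.1.2 :=
  congrArg Subtype.val (L.dualEquiv.apply_symm_apply ⟨p.1.2, p.2.1⟩)

theorem negSupportIndex_snd (p : L.negSupport) :
    ((L.negSupportIndex p).2 : ℚ) = L.quad p.1.2 - p.1.1 := by
  have := p.2.2.2.choose_spec
  rw [negSupportIndex]; push_cast; linarith

theorem negSupportIndex_injective : Function.Injective L.negSupportIndex := by
  intro p q h
  have h1 : p.1.2 = q.1.2 := by rw [← negSupportIndex_fst, h, negSupportIndex_fst]
  have h2 := L.negSupportIndex_snd p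
  rw [h, negSupportIndex_snd, h1] at h2
  exact Subtype.ext (Prod.ext (by linarith) h1)

theorem mem_range_negSupportIndex {x : (Fin n → ℤ) × ℤ} (hx : L.quad (L.dualVec x.1) < x.2) :
    x ∈ Set.range L.negSupportIndex := by
  set p : L.negSupport := ⟨(L.quad (L.dualVec x.1) - x.2, L.dualVec x.1), L.dualVec_mem _,
    by simp only; linarith, -x.2, by push_cast; ring⟩ with hp
  refine ⟨p, Prod.ext ?_ ?_⟩
  · have h : (⟨L.dualVec x.1, L.dualVec_mem x.1⟩ : L.dual) = L.dualEquiv x.1 := Subtype.ext rfl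
    simp only [negSupportIndex, hp]
    rw [h, Equiv.symm_apply_apply]
  · have := L.negSupportIndex_snd p
    simp only [hp] at this
    have h2 : ((L.negSupportIndex p).2 : ℚ) = x.2 := by rw [this]; ring
    exact_mod_cast h2

theorem I_zpow_neg (k : ℤ) : Complex.I ^ (-k) = (-1) ^ k * Complex.I ^ k := by
  rw [_root_.zpow_neg, ← _root_.inv_zpow, Complex.inv_I, neg_eq_neg_one_mul, mul_zpow]

/-- Comparison of `G_r(D', r')` with the terms of `tsum_fiberSum_posSL` for `r` and for `-r`. Here
`i^{-k} (-1)^k = i^k`. -/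
theorem nonsingularTerm_eq {k : ℤ} (hk : (n : ℚ) / 2 + 2 < k) (r : L.isotropic) (τ : ℍ)
    (z : Fin n → ℂ) (p : L.negSupport) :
    L.nonsingularTerm k r τ z p = (1 / 2 * (L.thetaConst k *
      ((2 * Real.pi) ^ ((k : ℝ) - n / 2) / Real.Gamma ((k : ℝ) - n / 2) : ℝ))) *
      ((powExp ((k : ℝ) - n / 2) τ ((L.negSupportIndex p).2 -
        (L.quad (L.dualVec (L.negSupportIndex p).1) : ℚ)) *
        L.gFun (L.dualVec (L.negSupportIndex p).1) τ z *
        L.latticeSeries k (-r) (L.negSupportIndex p).1 (L.negSupportIndex p).2) +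
      (-1) ^ k * (powExp ((k : ℝ) - n / 2) τ ((L.negSupportIndex p).2 -
        (L.quad (L.dualVec (L.negSupportIndex p).1) : ℚ)) *
        L.gFun (L.dualVec (L.negSupportIndex p).1) τ z *
        L.latticeSeries k r (L.negSupportIndex p).1 (L.negSupportIndex p).2)) := by
  obtain ⟨w, hw, hwb⟩ := L.exists_latticeSum_majorant hk
  set α : ℝ := (k : ℝ) - n / 2 with hα
  have h1 := L.negSupportIndex_fst p
  have h2 := L.negSupportIndex_snd p
  have hpos : (0 : ℝ) < -(p.1.1 : ℝ) := by
    have := p.2.2.1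
    have h : ((p.1.1 : ℚ) : ℝ) < ((0 : ℚ) : ℝ) := by exact_mod_cast this
    push_cast at h
    linarith
  have hx : (((L.negSupportIndex p).2 : ℤ) : ℝ) - ((L.quad p.1.2 : ℚ) : ℝ) = -(p.1.1 : ℝ) := by
    have h : (((L.negSupportIndex p).2 : ℚ) : ℝ) = ((L.quad p.1.2 - p.1.1 : ℚ) : ℝ) := by rw [h2]
    push_cast at h
    linarith
  have hD : L.quad p.1.2 - (((L.negSupportIndex p).2 : ℤ) : ℚ) = p.1.1 := by rw [h2]; ring
  have hser : ∑' c : ℕ+, L.coeffTerm k r p.1.1 p.1.2 c =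
      L.latticeSeries k r (L.negSupportIndex p).1 (L.negSupportIndex p).2 +
      (-1) ^ k * L.latticeSeries k (-r) (L.negSupportIndex p).1 (L.negSupportIndex p).2 := by
    have s1 := Summable.of_norm_bounded hw fun c => hwb r r.2 p.1.1 _ p.2.1 c
    have s2 := Summable.of_norm_bounded hw fun c => hwb (-r) (L.isotropic_neg r.2) p.1.1 _ p.2.1 c
    rw [latticeSeries, latticeSeries, h1, hD, ← tsum_mul_left, ← s1.tsum_add (s2.mul_left _)]
    refine tsum_congr fun c => ?_
    rw [coeffTerm]; ring
  have hexp : eFun ((L.quad (ratVec p.1.2) - (p.1.1 : ℂ)) * τ + L.bil (ratVec p.1.2) z) =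
      eFun (((-(p.1.1 : ℝ) : ℝ) : ℂ) * τ) * L.gFun p.1.2 τ z := by
    rw [gFun, ← eFun_add]
    congr 1
    push_cast
    ring
  have hsign : ((-1 : ℂ) ^ k) * (-1) ^ k = 1 := by rw [← mul_zpow]; norm_num
  rw [nonsingularTerm, coeff, ← hα, hser, hexp, h1, hx, powExp, max_eq_left hpos.le, thetaConst,
    I_zpow_neg]
  set H := L.latticeSeries k r (L.negSupportIndex p).1 (L.negSupportIndex p).2
  set H' := L.latticeSeries k (-r) (L.negSupportIndex p).1 (L.negSupportIndex p).2
  set P := (((-(p.1.1 : ℝ)) ^ (α - 1) : ℝ) : ℂ)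
  set e := eFun (((-(p.1.1 : ℝ) : ℝ) : ℂ) * τ)
  have hsd : ((Real.sqrt L.det : ℝ) : ℂ) ≠ 0 := by
    have := Real.sqrt_pos.mpr L.det_pos; exact_mod_cast this.ne'
  push_cast
  linear_combination (-((((2 * Real.pi) ^ α : ℝ) : ℂ) * Complex.I ^ k /
    (2 * (((Real.sqrt L.det : ℝ) : ℂ) * (Real.Gamma α : ℂ))) * P * e * L.gFun p.1.2 τ z * H)) * hsign

theorem hasSum_nonsingularTerm {k : ℤ} (hk : (n : ℚ) / 2 + 2 < k) (r : L.isotropic) (τ : ℍ)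
    (z : Fin n → ℂ) :
    HasSum (L.nonsingularTerm k r τ z) (1 / 2 *
      (∑' i, L.fiberSum k r (SLCosets.mk (posSL i)) τ z +
        (-1) ^ k * ∑' i, L.fiberSum k (L.isotropicNeg r) (SLCosets.mk (posSL i)) τ z)) := by
  have hα := rank_div_two_add_two_lt hk
  have h1 := (L.summable_posFourier hk (L.isotropicNeg r) τ z).hasSum
  have h2 := (L.summable_posFourier hk r τ z).hasSum
  have h3 := (h1.add (h2.mul_left ((-1) ^ k))).mul_left (1 / 2 * (L.thetaConst k *
      ((2 * Real.pi) ^ ((k : ℝ) - n / 2) / Real.Gamma ((k : ℝ) - n / 2) : ℝ)))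
  rw [← L.negSupportIndex_injective.hasSum_iff] at h3
  · rw [L.tsum_fiberSum_posSL hk, L.tsum_fiberSum_posSL hk]
    have e : (-((L.isotropicNeg r : L.isotropic) : Fin n → ℚ)) = r := neg_neg _
    rw [e]
    convert! h3 using 1
    · funext p
      exact L.nonsingularTerm_eq hk r τ z p
    · simp only [isotropicNeg]
      ring
  · intro x hx
    have hle : ((x.2 : ℤ) : ℝ) - ((L.quad (L.dualVec x.1) : ℚ) : ℝ) ≤ 0 := by
      by_contra hcon
      push Not at hcon
      refine hx (L.mem_range_negSupportIndex ?_)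
      have : ((L.quad (L.dualVec x.1) : ℚ) : ℝ) < ((x.2 : ℚ) : ℝ) := by push_cast; linarith
      exact_mod_cast this
    rw [powExp_of_nonpos (by linarith) τ hle]
    simp

theorem eisenstein_fourier {k : ℤ} (hk : (n : ℚ) / 2 + 2 < k) (r : L.isotropic) (τ : ℍ)
    (z : Fin n → ℂ) :
    Summable (L.singularTerm k r τ z) ∧ Summable (L.nonsingularTerm k r τ z) ∧
      L.eisenstein k r τ z =
        1 / 2 * ∑' r' : L.isotropic, L.singularTerm k r τ z r' +
          ∑' p : L.negSupport, L.nonsingularTerm k r τ z p := by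
  have h1 := L.hasSum_singularTerm k r τ z
  have h2 := L.hasSum_nonsingularTerm hk r τ z
  refine ⟨h1.summable, h2.summable, ?_⟩
  rw [h1.tsum_eq, h2.tsum_eq]
  linear_combination (1 / 2 : ℂ) * L.two_mul_eisenstein_eq hk r τ z

end EvenLattice

/-! ### Holomorphy in several variables -/

/-- Cauchy's estimate for the derivative, applied on complex lines. -/
theorem norm_fderiv_le_of_norm_le {E : Type*} [NormedAddCommGroup E] [NormedSpace ℂ E] {f : E → ℂ}
    {x : E} {R C : ℝ} (hR : 0 < R) (hd : DifferentiableOn ℂ f (Metric.ball x (2 * R)))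
    (hC : ∀ y ∈ Metric.ball x (2 * R), ‖f y‖ ≤ C) {y : E} (hy : y ∈ Metric.ball x R) :
    ‖fderiv ℂ f y‖ ≤ C / (R / 2) := by
  have hyx : dist y x < R := hy
  have hC0 : 0 ≤ C := (norm_nonneg _).trans (hC x (Metric.mem_ball_self (by linarith)))
  have hy2 : y ∈ Metric.ball x (2 * R) := by rw [Metric.mem_ball]; linarith
  refine ContinuousLinearMap.opNorm_le_of_unit_norm (by positivity) fun v hv => ?_
  have hmaps : ∀ t : ℂ, ‖t‖ ≤ R / 2 → y + t • v ∈ Metric.ball x (2 * R) := by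
    intro t ht
    rw [Metric.mem_ball]
    calc dist (y + t • v) x ≤ dist (y + t • v) y + dist y x := dist_triangle _ _ _
      _ < 2 * R := by
        rw [dist_eq_norm, add_sub_cancel_left, norm_smul, hv, mul_one]; linarith
  have hline : Differentiable ℂ fun t : ℂ => y + t • v := by fun_prop
  have hdo : DifferentiableOn ℂ (fun t : ℂ => f (y + t • v)) (Metric.closedBall 0 (R / 2)) :=
    hd.comp hline.differentiableOn fun t ht => hmaps t (by simpa using ht)
  have h1 : HasDerivAt (fun t : ℂ => f (y + t • v)) (fderiv ℂ f y v) 0 := by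
    have hf : HasFDerivAt f (fderiv ℂ f y) (y + (0 : ℂ) • v) := by
      rw [zero_smul, add_zero]
      exact (hd.differentiableAt (Metric.isOpen_ball.mem_nhds hy2)).hasFDerivAt
    have hl : HasDerivAt (fun t : ℂ => y + t • v) v 0 := by
      simpa using ((hasDerivAt_id (0 : ℂ)).smul_const v).const_add y
    exact hf.comp_hasDerivAt _ hl
  rw [← h1.deriv]
  refine Complex.norm_deriv_le_of_forall_mem_sphere_norm_le (by positivity) ?_ fun t ht => ?_
  · refine DifferentiableOn.diffContOnCl ?_
    rwa [closure_ball _ (by positivity)]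
  · exact hC _ (hmaps t (by rw [mem_sphere_zero_iff_norm.mp ht]))

/-- Weierstrass' theorem for series of holomorphic functions in several variables. -/
theorem differentiableOn_tsum_of_locally_bounded {E ι : Type*} [NormedAddCommGroup E]
    [NormedSpace ℂ E] {f : ι → E → ℂ} {U : Set E} (hU : IsOpen U)
    (hd : ∀ i, DifferentiableOn ℂ (f i) U)
    (hb : ∀ x ∈ U, ∃ V ∈ nhds x, ∃ u : ι → ℝ, Summable u ∧ ∀ i, ∀ y ∈ V, ‖f i y‖ ≤ u i) :
    DifferentiableOn ℂ (fun x => ∑' i, f i x) U := by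
  intro x hx
  obtain ⟨V, hV, u, hu, hb⟩ := hb x hx
  obtain ⟨ε, hε, hball⟩ := Metric.mem_nhds_iff.mp (Filter.inter_mem hV (hU.mem_nhds hx))
  have hε2 : 2 * (ε / 2) = ε := by ring
  have hxb : x ∈ Metric.ball x (ε / 2) := Metric.mem_ball_self (by positivity)
  have hdb : ∀ i, DifferentiableOn ℂ (f i) (Metric.ball x (2 * (ε / 2))) := fun i =>
    (hd i).mono (by rw [hε2]; exact hball.trans Set.inter_subset_right)
  have key := hasFDerivAt_tsum_of_isPreconnected (𝕜 := ℂ) (f := f) (f' := fun i => fderiv ℂ (f i))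
    (u := fun i => u i / (ε / 2 / 2)) (x₀ := x) (x := x) (s := Metric.ball x (ε / 2)) (hu.div_const _)
    Metric.isOpen_ball (convex_ball x _).isPreconnected
    (fun i y hy => ((hdb i).differentiableAt (Metric.isOpen_ball.mem_nhds
      (Metric.ball_subset_ball (by linarith) hy))).hasFDerivAt)
    (fun i y hy => norm_fderiv_le_of_norm_le (by positivity) (hdb i)
      (fun w hw => hb i w (hball (by rwa [hε2] at hw)).1) hy)
    hxb (Summable.of_norm_bounded hu fun i => hb i x (mem_of_mem_nhds hV)) hxb
  exact key.differentiableAt.differentiableWithinAt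

theorem isOpen_im_pos (n : ℕ) : IsOpen {w : ℂ × (Fin n → ℂ) | 0 < w.1.im} :=
  isOpen_lt continuous_const (Complex.continuous_im.comp continuous_fst)

theorem differentiableOn_tsum_of_bound {n : ℕ} {ι : Type*} {f : ι → ℍ → (Fin n → ℂ) → ℂ}
    (hd : ∀ i, DifferentiableOn ℂ (fun w : ℂ × (Fin n → ℂ) => f i (ofComplex w.1) w.2)
      {w | 0 < w.1.im})
    (h : ∀ K : Set (ℍ × (Fin n → ℂ)), IsCompact K →
      ∃ u : ι → ℝ, Summable u ∧ ∀ i, ∀ w ∈ K, ‖f i w.1 w.2‖ ≤ u i) :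
    DifferentiableOn ℂ (fun w : ℂ × (Fin n → ℂ) => ∑' i, f i (ofComplex w.1) w.2)
      {w | 0 < w.1.im} := by
  refine differentiableOn_tsum_of_locally_bounded (isOpen_im_pos n) hd fun x hx => ?_
  obtain ⟨V, hV, hVs, hVc⟩ := local_compact_nhds ((isOpen_im_pos n).mem_nhds hx)
  have hcont : ContinuousOn (fun w : ℂ × (Fin n → ℂ) => ((ofComplex w.1 : ℍ), w.2)) V := by
    intro w hw
    have h1 : ContinuousAt (fun z : ℂ => (ofComplex z : ℍ)) w.1 :=
      (UpperHalfPlane.contMDiffAt_ofComplex (n := 0) (hVs hw)).continuousAt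
    exact ((h1.comp continuous_fst.continuousAt).prodMk
      continuous_snd.continuousAt).continuousWithinAt
  obtain ⟨u, hu, hb⟩ := h _ (hVc.image_of_continuousOn hcont)
  exact ⟨V, hV, u, hu, fun i y hy => hb i _ ⟨y, hy, rfl⟩⟩

namespace EvenLattice

variable {n : ℕ} (L : EvenLattice n)

theorem differentiable_bil {E : Type*} [NormedAddCommGroup E] [NormedSpace ℂ E]
    {f g : E → Fin n → ℂ} {S : Set E} (hf : DifferentiableOn ℂ f S) (hg : DifferentiableOn ℂ g S) :
    DifferentiableOn ℂ (fun x => L.bil (f x) (g x)) S := by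
  have hf' := differentiableOn_pi.mp hf
  have hg' := differentiableOn_pi.mp hg
  unfold bil dotProduct mulVec dotProduct
  refine DifferentiableOn.fun_sum fun i _ => (hf' i).mul (DifferentiableOn.fun_sum fun j _ => ?_)
  exact (hg' j).const_mul _

theorem differentiable_slashSL_gFun (k : ℤ) (s : Fin n → ℚ) (A : SL(2, ℤ)) :
    DifferentiableOn ℂ (fun w : ℂ × (Fin n → ℂ) => L.slashSL k (L.gFun s) A (ofComplex w.1) w.2)
      {w | 0 < w.1.im} := by
  set j : ℂ × (Fin n → ℂ) → ℂ := fun w => (A 1 0 : ℂ) * w.1 + (A 1 1 : ℂ) with hj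
  have hj0 : ∀ w ∈ {w : ℂ × (Fin n → ℂ) | 0 < w.1.im}, j w ≠ 0 := by
    intro w hw
    have := jfac_ne_zero A ⟨w.1, hw⟩
    exact this
  have hjd : DifferentiableOn ℂ j {w | 0 < w.1.im} := by
    refine Differentiable.differentiableOn ?_
    simp only [hj]
    fun_prop
  have hinv : DifferentiableOn ℂ (fun w => (j w)⁻¹) {w | 0 < w.1.im} := hjd.inv hj0
  have hsnd : DifferentiableOn ℂ (fun w : ℂ × (Fin n → ℂ) => w.2) {w | 0 < w.1.im} :=
    differentiable_snd.differentiableOn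
  have hexpl : DifferentiableOn ℂ (fun w : ℂ × (Fin n → ℂ) =>
      eFun (((A 0 0 : ℂ) * w.1 + (A 0 1 : ℂ)) * (j w)⁻¹ * L.quad (ratVec s) +
        L.bil (ratVec s) ((j w)⁻¹ • w.2)) * j w ^ (-k) *
        eFun (-(A 1 0 : ℂ) * L.quad w.2 * (j w)⁻¹)) {w | 0 < w.1.im} := by
    refine ((differentiable_eFun.comp_differentiableOn ?_).mul ?_).mul
      (differentiable_eFun.comp_differentiableOn ?_)
    · refine DifferentiableOn.add ((DifferentiableOn.mul ?_ hinv).mul_const _)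
        (L.differentiable_bil (differentiableOn_const _) (hinv.smul hsnd))
      refine Differentiable.differentiableOn ?_
      fun_prop
    · intro w hw
      exact (hjd w hw).zpow (Or.inl (hj0 w hw))
    · have hq : DifferentiableOn ℂ (fun w : ℂ × (Fin n → ℂ) => L.quad w.2) {w | 0 < w.1.im} := by
        simp only [quad, div_eq_mul_inv]
        exact (L.differentiable_bil hsnd hsnd).mul_const (2 : ℂ)⁻¹
      exact (hq.const_mul _).mul hinv
  refine hexpl.congr fun w hw => ?_
  have hc : ((ofComplex w.1 : ℍ) : ℂ) = w.1 := ofComplex_apply_of_im_pos hw ▸ rfl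
  have hjj : jfac A (ofComplex w.1) = j w := by rw [jfac, hc]
  rw [slashSL_eq, gFun, hjj, coe_smul_eq, hjj, hc]
  rfl

theorem differentiable_fiberSum {k : ℤ} (hk : (n : ℚ) / 2 + 2 < k) (r : L.isotropic)
    (q : SLCosets) :
    DifferentiableOn ℂ (fun w : ℂ × (Fin n → ℂ) => L.fiberSum k r q (ofComplex w.1) w.2)
      {w | 0 < w.1.im} := by
  obtain ⟨A, rfl⟩ : ∃ A, SLCosets.mk A = q := ⟨_, q.mk_out⟩
  simp only [fiberSum_mk]
  refine differentiableOn_tsum_of_bound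
    (f := fun (l : Fin n → ℤ) => L.slashSL k (L.gFun (r + intVec ℚ l)) A)
    (fun l => L.differentiable_slashSL_gFun k _ A) fun K hK => ?_
  obtain ⟨C, hC, a, ha, h⟩ := L.exists_term_bound k (weight_pos hk).le r hK
  have hN : 0 < ‖A 1‖ := norm_pos_iff.mpr (SL_bottom_row_ne_zero A)
  refine ⟨_, ?_, fun l => h A l⟩
  refine ((summable_exp_neg_norm_sq (n := n) (a := a / ‖A 1‖ ^ 2)
    (by positivity)).mul_left (C * ‖A 1‖ ^ (-k))).congr fun l => ?_
  congr 2
  field_simp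

theorem differentiable_eisenstein {k : ℤ} (hk : (n : ℚ) / 2 + 2 < k) (r : L.isotropic) :
    DifferentiableOn ℂ (fun w : ℂ × (Fin n → ℂ) => L.eisenstein k r (ofComplex w.1) w.2)
      {w | 0 < w.1.im} :=
  (differentiableOn_tsum_of_bound (f := L.fiberSum k r) (L.differentiable_fiberSum hk r)
    fun _ hK => L.exists_fiberSum_bound hk r hK).const_mul _

/-! ### Invariance under the Jacobi group -/

/-- The theta series `∑ e(τ β(r + λ) + β(r + λ, z))`. -/
noncomputable def theta (r : Fin n → ℚ) (τ : ℍ) (z : Fin n → ℂ) : ℂ :=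
  ∑' l : Fin n → ℤ, L.gFun (r + intVec ℚ l) τ z

/-- The partial sum over a coset is the transform of a theta series. -/
theorem fiberSum_eq_slashSL (k : ℤ) (r : L.isotropic) (A : SL(2, ℤ)) :
    L.fiberSum k r (SLCosets.mk A) = L.slashSL k (L.theta r) A := by
  funext τ z
  simp only [fiberSum_mk, slashSL_eq, theta]
  rw [tsum_mul_right, tsum_mul_right]

/-- Since `x ∈ L` shifts the index `r + λ`, and `y ∈ L` changes nothing because `r + λ ∈ L^#`, the theta
series is invariant under the Heisenberg group. -/
theorem slashH_theta (r : L.isotropic) (x y : Fin n → ℤ) :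
    L.slashH (L.theta r) x y = L.theta r := by
  funext τ z
  have h1 : L.slashH (L.theta r) x y τ z =
      ∑' l : Fin n → ℤ, L.slashH (L.gFun (r + intVec ℚ l)) x y τ z := by
    simp only [slashH, theta]
    rw [tsum_mul_right]
  have h2 : ∀ l : Fin n → ℤ, L.slashH (L.gFun (r + intVec ℚ l)) x y =
      L.gFun (r + intVec ℚ (l + x)) := by
    intro l
    have e1 : L.slashH (L.gFun (r + intVec ℚ l)) 0 y = L.gFun (r + intVec ℚ l) := by
      funext τ z
      have := L.gFun_add_int (L.isotropic_add r.2 l) 0 y τ τ (by simp) z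
      simp only [slashH, intVec_zero, smul_zero, add_zero]
      rw [this]
      simp [quad, bil]
    have e2 := L.slashH_slashH (L.gFun (r + intVec ℚ l)) 0 y x 0
    rw [e1, zero_add, add_zero, slashH_gFun] at e2
    rw [← e2, intVec_add, add_assoc]
  rw [h1]
  simp only [h2]
  exact (Equiv.addRight x).tsum_eq fun l => L.gFun (r + intVec ℚ l) τ z

theorem slashH_fiberSum (k : ℤ) (r : L.isotropic) (q : SLCosets) (x y : Fin n → ℤ) :
    L.slashH (L.fiberSum k r q) x y = L.fiberSum k r q := by
  obtain ⟨A, rfl⟩ : ∃ A, SLCosets.mk A = q := ⟨_, q.mk_out⟩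
  have h := L.slashH_slashSL k (L.theta r) A (A 1 1 • x - A 1 0 • y) (-A 0 1 • x + A 0 0 • y)
  have hd := SL_det A
  have e1 : A 0 0 • (A 1 1 • x - A 1 0 • y) + A 1 0 • (-A 0 1 • x + A 0 0 • y) = x := by
    ext i
    simp only [Pi.add_apply, Pi.sub_apply, Pi.smul_apply, smul_eq_mul]
    linear_combination x i * hd
  have e2 : A 0 1 • (A 1 1 • x - A 1 0 • y) + A 1 1 • (-A 0 1 • x + A 0 0 • y) = y := by
    ext i
    simp only [Pi.add_apply, Pi.sub_apply, Pi.smul_apply, smul_eq_mul]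
    linear_combination y i * hd
  rw [e1, e2, slashH_theta] at h
  rw [fiberSum_eq_slashSL, h]

end EvenLattice

/-- Right translation on the cosets of `SL₂(ℤ)_∞`. -/
noncomputable def SLCosets.mulRight (B : SL(2, ℤ)) (q : SLCosets) : SLCosets :=
  SLCosets.mk (q.out * B)

theorem SLCosets.mulRight_mk (A B : SL(2, ℤ)) :
    (SLCosets.mk A).mulRight B = SLCosets.mk (A * B) := by
  have h := SLCosets.mk_eq_iff.mp (SLCosets.mk A).mk_out
  refine SLCosets.mk_eq_iff.mpr ⟨?_, ?_⟩ <;> rw [SL_mul_apply, SL_mul_apply, h.1, h.2]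

/-- Right translation as a permutation of the cosets. -/
noncomputable def SLCosets.mulRightEquiv (B : SL(2, ℤ)) : SLCosets ≃ SLCosets where
  toFun := SLCosets.mulRight B
  invFun := SLCosets.mulRight B⁻¹
  left_inv q := by
    obtain ⟨A, rfl⟩ : ∃ A, SLCosets.mk A = q := ⟨_, q.mk_out⟩
    rw [mulRight_mk, mulRight_mk, mul_inv_cancel_right]
  right_inv q := by
    obtain ⟨A, rfl⟩ : ∃ A, SLCosets.mk A = q := ⟨_, q.mk_out⟩
    rw [mulRight_mk, mulRight_mk, inv_mul_cancel_right]

namespace EvenLattice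

variable {n : ℕ} (L : EvenLattice n)

/-- The right action of `B` permutes the cosets of `SL₂(ℤ)_∞`. -/
theorem slashSL_eisenstein (k : ℤ) (r : L.isotropic) (B : SL(2, ℤ)) :
    L.slashSL k (L.eisenstein k r) B = L.eisenstein k r := by
  funext τ z
  have h : ∀ q, L.fiberSum k r (SLCosets.mulRightEquiv B q) τ z =
      L.slashSL k (L.fiberSum k r q) B τ z := by
    intro q
    obtain ⟨A, rfl⟩ : ∃ A, SLCosets.mk A = q := ⟨_, q.mk_out⟩
    change L.fiberSum k r ((SLCosets.mk A).mulRight B) τ z = _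
    rw [SLCosets.mulRight_mk, fiberSum_eq_slashSL, fiberSum_eq_slashSL, slashSL_mul]
  rw [eisenstein, ← (SLCosets.mulRightEquiv B).tsum_eq]
  simp only [h, slashSL_eq, eisenstein]
  rw [tsum_mul_right, tsum_mul_right]
  ring

theorem slashH_eisenstein (k : ℤ) (r : L.isotropic) (x y : Fin n → ℤ) :
    L.slashH (L.eisenstein k r) x y = L.eisenstein k r := by
  funext τ z
  have h : ∀ q, L.fiberSum k r q τ z = L.slashH (L.fiberSum k r q) x y τ z := fun q => by
    rw [slashH_fiberSum]
  conv_rhs => rw [eisenstein]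
  simp only [h]
  simp only [slashH, eisenstein]
  rw [tsum_mul_right]
  ring

theorem slash_eisenstein (k : ℤ) (r : L.isotropic) (g : JacobiGroup n) :
    L.slash k (L.eisenstein k r) g = L.eisenstein k r := by
  rw [slash, slashSL_eisenstein, slashH_eisenstein]

/-! ### The Fourier expansion required of a Jacobi form -/

open Classical in
/-- The Fourier coefficients of the Eisenstein series. -/
noncomputable def eisensteinCoeff (k : ℤ) (r : Fin n → ℚ) (m : ℤ) (s : Fin n → ℚ) : ℂ :=
  if L.quad s = m then 1 / 2 * (delta r s + (-1) ^ k * delta (-r) s) else L.coeff k r (L.quad s - m) s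

/-- The exponents `(m, s)` with `m ≥ β(s)`, sorted by whether equality holds. -/
noncomputable def exponentEquiv : L.isotropic ⊕ L.negSupport ≃
    {p : ℤ × (Fin n → ℚ) // p.2 ∈ L.dual ∧ L.quad p.2 ≤ p.1} :=
  Equiv.ofBijective (Sum.elim
    (fun s => ⟨(s.2.2.choose, s), s.2.1, s.2.2.choose_spec.le⟩)
    (fun p => ⟨(-p.2.2.2.choose, p.1.2), p.2.1, by
      have h1 := p.2.2.2.choose_spec
      have h2 := p.2.2.1
      push_cast
      linarith⟩)) (by
    have hs : ∀ s : L.isotropic, L.quad (s : Fin n → ℚ) = (s.2.2.choose : ℚ) :=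
      fun s => s.2.2.choose_spec
    have hp : ∀ p : L.negSupport, p.1.1 - L.quad p.1.2 = (p.2.2.2.choose : ℚ) :=
      fun p => p.2.2.2.choose_spec
    constructor
    · rintro (s | p) (s' | p') h <;>
        simp only [Sum.elim_inl, Sum.elim_inr, Subtype.mk.injEq, Prod.mk.injEq] at h
      · rw [Subtype.ext h.2]
      · have h1 := hs s
        rw [h.1, h.2] at h1
        have h2 := hp p'
        have h3 := p'.2.2.1
        push_cast at h1
        linarith
      · have h1 := hs s'
        rw [← h.1, ← h.2] at h1
        have h2 := hp p
        have h3 := p.2.2.1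
        push_cast at h1
        linarith
      · have h1 := hp p
        have h2 := hp p'
        have h3 := congrArg (Int.cast : ℤ → ℚ) (neg_inj.mp h.1)
        have h4 : L.quad p.1.2 = L.quad p'.1.2 := congrArg _ h.2
        rw [Subtype.ext (Prod.ext (by linarith : p.1.1 = p'.1.1) h.2)]
    · rintro ⟨⟨m, s⟩, hd, hle⟩
      rcases hle.eq_or_lt with h | h
      · refine ⟨Sum.inl ⟨s, hd, m, h⟩, Subtype.ext (Prod.ext ?_ rfl)⟩
        have h1 := hs ⟨s, hd, m, h⟩
        simp only [Sum.elim_inl] at h1 ⊢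
        rw [h1] at h
        exact_mod_cast h
      · set p : L.negSupport := ⟨(L.quad s - m, s), hd, by simp only at h ⊢; linarith, -m,
          by push_cast; ring⟩ with hpd
        refine ⟨Sum.inr p, Subtype.ext (Prod.ext ?_ rfl)⟩
        have h1 := hp p
        simp only [Sum.elim_inr]
        have h2 : (-(p.2.2.2.choose : ℚ)) = m := by rw [← h1, hpd]; ring
        exact_mod_cast h2)

theorem exponentEquiv_inl (s : L.isotropic) : ((L.exponentEquiv (Sum.inl s)).1.1 : ℚ) = L.quad s.1 ∧
    (L.exponentEquiv (Sum.inl s)).1.2 = s :=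
  ⟨s.2.2.choose_spec.symm, rfl⟩

theorem exponentEquiv_inr (p : L.negSupport) :
    ((L.exponentEquiv (Sum.inr p)).1.1 : ℚ) = L.quad p.1.2 - p.1.1 ∧
    (L.exponentEquiv (Sum.inr p)).1.2 = p.1.2 := by
  refine ⟨?_, rfl⟩
  have h1 := p.2.2.2.choose_spec
  change ((-p.2.2.2.choose : ℤ) : ℚ) = _
  push_cast
  linarith

theorem hasFourierExpansion_eisenstein {k : ℤ} (hk : (n : ℚ) / 2 + 2 < k) (r : L.isotropic) :
    L.HasFourierExpansion (L.eisenstein k r) (L.eisensteinCoeff k r) := by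
  intro τ z
  obtain ⟨h1, h2, h3⟩ := L.eisenstein_fourier hk r τ z
  rw [← L.exponentEquiv.hasSum_iff, h3]
  refine HasSum.sum ?_ ?_
  · refine (h1.hasSum.mul_left (1 / 2 : ℂ)).congr_fun fun s => ?_
    obtain ⟨e1, e2⟩ := L.exponentEquiv_inl s
    simp only [Function.comp_apply, eisensteinCoeff, e2]
    rw [if_pos e1.symm, singularTerm, quad_ratVec, ← e1]
    push_cast
    ring_nf
  · refine h2.hasSum.congr_fun fun p => ?_
    obtain ⟨e1, e2⟩ := L.exponentEquiv_inr p
    have h4 := p.2.2.1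
    simp only [Function.comp_apply, eisensteinCoeff, e2]
    rw [if_neg (by rw [e1]; intro h; linarith), nonsingularTerm, e1, quad_ratVec]
    congr 2
    · ring
    · have : (((L.exponentEquiv (Sum.inr p)).1.1 : ℤ) : ℂ) = ((L.quad p.1.2 - p.1.1 : ℚ) : ℂ) := by
        rw [← e1]; push_cast; rfl
      rw [this]; push_cast; ring

theorem isJacobiForm_eisenstein {k : ℤ} (hk : (n : ℚ) / 2 + 2 < k) (r : L.isotropic) :
    L.IsJacobiForm k (L.eisenstein k r) :=
  ⟨L.differentiable_eisenstein hk r, L.slash_eisenstein k r,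
    _, L.hasFourierExpansion_eisenstein hk r⟩

end EvenLattice

/-! ### Integration over the real torus -/

/-- The unit box `[0, 1)ⁿ × [0, 1)ⁿ`. -/
def unitBox (n : ℕ) : Set ((Fin n → ℝ) × (Fin n → ℝ)) :=
  {x | ∀ i, x.1 i ∈ Set.Ico (0 : ℝ) 1 ∧ x.2 i ∈ Set.Ico (0 : ℝ) 1}

/-- The standard basis of `ℝⁿ × ℝⁿ`. -/
noncomputable def boxBasis (n : ℕ) :
    Module.Basis (Fin n ⊕ Fin n) ℝ ((Fin n → ℝ) × (Fin n → ℝ)) :=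
  (Pi.basisFun ℝ (Fin n)).prod (Pi.basisFun ℝ (Fin n))

theorem fundamentalDomain_boxBasis (n : ℕ) :
    ZSpan.fundamentalDomain (boxBasis n) = unitBox n := by
  ext x
  simp only [ZSpan.mem_fundamentalDomain, boxBasis, unitBox, Set.mem_ofPred_eq]
  constructor
  · intro h i
    exact ⟨by simpa using h (Sum.inl i), by simpa using h (Sum.inr i)⟩
  · rintro h (i | i)
    · simpa using (h i).1
    · simpa using (h i).2

theorem mem_span_boxBasis {n : ℕ} {x : (Fin n → ℝ) × (Fin n → ℝ)} :
    x ∈ Submodule.span ℤ (Set.range (boxBasis n)) ↔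
      ∃ a b : Fin n → ℤ, x = (intVec ℝ a, intVec ℝ b) := by
  rw [Module.Basis.mem_span_iff_repr_mem]
  constructor
  · intro h
    choose c hc using h
    refine ⟨fun i => c (Sum.inl i), fun i => c (Sum.inr i), Prod.ext ?_ ?_⟩
    · ext i; simpa [boxBasis, intVec] using (hc (Sum.inl i)).symm
    · ext i; simpa [boxBasis, intVec] using (hc (Sum.inr i)).symm
  · rintro ⟨a, b, rfl⟩ (i | i)
    · exact ⟨a i, by simp [boxBasis, intVec]⟩
    · exact ⟨b i, by simp [boxBasis, intVec]⟩

theorem measurableSet_unitBox (n : ℕ) : MeasurableSet (unitBox n) := by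
  rw [← fundamentalDomain_boxBasis]
  exact ZSpan.fundamentalDomain_measurableSet _

/-- The unit cube `[0, 1)ⁿ`. -/
def unitCube (n : ℕ) : Set (Fin n → ℝ) := Set.univ.pi fun _ => Set.Ico (0 : ℝ) 1

theorem unitBox_eq_prod (n : ℕ) : unitBox n = unitCube n ×ˢ unitCube n := by
  ext x; simp [unitBox, unitCube, Set.mem_pi, forall_and]

theorem volume_unitCube (n : ℕ) : volume (unitCube n) = 1 := by
  rw [unitCube, Real.volume_pi_Ico]; simp

theorem volume_unitBox (n : ℕ) : volume (unitBox n) = 1 := by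
  rw [unitBox_eq_prod, Measure.volume_eq_prod, Measure.prod_prod, volume_unitCube, one_mul]

instance isAddHaarMeasure_volume_prod (n : ℕ) :
    (volume : Measure ((Fin n → ℝ) × (Fin n → ℝ))).IsAddHaarMeasure := by
  rw [Measure.volume_eq_prod]
  exact Measure.prod.instIsAddHaarMeasure _ _

instance vaddInvariantMeasure_span_boxBasis (n : ℕ) :
    VAddInvariantMeasure (Submodule.span ℤ (Set.range (boxBasis n)))
      ((Fin n → ℝ) × (Fin n → ℝ)) volume :=
  inferInstanceAs (VAddInvariantMeasure (Submodule.span ℤ (Set.range (boxBasis n))).toAddSubgroup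
    ((Fin n → ℝ) × (Fin n → ℝ)) volume)

/-- The action `(p, q) ↦ (d p - c q, a q - b p)` of `SL₂(ℤ)` on the real coordinates. -/
noncomputable def coordAct {n : ℕ} (A : SL(2, ℤ)) :
    ((Fin n → ℝ) × (Fin n → ℝ)) ≃ₗ[ℝ] ((Fin n → ℝ) × (Fin n → ℝ)) where
  toFun x := ((A 1 1 : ℝ) • x.1 - (A 1 0 : ℝ) • x.2, (A 0 0 : ℝ) • x.2 - (A 0 1 : ℝ) • x.1)
  invFun x := ((A 0 0 : ℝ) • x.1 + (A 1 0 : ℝ) • x.2, (A 0 1 : ℝ) • x.1 + (A 1 1 : ℝ) • x.2)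
  map_add' x y := by ext i <;> simp <;> ring
  map_smul' t x := by ext i <;> simp <;> ring
  left_inv x := by
    have hd : (A 0 0 : ℝ) * A 1 1 - A 0 1 * A 1 0 = 1 := by exact_mod_cast SL_det A
    ext i
    · simp; linear_combination x.1 i * hd
    · simp; linear_combination x.2 i * hd
  right_inv x := by
    have hd : (A 0 0 : ℝ) * A 1 1 - A 0 1 * A 1 0 = 1 := by exact_mod_cast SL_det A
    ext i
    · simp; linear_combination x.1 i * hd
    · simp; linear_combination x.2 i * hd

theorem coordAct_apply {n : ℕ} (A : SL(2, ℤ)) (x : (Fin n → ℝ) × (Fin n → ℝ)) :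
    coordAct A x = ((A 1 1 : ℝ) • x.1 - (A 1 0 : ℝ) • x.2,
      (A 0 0 : ℝ) • x.2 - (A 0 1 : ℝ) • x.1) := rfl

theorem span_map_coordAct {n : ℕ} (A : SL(2, ℤ)) :
    Submodule.span ℤ (Set.range ((boxBasis n).map (coordAct A))) =
      Submodule.span ℤ (Set.range (boxBasis n)) := by
  rw [← ZSpan.map]
  apply le_antisymm
  · rintro _ ⟨x, hx, rfl⟩
    obtain ⟨a, b, rfl⟩ := mem_span_boxBasis.mp hx
    refine mem_span_boxBasis.mpr ⟨A 1 1 • a - A 1 0 • b, A 0 0 • b - A 0 1 • a, ?_⟩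
    change coordAct A _ = _
    rw [coordAct_apply]
    refine Prod.ext ?_ ?_ <;> ext i <;> simp [intVec]
  · intro x hx
    obtain ⟨a, b, rfl⟩ := mem_span_boxBasis.mp hx
    refine ⟨(coordAct A).symm (intVec ℝ a, intVec ℝ b), ?_, (coordAct A).apply_symm_apply _⟩
    refine mem_span_boxBasis.mpr ⟨A 0 0 • a + A 1 0 • b, A 0 1 • a + A 1 1 • b, ?_⟩
    change ((A 0 0 : ℝ) • intVec ℝ a + (A 1 0 : ℝ) • intVec ℝ b,
      (A 0 1 : ℝ) • intVec ℝ a + (A 1 1 : ℝ) • intVec ℝ b) = _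
    refine Prod.ext ?_ ?_ <;> ext i <;> simp [intVec]

theorem isAddFundamentalDomain_unitBox (n : ℕ) :
    IsAddFundamentalDomain (Submodule.span ℤ (Set.range (boxBasis n))) (unitBox n) volume := by
  rw [← fundamentalDomain_boxBasis]
  exact ZSpan.isAddFundamentalDomain _ _

theorem isAddFundamentalDomain_coordAct {n : ℕ} (A : SL(2, ℤ)) :
    IsAddFundamentalDomain (Submodule.span ℤ (Set.range (boxBasis n)))
      (coordAct A '' unitBox n) volume := by
  rw [← fundamentalDomain_boxBasis, ZSpan.map_fundamentalDomain]
  have := ZSpan.isAddFundamentalDomain ((boxBasis n).map (coordAct A)) volume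
  rwa [span_map_coordAct] at this

/-- The unit box and its image are fundamental domains of the same lattice, hence have the same
volume. -/
theorem measurePreserving_coordAct {n : ℕ} (A : SL(2, ℤ)) :
    MeasurePreserving (coordAct (n := n) A) volume volume := by
  have hcont : Continuous (coordAct (n := n) A) := (coordAct A).toLinearMap.continuous_of_finiteDimensional
  refine ⟨hcont.measurable, ?_⟩
  have hdet : LinearMap.det ((coordAct (n := n) A : ((Fin n → ℝ) × (Fin n → ℝ)) ≃ₗ[ℝ] ((Fin n → ℝ) × (Fin n → ℝ))) :
      ((Fin n → ℝ) × (Fin n → ℝ)) →ₗ[ℝ] ((Fin n → ℝ) × (Fin n → ℝ))) ≠ 0 :=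
    (coordAct A).isUnit_det'.ne_zero
  have h := Measure.map_linearMap_addHaar_eq_smul_addHaar
    (volume : Measure ((Fin n → ℝ) × (Fin n → ℝ))) hdet
  set c := ENNReal.ofReal |(LinearMap.det ((coordAct (n := n) A : ((Fin n → ℝ) × (Fin n → ℝ)) ≃ₗ[ℝ] ((Fin n → ℝ) × (Fin n → ℝ))) :
      ((Fin n → ℝ) × (Fin n → ℝ)) →ₗ[ℝ] ((Fin n → ℝ) × (Fin n → ℝ))))⁻¹|
  -- the unit box and its image are fundamental domains of the same lattice
  have hvol : volume (coordAct A '' unitBox n) = 1 := by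
    rw [(isAddFundamentalDomain_coordAct A).measure_eq (isAddFundamentalDomain_unitBox n),
      volume_unitBox]
  have hc : c = 1 := by
    have h1 := congrArg (fun μ => μ (coordAct A '' unitBox n)) h
    simp only [Measure.smul_apply, smul_eq_mul, hvol, mul_one] at h1
    rw [← h1]
    have hemb : MeasurableEmbedding (coordAct (n := n) A) :=
      ((coordAct A).toContinuousLinearEquiv.toHomeomorph).measurableEmbedding
    change Measure.map (coordAct A) volume _ = 1
    rw [hemb.map_apply, Set.preimage_image_eq _ (coordAct A).injective, volume_unitBox]
  rw [hc, one_smul] at h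
  exact h

/-- Automorphisms of the torus `(ℝ / ℤ)ⁿ × (ℝ / ℤ)ⁿ` preserve integrals. -/
theorem setIntegral_unitBox_coordAct {n : ℕ} (A : SL(2, ℤ)) {G : (Fin n → ℝ) × (Fin n → ℝ) → ℂ}
    (hG : ∀ (a b : Fin n → ℤ) (x : (Fin n → ℝ) × (Fin n → ℝ)),
      G ((intVec ℝ a, intVec ℝ b) + x) = G x) :
    ∫ x in unitBox n, G (coordAct A x) = ∫ x in unitBox n, G x := by
  have hemb : MeasurableEmbedding (coordAct (n := n) A) :=
    ((coordAct A).toContinuousLinearEquiv.toHomeomorph).measurableEmbedding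
  rw [← (measurePreserving_coordAct A).setIntegral_image_emb hemb G]
  refine (isAddFundamentalDomain_coordAct A).setIntegral_eq (isAddFundamentalDomain_unitBox n) ?_
  rintro ⟨g, hg⟩ x
  obtain ⟨a, b, rfl⟩ := mem_span_boxBasis.mp hg
  exact hG a b x

/-! ### Real coordinates in the Petersson integral -/

/-- The real coordinates `(p, q) ↦ p τ + q` as a homeomorphism `ℍ × (ℝⁿ × ℝⁿ) ≃ ℍ × ℂⁿ`. -/
noncomputable def realCoords (n : ℕ) :
    (ℍ × ((Fin n → ℝ) × (Fin n → ℝ))) ≃ₜ (ℍ × (Fin n → ℂ)) where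
  toFun w := (w.1, realPt w.1 w.2.1 w.2.2)
  invFun w := (w.1, (coordP w.1 w.2, coordQ w.1 w.2))
  left_inv w := by simp [coordP_realPt, coordQ_realPt]
  right_inv w := by simp [realPt_coord]
  continuous_toFun := by
    refine continuous_fst.prodMk ?_
    exact continuous_realPt.comp (continuous_fst.prodMk continuous_snd)
  continuous_invFun := by
    exact continuous_fst.prodMk (continuous_coordP.prodMk continuous_coordQ)

theorem realCoords_apply {n : ℕ} (w : ℍ × ((Fin n → ℝ) × (Fin n → ℝ))) :
    realCoords n w = (w.1, realPt w.1 w.2.1 w.2.2) := rfl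

theorem realCoords_preimage_jacobiDomain (n : ℕ) :
    realCoords n ⁻¹' EvenLattice.jacobiDomain n = 𝒟 ×ˢ unitBox n := by
  ext ⟨τ, p, q⟩
  simp only [Set.mem_preimage, realCoords_apply, EvenLattice.jacobiDomain, Set.mem_prod,
    Set.mem_ofPred_eq, unitBox]
  refine and_congr_right fun _ => ⟨?_, fun h => ⟨p, q, h, fun i => by simp [realPt, realVec]; ring⟩⟩
  rintro ⟨p', q', h, hz⟩
  have hpt : realPt τ p q = realPt τ p' q' := by
    ext i; rw [hz i]; simp [realPt, realVec]; ring
  have hp : p = p' := by rw [← coordP_realPt τ p q, hpt, coordP_realPt]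
  have hq : q = q' := by rw [← coordQ_realPt τ p q, hpt, coordQ_realPt]
  rw [hp, hq]; exact h

theorem measurableSet_fd : MeasurableSet (𝒟 : Set ℍ) := by
  have : IsClosed (𝒟 : Set ℍ) := by
    have h1 : Continuous fun τ : ℍ => Complex.normSq (τ : ℂ) :=
      Complex.continuous_normSq.comp continuous_coe
    have h2 : Continuous fun τ : ℍ => |τ.re| := continuous_re.abs
    exact (isClosed_le continuous_const h1).inter (isClosed_le h2 continuous_const)
  exact this.measurableSet

theorem measurableSet_jacobiDomain (n : ℕ) : MeasurableSet (EvenLattice.jacobiDomain n) := by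
  rw [← (realCoords n).toMeasurableEquiv.measurableSet_preimage]
  change MeasurableSet (realCoords n ⁻¹' _)
  rw [realCoords_preimage_jacobiDomain]
  exact measurableSet_fd.prod (measurableSet_unitBox n)

/-- The identification `(p, q) ↦ i p + q` of `ℝⁿ × ℝⁿ` with `ℂⁿ` preserves the volume. -/
theorem measurePreserving_complex (n : ℕ) :
    MeasurePreserving (fun x : (Fin n → ℝ) × (Fin n → ℝ) => fun i => (⟨x.2 i, x.1 i⟩ : ℂ))
      volume volume := by
  have h1 : MeasurePreserving (Prod.swap : (Fin n → ℝ) × (Fin n → ℝ) → _) volume volume :=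
    Measure.measurePreserving_swap
  have h2 := (volume_measurePreserving_arrowProdEquivProdArrow ℝ ℝ (Fin n)).symm
  have h3 : MeasurePreserving (fun (a : Fin n → ℝ × ℝ) i => (⟨(a i).1, (a i).2⟩ : ℂ))
      volume volume :=
    volume_preserving_pi fun _ => Complex.volume_preserving_equiv_real_prod.symm
  exact h3.comp (h2.comp h1)

theorem measurePreserving_shear {n : ℕ} (u : ℝ) :
    MeasurePreserving (fun x : (Fin n → ℝ) × (Fin n → ℝ) => (x.1, x.2 + u • x.1))
      volume volume := by
  refine MeasurePreserving.skew_product (g := fun a b => b + u • a) (MeasurePreserving.id volume)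
    (by fun_prop) (Filter.Eventually.of_forall fun a => ?_)
  exact map_add_right_eq_self _ _

theorem map_smul_fst {n : ℕ} {v : ℝ} (hv : 0 < v) :
    Measure.map (fun x : (Fin n → ℝ) × (Fin n → ℝ) => (v • x.1, x.2)) volume =
      ENNReal.ofReal ((v ^ n)⁻¹) • volume := by
  have h := Measure.map_prod_map (volume : Measure (Fin n → ℝ)) (volume : Measure (Fin n → ℝ))
    (f := fun p => v • p) (g := id) (by fun_prop) measurable_id
  rw [Measure.map_id, Measure.map_addHaar_smul _ hv.ne', Module.finrank_fin_fun,
    abs_of_pos (by positivity), Measure.prod_smul_left] at h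
  exact h.symm

/-- The Jacobian of `(p, q) ↦ p τ + q` is `v ^ n`. -/
theorem volume_realPt_preimage {n : ℕ} (τ : ℍ) {s : Set (Fin n → ℂ)} (hs : MeasurableSet s) :
    volume {x : (Fin n → ℝ) × (Fin n → ℝ) | realPt τ x.1 x.2 ∈ s} =
      ENNReal.ofReal ((τ.im ^ n)⁻¹) * volume s := by
  have h1 := (measurePreserving_complex n).comp (measurePreserving_shear (n := n) (τ.re / τ.im))
  have h2 := map_smul_fst (n := n) τ.im_pos
  have h3 : {x : (Fin n → ℝ) × (Fin n → ℝ) | realPt τ x.1 x.2 ∈ s} =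
      (fun x : (Fin n → ℝ) × (Fin n → ℝ) => (τ.im • x.1, x.2)) ⁻¹'
      (((fun x : (Fin n → ℝ) × (Fin n → ℝ) => fun i => (⟨x.2 i, x.1 i⟩ : ℂ)) ∘
        (fun x : (Fin n → ℝ) × (Fin n → ℝ) => (x.1, x.2 + (τ.re / τ.im) • x.1))) ⁻¹' s) := by
    ext ⟨p, q⟩
    simp only [Set.mem_preimage, Set.mem_ofPred_eq, Function.comp]
    have : realPt τ p q = fun i => (⟨(q + (τ.re / τ.im) • τ.im • p) i, (τ.im • p) i⟩ : ℂ) := by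
      ext i
      have := τ.im_ne_zero
      apply Complex.ext
      · simp [realPt, realVec]; field_simp; ring
      · simp [realPt, realVec]
    rw [this]
  rw [h3, ← Measure.map_apply (by fun_prop) (h1.measurable hs), h2, Measure.smul_apply,
    h1.measure_preimage hs.nullMeasurableSet, smul_eq_mul]

/-- In real coordinates the measure `v^{-n} dx dy` on `ℂⁿ` is Lebesgue measure. -/
theorem measurePreserving_realCoords (n : ℕ) :
    MeasurePreserving (realCoords n) volume
      ((volume : Measure (ℍ × (Fin n → ℂ))).withDensity
        fun w => (Real.toNNReal ((w.1.im ^ n)⁻¹) : ENNReal)) := by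
  have hm : Measurable (realCoords n) := (realCoords n).continuous.measurable
  have hd : Measurable fun w : ℍ × (Fin n → ℂ) => ((Real.toNNReal ((w.1.im ^ n)⁻¹) : ENNReal)) := by
    have : Continuous fun w : ℍ × (Fin n → ℂ) => ((w.1.im ^ n)⁻¹) :=
      ((continuous_im.comp continuous_fst).pow n).inv₀ fun w => pow_ne_zero _ w.1.im_ne_zero
    exact this.measurable.real_toNNReal.coe_nnreal_ennreal
  refine ⟨hm, Measure.ext fun s hs => ?_⟩
  rw [Measure.map_apply hm hs, withDensity_apply _ hs, ← lintegral_indicator hs,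
    Measure.volume_eq_prod ℍ ((Fin n → ℝ) × (Fin n → ℝ)), Measure.volume_eq_prod ℍ (Fin n → ℂ),
    Measure.prod_apply (hm hs),
    lintegral_prod _ (hd.indicator hs).aemeasurable]
  refine lintegral_congr fun τ => ?_
  have hs' : MeasurableSet (Prod.mk τ ⁻¹' s) := measurable_prodMk_left hs
  have h1 := volume_realPt_preimage τ hs'
  have h2 : (fun z : Fin n → ℂ => s.indicator
      (fun w : ℍ × (Fin n → ℂ) => ((Real.toNNReal ((w.1.im ^ n)⁻¹) : ENNReal))) (τ, z)) =
      (Prod.mk τ ⁻¹' s).indicator fun _ => ENNReal.ofReal ((τ.im ^ n)⁻¹) := by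
    ext z
    by_cases hz : (τ, z) ∈ s
    · rw [Set.indicator_of_mem hz, Set.indicator_of_mem (by exact hz)]; rfl
    · rw [Set.indicator_of_notMem hz, Set.indicator_of_notMem (by exact hz)]
  rw [h2, lintegral_indicator hs', lintegral_const, Measure.restrict_apply_univ, ← h1]
  rfl

/-- The Petersson integral in the real coordinates of `z`. -/
theorem petIntegrand_real {n : ℕ} (F : ℍ → (Fin n → ℂ) → ℂ) :
    (IntegrableOn (fun w : ℍ × (Fin n → ℂ) => F w.1 w.2 * ((w.1.im ^ (-(n : ℤ)) : ℝ) : ℂ))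
        (EvenLattice.jacobiDomain n) ↔
      IntegrableOn (fun w : ℍ × ((Fin n → ℝ) × (Fin n → ℝ)) => F w.1 (realPt w.1 w.2.1 w.2.2))
        (𝒟 ×ˢ unitBox n)) ∧
    ∫ w in EvenLattice.jacobiDomain n, F w.1 w.2 * ((w.1.im ^ (-(n : ℤ)) : ℝ) : ℂ) =
      ∫ w in 𝒟 ×ˢ unitBox n, F w.1 (realPt w.1 w.2.1 w.2.2) := by
  have hmp := measurePreserving_realCoords n
  have hemb : MeasurableEmbedding (realCoords n) := (realCoords n).measurableEmbedding
  have hd : Measurable fun w : ℍ × (Fin n → ℂ) => (Real.toNNReal ((w.1.im ^ n)⁻¹)) := by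
    have : Continuous fun w : ℍ × (Fin n → ℂ) => ((w.1.im ^ n)⁻¹) :=
      ((continuous_im.comp continuous_fst).pow n).inv₀ fun w => pow_ne_zero _ w.1.im_ne_zero
    exact this.measurable.real_toNNReal
  have hF : (fun w : ℍ × (Fin n → ℂ) => F w.1 w.2 * ((w.1.im ^ (-(n : ℤ)) : ℝ) : ℂ)) =
      fun w => Real.toNNReal ((w.1.im ^ n)⁻¹) • F w.1 w.2 := by
    ext w
    rw [NNReal.smul_def, Real.coe_toNNReal _ (by have := w.1.im_pos; positivity),
      Complex.real_smul, mul_comm, _root_.zpow_neg, zpow_natCast]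
  rw [hF, ← realCoords_preimage_jacobiDomain]
  constructor
  · have h := hmp.integrableOn_comp_preimage hemb (f := fun w => F w.1 w.2)
      (s := EvenLattice.jacobiDomain n)
    rw [IntegrableOn, IntegrableOn, restrict_withDensity (measurableSet_jacobiDomain n),
      integrable_withDensity_iff_integrable_smul hd] at h
    exact h.symm
  · rw [← setIntegral_withDensity_eq_setIntegral_smul hd _ (measurableSet_jacobiDomain n)]
    exact (hmp.setIntegral_preimage_emb hemb (fun w => F w.1 w.2) _).symm

/-! ### Decay of cusp forms -/

namespace EvenLattice

variable {n : ℕ} (L : EvenLattice n)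

/-- Cramer's rule: `det(G) s` is an integral vector for `s ∈ L^#`. -/
theorem exists_gram_det_smul {s : Fin n → ℚ} (hs : s ∈ L.dual) :
    ∃ y : Fin n → ℤ, (L.gram.det : ℚ) • s = intVec ℚ y := by
  obtain ⟨a, ha⟩ := L.dualEquiv.surjective ⟨s, hs⟩
  have hs' : s = L.dualVec a := by
    have := congrArg Subtype.val ha
    simpa using this.symm
  refine ⟨L.gram.adjugate *ᵥ a, ?_⟩
  have h1 := L.gram_mulVec_dualVec a
  rw [← hs'] at h1
  have h2 : (L.gram.map (Int.cast : ℤ → ℚ)).adjugate *ᵥ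
      (L.gram.map (Int.cast : ℤ → ℚ) *ᵥ s) = (L.gram.det : ℚ) • s := by
    rw [mulVec_mulVec, adjugate_mul, smul_mulVec, one_mulVec]
    congr 1
    exact ((Int.castRingHom ℚ).map_det L.gram).symm
  rw [← h2, h1]
  have h3 : (L.gram.map (Int.cast : ℤ → ℚ)).adjugate =
      L.gram.adjugate.map (Int.cast : ℤ → ℚ) := ((Int.castRingHom ℚ).map_adjugate L.gram).symm
  rw [h3]
  ext i
  simp [mulVec, dotProduct, intVec]

/-- The values `β(s)`, `s ∈ L^#`, have bounded denominators. -/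
theorem exists_quad_gap : ∃ δ : ℝ, 0 < δ ∧ ∀ s ∈ L.dual, ∀ m : ℤ, L.quad s < (m : ℚ) →
    δ ≤ (m : ℝ) - ((L.quad s : ℚ) : ℝ) := by
  have hD : 0 < |(L.gram.det : ℚ)| := abs_pos.mpr (by exact_mod_cast L.gram_det_ne_zero)
  refine ⟨((1 / (2 * |(L.gram.det : ℚ)|) : ℚ) : ℝ), Rat.cast_pos.mpr (div_pos one_pos (mul_pos two_pos hD)),
    fun s hs m hm => ?_⟩
  obtain ⟨y, hy⟩ := L.exists_gram_det_smul hs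
  obtain ⟨t, ht⟩ := hs y
  rw [← hy, bil_smul_right] at ht
  have h1 : ((2 * L.gram.det * m - t : ℤ) : ℚ) = 2 * L.gram.det * ((m : ℚ) - L.quad s) := by
    simp only [Int.cast_sub, Int.cast_mul, Int.cast_ofNat]
    rw [← ht, quad]; ring
  have h2 : (2 * L.gram.det * m - t : ℤ) ≠ 0 := by
    intro h
    rw [h] at h1
    have h3 : (L.gram.det : ℚ) ≠ 0 := by exact_mod_cast L.gram_det_ne_zero
    have h4 : (m : ℚ) - L.quad s ≠ 0 := (sub_pos.mpr hm).ne'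
    simp [h3, h4] at h1
  have h5 : (1 : ℚ) ≤ |((2 * L.gram.det * m - t : ℤ) : ℚ)| := by
    exact_mod_cast Int.one_le_abs h2
  rw [h1, abs_mul, abs_mul, abs_two, abs_of_pos (show (0 : ℚ) < (m : ℚ) - L.quad s by linarith)] at h5
  have h6 : 1 / (2 * |(L.gram.det : ℚ)|) ≤ (m : ℚ) - L.quad s := by
    rw [div_le_iff₀ (by positivity)]; linarith
  exact_mod_cast h6

/-- The modulus of `e(mτ + β(s, z))` in real coordinates. -/
theorem norm_eFun_exponent (m : ℝ) (s : Fin n → ℚ) (τ : ℍ) (p q : Fin n → ℝ) :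
    ‖eFun ((m : ℂ) * τ + L.bil (ratVec s) (realPt τ p q))‖ =
      Real.exp (-2 * Real.pi * τ.im * (m + L.bil (ratVecReal s) p)) := by
  rw [norm_eFun, ratVec_eq_realVec, realPt, bil_add_right, bil_smul_right, bil_realVec,
    bil_realVec]
  congr 1
  simp
  ring

/-- A linear exponential on the unit cube is at most the sum of its values at the corners. -/
theorem exp_linear_le_sum_corners {t : ℝ} (ht : 0 ≤ t) (b p : Fin n → ℝ)
    (hp : ∀ i, p i ∈ Set.Icc (0 : ℝ) 1) : Real.exp (-t * ∑ i, b i * p i) ≤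
      ∑ S : Finset (Fin n), Real.exp (-t * ∑ i, b i * (if i ∈ S then 1 else 0)) := by
  have h1 : ∀ i, Real.exp (-t * (b i * p i)) ≤ 1 + Real.exp (-t * b i) := by
    intro i
    obtain ⟨h0, h1⟩ := hp i
    rcases le_total 0 (b i) with hb | hb
    · have : Real.exp (-t * (b i * p i)) ≤ 1 := Real.exp_le_one_iff.mpr (by
        have := mul_nonneg ht (mul_nonneg hb h0); linarith)
      linarith [Real.exp_pos (-t * b i)]
    · have : Real.exp (-t * (b i * p i)) ≤ Real.exp (-t * b i) := Real.exp_le_exp.mpr (by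
        have := mul_nonneg ht (mul_nonneg (neg_nonneg.mpr hb) (sub_nonneg.mpr h1)); linarith)
      linarith
  calc Real.exp (-t * ∑ i, b i * p i) = ∏ i, Real.exp (-t * (b i * p i)) := by
        rw [Finset.mul_sum, Real.exp_sum]
    _ ≤ ∏ i, (1 + Real.exp (-t * b i)) :=
        Finset.prod_le_prod (fun i _ => (Real.exp_pos _).le) fun i _ => h1 i
    _ = ∑ S : Finset (Fin n), ∏ i ∈ S, Real.exp (-t * b i) := by
        rw [Finset.prod_one_add, Finset.powerset_univ]
    _ = _ := by
        refine Finset.sum_congr rfl fun S _ => ?_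
        rw [← Real.exp_sum, ← Finset.mul_sum]
        simp

/-- A cusp form decays exponentially in `Im τ`, uniformly in the real coordinates on the unit
cube. The constant is the sum of the absolute Fourier series at the corners of the cube, at height
`1/2`. -/
theorem exists_cusp_bound {k : ℤ} {φ : ℍ → (Fin n → ℂ) → ℂ} (hφ : L.IsCuspForm k φ) :
    ∃ C δ : ℝ, 0 ≤ C ∧ 0 < δ ∧ ∀ (τ : ℍ) (p q : Fin n → ℝ), 1 / 2 ≤ τ.im →
      (∀ i, p i ∈ Set.Icc (0 : ℝ) 1) → ‖φ τ (realPt τ p q)‖ ≤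
        C * Real.exp (-δ * τ.im) * Real.exp (2 * Real.pi * τ.im * L.quad p) := by
  obtain ⟨c, hc, hcusp⟩ := hφ.cusp
  obtain ⟨δ, hδ, hgap⟩ := L.exists_quad_gap
  -- The height `1/2` lies below the fundamental domain. Moving from there to `τ` multiplies each
  -- term by a factor that decays in `Im τ`, since the exponent is bounded below by `δ`.
  set τ₀ : ℍ := ⟨Complex.I / 2, by simp⟩ with hτ₀
  have him : τ₀.im = 1 / 2 := by simp [hτ₀, UpperHalfPlane.im]
  set corner : Finset (Fin n) → (Fin n → ℝ) := fun S i => if i ∈ S then 1 else 0 with hcorner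
  set ι := {p : ℤ × (Fin n → ℚ) // p.2 ∈ L.dual ∧ L.quad p.2 ≤ p.1}
  set a : Finset (Fin n) → ι → ℝ := fun S x => ‖c x.1.1 x.1.2‖ *
    Real.exp (-Real.pi * ((x.1.1 : ℝ) + L.bil (ratVecReal x.1.2) (corner S))) with ha
  have hnorm : ∀ (x : ι) (τ : ℍ) (p q : Fin n → ℝ), ‖c x.1.1 x.1.2 *
      eFun ((x.1.1 : ℂ) * τ + L.bil (ratVec x.1.2) (realPt τ p q))‖ = ‖c x.1.1 x.1.2‖ *
        Real.exp (-2 * Real.pi * τ.im * ((x.1.1 : ℝ) + L.bil (ratVecReal x.1.2) p)) := by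
    intro x τ p q
    have := L.norm_eFun_exponent (x.1.1 : ℝ) x.1.2 τ p q
    rw [Complex.ofReal_intCast] at this
    rw [norm_mul, this]
  have hsum : ∀ S, Summable (a S) := by
    intro S
    refine ((hc τ₀ (realPt τ₀ (corner S) 0)).summable.norm).congr fun x => ?_
    rw [hnorm, him, ha]
    ring_nf
  refine ⟨(∑ S, ∑' x, a S x) * Real.exp (Real.pi * δ), 2 * Real.pi * δ, ?_, by positivity, ?_⟩
  · refine mul_nonneg (Finset.sum_nonneg fun S _ => tsum_nonneg fun x => ?_) (Real.exp_pos _).le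
    exact mul_nonneg (norm_nonneg _) (Real.exp_pos _).le
  intro τ p q hτ hp
  have hmaj : HasSum (fun x => (∑ S, a S x) * (Real.exp (Real.pi * δ) *
      Real.exp (-(2 * Real.pi * δ) * τ.im) * Real.exp (2 * Real.pi * τ.im * L.quad p)))
      ((∑ S, ∑' x, a S x) * (Real.exp (Real.pi * δ) *
      Real.exp (-(2 * Real.pi * δ) * τ.im) * Real.exp (2 * Real.pi * τ.im * L.quad p))) :=
    (hasSum_sum fun S _ => (hsum S).hasSum).mul_right _
  have hbound : ∀ x : ι, ‖c x.1.1 x.1.2 *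
      eFun ((x.1.1 : ℂ) * τ + L.bil (ratVec x.1.2) (realPt τ p q))‖ ≤
      (∑ S, a S x) * (Real.exp (Real.pi * δ) *
      Real.exp (-(2 * Real.pi * δ) * τ.im) * Real.exp (2 * Real.pi * τ.im * L.quad p)) := by
    rintro ⟨⟨m, s⟩, hs, hm⟩
    rw [hnorm]
    by_cases h0 : c m s = 0
    · simp only [h0, norm_zero, zero_mul, ha, Finset.sum_const_zero, le_refl]
    have hlt : L.quad s < (m : ℚ) := lt_of_le_of_ne hm fun h => h0 (hcusp s hs m h)
    have hg := hgap s hs m hlt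
    have hlin : ∀ x : Fin n → ℝ, L.bil (ratVecReal s) x =
        ∑ i, (L.gram.map (Int.cast : ℤ → ℝ) *ᵥ ratVecReal s) i * x i := by
      intro x; rw [bil_comm, bil, dotProduct_comm]; rfl
    have hcor := exp_linear_le_sum_corners Real.pi_pos.le
      (L.gram.map (Int.cast : ℤ → ℝ) *ᵥ ratVecReal s) p hp
    rw [← hlin] at hcor
    have hcor' : ‖c m s‖ * Real.exp (-Real.pi * ((m : ℝ) + L.bil (ratVecReal s) p)) ≤
        ∑ S, a S ⟨⟨m, s⟩, hs, hm⟩ := by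
      simp only [ha, mul_add, Real.exp_add, ← Finset.mul_sum]
      refine mul_le_mul_of_nonneg_left ?_ (norm_nonneg _)
      refine mul_le_mul_of_nonneg_left ?_ (Real.exp_pos _).le
      refine hcor.trans_eq (Finset.sum_congr rfl fun S _ => ?_)
      rw [hlin]
    -- the exponent is `m - β(s) + β(s + p)`, up to the summand `-β(p)`
    have hquad : (m : ℝ) + L.bil (ratVecReal s) p + L.quad p =
        (m - ((L.quad s : ℚ) : ℝ)) + L.quad (ratVecReal s + p) := by
      rw [quad_add_field, quad_ratVecReal]; ring
    have hX : δ ≤ (m : ℝ) + L.bil (ratVecReal s) p + L.quad p := by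
      rw [hquad]; linarith [L.quad_real_nonneg (ratVecReal s + p)]
    have hQ := L.quad_real_nonneg p
    calc ‖c m s‖ * Real.exp (-2 * Real.pi * τ.im * ((m : ℝ) + L.bil (ratVecReal s) p))
        ≤ ‖c m s‖ * (Real.exp (-Real.pi * ((m : ℝ) + L.bil (ratVecReal s) p)) *
          (Real.exp (Real.pi * δ) * Real.exp (-(2 * Real.pi * δ) * τ.im) *
            Real.exp (2 * Real.pi * τ.im * L.quad p))) := by
          refine mul_le_mul_of_nonneg_left ?_ (norm_nonneg _)
          rw [← Real.exp_add, ← Real.exp_add, ← Real.exp_add]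
          refine Real.exp_le_exp.mpr ?_
          have h1 : 0 ≤ (2 * τ.im - 1) * ((m : ℝ) + L.bil (ratVecReal s) p + L.quad p - δ) :=
            mul_nonneg (by linarith) (by linarith)
          have h2 : 0 ≤ Real.pi * ((2 * τ.im - 1) *
            ((m : ℝ) + L.bil (ratVecReal s) p + L.quad p - δ) + L.quad p) :=
            mul_nonneg Real.pi_pos.le (by linarith)
          linarith
      _ ≤ _ := by
          rw [← _root_.mul_assoc]
          exact mul_le_mul_of_nonneg_right hcor' (by positivity)
  have h := hc τ (realPt τ p q)
  rw [← h.tsum_eq]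
  refine (tsum_of_norm_bounded hmaj hbound).trans_eq ?_
  ring

end EvenLattice

/-! ### Unfolding over the upper half-plane -/

/-- The invariant measure on `ℍ` in the coordinates `u = Re τ`, `v = Im τ`. -/
theorem measurePreserving_re_im :
    MeasurePreserving (fun τ : ℍ => (τ.re, τ.im)) volume
      ((volume.restrict (Set.univ ×ˢ Set.Ioi (0 : ℝ))).withDensity
        fun x : ℝ × ℝ => ((1 / ‖x.2‖₊) ^ 2 : NNReal)) := by
  have hm : Measurable fun τ : ℍ => (τ.re, τ.im) :=
    (continuous_re.prodMk continuous_im).measurable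
  refine ⟨hm, Measure.ext fun s hs => ?_⟩
  have hI : MeasurableSet (Set.univ ×ˢ Set.Ioi (0 : ℝ) : Set (ℝ × ℝ)) :=
    MeasurableSet.univ.prod measurableSet_Ioi
  rw [Measure.map_apply hm hs, withDensity_apply _ hs, Measure.restrict_restrict hs,
    volume_eq_lintegral]
  have hset : ((↑) : ℍ → ℂ) '' ((fun τ : ℍ => (τ.re, τ.im)) ⁻¹' s) =
      Complex.measurableEquivRealProd ⁻¹' (s ∩ Set.univ ×ˢ Set.Ioi (0 : ℝ)) := by
    ext z
    constructor
    · rintro ⟨τ, hτ, rfl⟩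
      exact ⟨hτ, Set.mem_univ _, τ.im_pos⟩
    · rintro ⟨hz, -, hz'⟩
      exact ⟨⟨z, hz'⟩, hz, rfl⟩
  rw [hset]
  exact Complex.volume_preserving_equiv_real_prod.setLIntegral_comp_preimage_emb
    Complex.measurableEquivRealProd.measurableEmbedding
    (fun x : ℝ × ℝ => (((1 / ‖x.2‖₊) ^ 2 : NNReal) : ENNReal)) _

theorem volume_fd_lt_top : volume (𝒟 : Set ℍ) < ⊤ := by
  have hI : MeasurableSet (Set.univ ×ˢ Set.Ioi (0 : ℝ) : Set (ℝ × ℝ)) :=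
    MeasurableSet.univ.prod measurableSet_Ioi
  set R : Set (ℝ × ℝ) := Set.Icc (-1 / 2) (1 / 2) ×ˢ Set.Ioi (1 / 2) with hR
  have hRm : MeasurableSet R := measurableSet_Icc.prod measurableSet_Ioi
  have hsub : (𝒟 : Set ℍ) ⊆ (fun τ : ℍ => (τ.re, τ.im)) ⁻¹' R := by
    intro τ hτ
    have h1 := ModularGroup.three_le_four_mul_im_sq_of_mem_fd hτ
    have h2 := abs_le.mp hτ.2
    refine ⟨⟨by linarith [h2.1], h2.2⟩, ?_⟩
    have := τ.im_pos
    change 1 / 2 < τ.im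
    nlinarith
  refine (measure_mono hsub).trans_lt ?_
  rw [measurePreserving_re_im.measure_preimage hRm.nullMeasurableSet, withDensity_apply _ hRm]
  have hint : IntegrableOn (fun x : ℝ × ℝ => (1 : ℝ) * x.2 ^ (-2 : ℝ)) R := by
    rw [IntegrableOn, hR, Measure.volume_eq_prod, ← Measure.prod_restrict]
    refine Integrable.mul_prod (f := fun _ => (1 : ℝ)) (g := fun v : ℝ => v ^ (-2 : ℝ)) ?_ ?_
    · exact integrableOn_const (by simp)
    · exact integrableOn_Ioi_rpow_of_lt (by norm_num) (by norm_num)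
  refine lt_of_le_of_lt ?_ hint.2
  rw [Measure.restrict_restrict hRm]
  refine (lintegral_mono_set Set.inter_subset_left).trans ?_
  refine setLIntegral_mono' hRm fun x hx => ?_
  have hx2 : 0 < x.2 := lt_trans (by norm_num) hx.2
  rw [← ofReal_norm, ENNReal.le_ofReal_iff_toReal_le (by simp) (norm_nonneg _)]
  simp only [ENNReal.coe_toReal, NNReal.coe_pow, NNReal.coe_div, NNReal.coe_one, coe_nnnorm]
  rw [Real.norm_of_nonneg hx2.le, one_mul, Real.norm_of_nonneg (by positivity),
    Real.rpow_neg hx2.le, Real.rpow_two, one_div, inv_pow]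

/-- The boundary of the fundamental domain is a null set. -/
theorem volume_fd_diff_fdo : volume ((𝒟 : Set ℍ) \ 𝒟ᵒ) = 0 := by
  set B : Set (ℝ × ℝ) := {x | |x.1| = 1 / 2 ∨ x.1 ^ 2 + x.2 ^ 2 = 1} with hB
  have hBc : IsClosed B := (isClosed_eq (by fun_prop) (by fun_prop)).union
    (isClosed_eq (by fun_prop) (by fun_prop))
  have hsub : (𝒟 : Set ℍ) \ 𝒟ᵒ ⊆ (fun τ : ℍ => (τ.re, τ.im)) ⁻¹' B := by
    rintro τ ⟨⟨h1, h2⟩, h3⟩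
    by_contra h
    simp only [hB, Set.mem_preimage, Set.mem_ofPred_eq, not_or] at h
    refine h3 ⟨lt_of_le_of_ne h1 fun h4 => h.2 ?_, lt_of_le_of_ne h2 h.1⟩
    rw [h4, Complex.normSq_apply]
    simp [pow_two]
  refine measure_mono_null hsub ?_
  rw [measurePreserving_re_im.measure_preimage hBc.measurableSet.nullMeasurableSet]
  refine withDensity_absolutelyContinuous _ _ (Measure.absolutelyContinuous_of_le
    Measure.restrict_le_self ?_)
  rw [Measure.volume_eq_prod, Measure.measure_prod_null hBc.measurableSet]
  have hne : ∀ᵐ u : ℝ, u ∉ ({1 / 2, -1 / 2} : Set ℝ) :=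
    measure_eq_zero_iff_ae_notMem.mp ((Set.toFinite _).measure_zero _)
  filter_upwards [hne] with u hu
  refine Set.Finite.measure_zero ?_ _
  refine (Set.toFinite ({Real.sqrt (1 - u ^ 2), -Real.sqrt (1 - u ^ 2)} : Set ℝ)).subset ?_
  rintro v (h | h)
  · refine absurd ?_ hu
    rcases eq_or_eq_neg_of_abs_eq h with h | h
    · exact Or.inl h
    · exact Or.inr (by simp at h ⊢; linarith)
  · have h1 : v ^ 2 = Real.sqrt (1 - u ^ 2) ^ 2 := by
      have h' : u ^ 2 + v ^ 2 = 1 := h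
      rw [Real.sq_sqrt (by nlinarith [sq_nonneg v])]; linarith
    exact sq_eq_sq_iff_eq_or_eq_neg.mp h1

theorem measurePreserving_SL_smul (A : SL(2, ℤ)) :
    MeasurePreserving (fun τ : ℍ => A • τ) volume volume :=
  measurePreserving_smul (A : GL (Fin 2) ℝ) (volume : Measure ℍ)

theorem measurableEmbedding_SL_smul (A : SL(2, ℤ)) : MeasurableEmbedding (fun τ : ℍ => A • τ) :=
  measurableEmbedding_const_smul (A : GL (Fin 2) ℝ)

instance countable_SL : Countable SL(2, ℤ) := by
  have : Countable (Matrix (Fin 2) (Fin 2) ℤ) := inferInstanceAs (Countable (Fin 2 → Fin 2 → ℤ))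
  exact Subtype.countable

instance countable_SLCosets : Countable SLCosets := Quotient.countable

/-- Almost every point of `ℍ` lies in exactly two of the translates `γ 𝒟`, `γ ∈ SL₂(ℤ)`. -/
theorem ae_exists_translates : ∀ᵐ τ : ℍ, ∃ A : SL(2, ℤ), ∀ γ : SL(2, ℤ),
    γ⁻¹ • τ ∈ 𝒟 ↔ γ = A ∨ γ = -A := by
  have h : ∀ᵐ τ : ℍ, ∀ γ : SL(2, ℤ), γ • τ ∉ 𝒟 \ 𝒟ᵒ := by
    rw [ae_all_iff]
    intro γ
    refine measure_eq_zero_iff_ae_notMem.mp ?_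
    have := (measurePreserving_SL_smul γ).measure_preimage_emb (measurableEmbedding_SL_smul γ)
      (𝒟 \ 𝒟ᵒ)
    rw [volume_fd_diff_fdo] at this
    exact this
  filter_upwards [h] with τ hτ
  obtain ⟨g, hg⟩ := ModularGroup.exists_smul_mem_fd τ
  have hg' : g • τ ∈ 𝒟ᵒ := by
    by_contra hn; exact hτ g ⟨hg, hn⟩
  refine ⟨g⁻¹, fun γ => ⟨fun hγ => ?_, ?_⟩⟩
  · have h1 : (γ⁻¹ * g⁻¹) • (g • τ) ∈ 𝒟 := by rwa [smul_smul, inv_mul_cancel_right]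
    rcases ModularGroup.eq_one_or_neg_one_of_mem_fdo_mem_fd hg' h1 with h2 | h2
    · left; exact (inv_mul_eq_one.mp h2).symm ▸ rfl
    · right
      have : g⁻¹ = γ * (-1) := by rw [← h2, mul_inv_cancel_left]
      rw [this]; simp
  · rintro (rfl | rfl)
    · simpa using hg
    · have : (-g⁻¹)⁻¹ • τ = g • τ := by
        rw [show (-g⁻¹)⁻¹ = -g from inv_eq_of_mul_eq_one_left (by simp)]
        exact ModularGroup.SL_neg_smul g τ
      rw [this]; exact hg

/-- Each element of `SL₂(ℤ)` is uniquely `T ^ m` times a coset representative. -/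
theorem bijective_T_zpow_mul_out : Function.Bijective
    fun p : SLCosets × ℤ => ModularGroup.T ^ p.2 * p.1.out := by
  have hmk : ∀ (q : SLCosets) (m : ℤ), SLCosets.mk (ModularGroup.T ^ m * q.out) = q := by
    intro q m
    conv_rhs => rw [← q.mk_out]
    rw [SLCosets.mk_eq_iff]
    simp
  constructor
  · rintro ⟨q, m⟩ ⟨q', m'⟩ h
    have hq : q = q' := by rw [← hmk q m, ← hmk q' m']; exact congrArg _ h
    subst hq
    have h1 := mul_right_cancel h
    have h2 := congrArg (fun A : SL(2, ℤ) => A 0 1) h1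
    simp [ModularGroup.coe_T_zpow] at h2
    rw [h2]
  · intro A
    have h : SLCosets.mk (SLCosets.mk A).out = SLCosets.mk A := SLCosets.mk_out _
    obtain ⟨h1, h2, h3⟩ : A * (SLCosets.mk A).out⁻¹ ∈ slParabolic := by
      rw [← QuotientGroup.rightRel_apply]; exact Quotient.eq.mp h
    refine ⟨(SLCosets.mk A, (A * (SLCosets.mk A).out⁻¹) 0 1), ?_⟩
    change _ * _ = _
    rw [← eq_mul_inv_iff_mul_eq]
    ext i j
    fin_cases i <;> fin_cases j <;> simp only [ModularGroup.coe_T_zpow]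
    · exact h1.symm
    · rfl
    · exact h2.symm
    · exact h3.symm

theorem integrable_of_ae_hasSum {α ι : Type*} [Countable ι] {m : MeasurableSpace α} {μ : Measure α}
    {F : ι → α → ℂ} {g : α → ℂ} (hF : ∀ i, Integrable (F i) μ)
    (hsum : Summable fun i => ∫ x, ‖F i x‖ ∂μ) (h : ∀ᵐ x ∂μ, HasSum (fun i => F i x) (g x)) :
    Integrable g μ := by
  refine ⟨aestronglyMeasurable_of_tendsto_ae Filter.atTop
    (f := fun (s : Finset ι) x => ∑ i ∈ s, F i x)
    (fun s => Finset.aestronglyMeasurable_fun_sum s fun i _ => (hF i).aestronglyMeasurable) h, ?_⟩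
  have hle : ∫⁻ x, ‖g x‖ₑ ∂μ ≤ ∑' i, ∫⁻ x, ‖F i x‖ₑ ∂μ := by
    rw [← lintegral_tsum fun i => (hF i).aestronglyMeasurable.enorm]
    refine lintegral_mono_ae (h.mono fun x hx => ?_)
    rw [← hx.tsum_eq]
    exact enorm_tsum_le_tsum_enorm
  refine hle.trans_lt ?_
  have he : ∀ i, ∫⁻ x, ‖F i x‖ₑ ∂μ = ENNReal.ofReal (∫ x, ‖F i x‖ ∂μ) := fun i =>
    (ofReal_integral_norm_eq_lintegral_enorm (hF i)).symm
  simp only [he]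
  rw [← ENNReal.ofReal_tsum_of_nonneg (fun i => integral_nonneg fun x => norm_nonneg _) hsum]
  exact ENNReal.ofReal_lt_top

/-- The unfolding of a sum over `SL₂(ℤ)_∞ \ SL₂(ℤ)` of integrals over the fundamental domain to
an absolutely convergent integral over the strip `0 ≤ Re τ < 1`. The factor `2` accounts for
`±1`. -/
theorem hasSum_setIntegral_fd {f : ℍ → ℂ} (hf : ∀ (m : ℤ) (τ : ℍ), f (ModularGroup.T ^ m • τ) = f τ)
    (hint : ∀ q : SLCosets, IntegrableOn (fun τ => f (q.out • τ)) 𝒟)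
    (hsum : Summable fun q : SLCosets => ∫ τ in 𝒟, ‖f (q.out • τ)‖) :
    IntegrableOn f {τ : ℍ | τ.re ∈ Set.Ico (0 : ℝ) 1} ∧
    HasSum (fun q : SLCosets => ∫ τ in 𝒟, f (q.out • τ))
      (2 * ∫ τ in {τ : ℍ | τ.re ∈ Set.Ico (0 : ℝ) 1}, f τ) := by
  set S : Set ℍ := {τ : ℍ | τ.re ∈ Set.Ico (0 : ℝ) 1} with hS
  have hSm : MeasurableSet S := continuous_re.measurable measurableSet_Ico
  have hemb := measurableEmbedding_SL_smul
  have hmp := measurePreserving_SL_smul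
  obtain ⟨e, he⟩ : ∃ e : SLCosets × ℤ ≃ SL(2, ℤ), ∀ p, e p = ModularGroup.T ^ p.2 * p.1.out :=
    ⟨Equiv.ofBijective _ bijective_T_zpow_mul_out, fun p => rfl⟩
  -- the pieces of `𝒟` that the matrices `T ^ m * q.out` send to the strip
  set D : SLCosets × ℤ → Set ℍ := fun p => 𝒟 ∩ {τ | e p • τ ∈ S} with hD
  have hDm : ∀ p, MeasurableSet (D p) := fun p =>
    measurableSet_fd.inter ((hmp (e p)).measurable hSm)
  have hre : ∀ q m (τ : ℍ), (e (q, m) • τ).re = (q.out • τ).re + m := by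
    intro q m τ
    rw [he, mul_smul, ModularGroup.re_T_zpow_smul]
  have hdisj : ∀ q, Pairwise (Function.onFun Disjoint fun m => D (q, m)) := by
    intro q m m' hmm
    refine Set.disjoint_left.mpr fun τ h h' => hmm ?_
    have h1 : (e (q, m) • τ).re ∈ Set.Ico (0 : ℝ) 1 := h.2
    have h2 : (e (q, m') • τ).re ∈ Set.Ico (0 : ℝ) 1 := h'.2
    rw [hre] at h1 h2
    have h3 : (m : ℝ) < m' + 1 := by linarith [h1.2, h2.1]
    have h4 : (m' : ℝ) < m + 1 := by linarith [h2.2, h1.1]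
    have h5 : m < m' + 1 := by exact_mod_cast h3
    have h6 : m' < m + 1 := by exact_mod_cast h4
    omega
  have hunion : ∀ q, ⋃ m, D (q, m) = 𝒟 := by
    intro q
    refine Set.Subset.antisymm (Set.iUnion_subset fun m => Set.inter_subset_left) fun τ hτ => ?_
    refine Set.mem_iUnion.mpr ⟨-⌊(q.out • τ).re⌋, hτ, ?_⟩
    change (e _ • τ).re ∈ Set.Ico (0 : ℝ) 1
    rw [hre]
    push_cast
    exact ⟨by linarith [Int.floor_le (q.out • τ).re], by linarith [Int.lt_floor_add_one (q.out • τ).re]⟩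
  have hfe : ∀ p τ, f (e p • τ) = f (p.1.out • τ) := fun p τ => by rw [he, mul_smul, hf]
  have hint' : ∀ p, IntegrableOn (fun τ => f (p.1.out • τ)) (D p) := fun p =>
    (hint p.1).mono_set Set.inter_subset_left
  have hfib : ∀ q, HasSum (fun m => ∫ τ in D (q, m), f (q.out • τ)) (∫ τ in 𝒟, f (q.out • τ)) := by
    intro q
    have := hasSum_integral_iUnion (μ := volume) (f := fun τ => f (q.out • τ))
      (fun m => hDm (q, m)) (hdisj q) (by rw [hunion]; exact hint q)
    rwa [hunion] at this
  have hfibn : ∀ q, HasSum (fun m => ∫ τ in D (q, m), ‖f (q.out • τ)‖)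
      (∫ τ in 𝒟, ‖f (q.out • τ)‖) := by
    intro q
    have := hasSum_integral_iUnion (μ := volume) (f := fun τ => ‖f (q.out • τ)‖)
      (fun m => hDm (q, m)) (hdisj q) (by rw [hunion]; exact (hint q).norm)
    rwa [hunion] at this
  -- the same integrals as integrals over the translates of the fundamental domain
  set F : SLCosets × ℤ → ℍ → ℂ := fun p =>
    ((fun τ => (e p)⁻¹ • τ) ⁻¹' 𝒟).indicator (S.indicator f) with hF
  have hFe : ∀ p τ, F p (e p • τ) = (D p).indicator (fun τ => f (p.1.out • τ)) τ := by
    intro p τ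
    by_cases h1 : τ ∈ 𝒟 <;> by_cases h2 : e p • τ ∈ S
    · have : τ ∈ D p := ⟨h1, h2⟩
      rw [Set.indicator_of_mem this, hF]
      dsimp only
      rw [Set.indicator_of_mem (by simpa using h1), Set.indicator_of_mem h2, hfe]
    · have : τ ∉ D p := fun h => h2 h.2
      rw [Set.indicator_of_notMem this, hF]
      dsimp only
      rw [Set.indicator_of_mem (by simpa using h1), Set.indicator_of_notMem h2]
    all_goals
      have : τ ∉ D p := fun h => h1 h.1
      rw [Set.indicator_of_notMem this, hF]
      dsimp only
      rw [Set.indicator_of_notMem (by simpa using h1)]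
  have hFint : ∀ p, Integrable (F p) := by
    intro p
    rw [← (hmp (e p)).integrable_comp_emb (hemb (e p))]
    have : F p ∘ (fun τ => e p • τ) = (D p).indicator (fun τ => f (p.1.out • τ)) :=
      funext (hFe p)
    rw [this, integrable_indicator_iff (hDm p)]
    exact hint' p
  have hFI : ∀ p, ∫ τ, F p τ = ∫ τ in D p, f (p.1.out • τ) := by
    intro p
    rw [← (hmp (e p)).integral_comp (hemb (e p)), ← integral_indicator (hDm p)]
    exact integral_congr_ae (Filter.Eventually.of_forall fun τ => hFe p τ)
  have hFN : ∀ p, ∫ τ, ‖F p τ‖ = ∫ τ in D p, ‖f (p.1.out • τ)‖ := by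
    intro p
    rw [← (hmp (e p)).integral_comp (hemb (e p)) (fun τ => ‖F p τ‖), ← integral_indicator (hDm p)]
    refine integral_congr_ae (Filter.Eventually.of_forall fun τ => ?_)
    change ‖F p (e p • τ)‖ = _
    rw [hFe, norm_indicator_eq_indicator_norm]
  have hFsum : Summable fun p => ∫ τ, ‖F p τ‖ := by
    simp only [hFN]
    rw [summable_prod_of_nonneg fun p => integral_nonneg fun τ => norm_nonneg _]
    exact ⟨fun q => (hfibn q).summable, hsum.congr fun q => (hfibn q).tsum_eq.symm⟩
  have htot := hasSum_integral_of_summable_integral_norm hFint hFsum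
  simp only [hFI] at htot
  have hF2 : ∀ᵐ τ : ℍ, HasSum (fun p => F p τ) (2 * S.indicator f τ) := by
    filter_upwards [ae_exists_translates] with τ hτ
    obtain ⟨A, hA⟩ := hτ
    have hne : A ≠ -A := by
      intro h
      have h0 := congrArg (fun B : SL(2, ℤ) => B 1) h
      have h1 : A 1 = 0 := by
        ext j
        have := congrFun h0 j
        simp at this
        simp; omega
      exact SL_bottom_row_ne_zero A h1
    -- At almost every point only the indices of `A` and `-A` contribute.
    have h1 : ∀ p, F p τ = if e p = A ∨ e p = -A then S.indicator f τ else 0 := by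
      intro p
      rw [hF]
      classical
      dsimp only
      rw [Set.indicator_apply]
      refine if_congr ?_ rfl rfl
      exact hA (e p)
    have h2 : HasSum (fun γ : SL(2, ℤ) => if γ = A ∨ γ = -A then S.indicator f τ else 0)
        (2 * S.indicator f τ) := by
      have h3 : 2 * S.indicator f τ = ∑ γ ∈ {A, -A}, if γ = A ∨ γ = -A then S.indicator f τ else 0 := by
        rw [Finset.sum_pair hne]
        simp [two_mul]
      rw [h3]
      exact hasSum_sum_of_ne_finset_zero fun γ hγ => by
        rw [if_neg]; simpa using hγ
    simp only [h1]
    exact (e.hasSum_iff (f := fun γ : SL(2, ℤ) =>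
      if γ = A ∨ γ = -A then S.indicator f τ else 0)).mpr h2
  have hSint : Integrable (S.indicator f) :=
    ((integrable_of_ae_hasSum hFint hFsum hF2).const_mul (2⁻¹ : ℂ)).congr
      (Filter.Eventually.of_forall fun τ => by simp)
  have hval : ∫ τ, ∑' p, F p τ = 2 * ∫ τ in S, f τ := by
    rw [← integral_indicator hSm, ← integral_const_mul]
    exact integral_congr_ae (hF2.mono fun τ h => h.tsum_eq)
  rw [hval] at htot
  exact ⟨(integrable_indicator_iff hSm).mp hSint, htot.prod_fiberwise hfib⟩

/-! ### The Petersson product with the Eisenstein series -/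

namespace EvenLattice

variable {n : ℕ} (L : EvenLattice n)

/-- The function `ω_{φ,ψ}(τ, p τ + q)` of `τ` and the real coordinates `(p, q)`. -/
noncomputable def omegaReal (k : ℤ) (φ ψ : ℍ → (Fin n → ℂ) → ℂ) (τ : ℍ)
    (x : (Fin n → ℝ) × (Fin n → ℝ)) : ℂ :=
  L.omega k φ ψ τ (realPt τ x.1 x.2)

theorem omegaReal_eq (k : ℤ) (φ ψ : ℍ → (Fin n → ℂ) → ℂ) (τ : ℍ)
    (x : (Fin n → ℝ) × (Fin n → ℝ)) : L.omegaReal k φ ψ τ x =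
      φ τ (realPt τ x.1 x.2) * (starRingEnd ℂ) (ψ τ (realPt τ x.1 x.2)) *
        ((τ.im ^ k * Real.exp (-4 * Real.pi * τ.im * L.quad x.1) : ℝ) : ℂ) := by
  have h1 : (fun i => (realPt τ x.1 x.2 i).im) = τ.im • x.1 := by
    ext i; rw [realPt_im]; simp
  rw [omegaReal, omega, h1, quad_smul_field]
  congr 5
  have := τ.im_ne_zero
  field_simp

theorem norm_omegaReal (k : ℤ) (φ ψ : ℍ → (Fin n → ℂ) → ℂ) (τ : ℍ)
    (x : (Fin n → ℝ) × (Fin n → ℝ)) : ‖L.omegaReal k φ ψ τ x‖ =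
      ‖φ τ (realPt τ x.1 x.2)‖ * ‖ψ τ (realPt τ x.1 x.2)‖ *
        (τ.im ^ k * Real.exp (-4 * Real.pi * τ.im * L.quad x.1)) := by
  have := τ.im_pos
  rw [omegaReal_eq, norm_mul, norm_mul, RCLike.norm_conj, Complex.norm_real,
    Real.norm_of_nonneg (by positivity)]

/-- If `φ` is invariant under `A`, then `ω_{φ, ψ|A} = ω_{φ,ψ} ∘ A`. -/
theorem omegaReal_slashSL {k : ℤ} {φ : ℍ → (Fin n → ℂ) → ℂ} {A : SL(2, ℤ)}
    (hφ : L.slashSL k φ A = φ) (ψ : ℍ → (Fin n → ℂ) → ℂ) (τ : ℍ)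
    (x : (Fin n → ℝ) × (Fin n → ℝ)) : L.omegaReal k φ (L.slashSL k ψ A) τ x =
      L.omegaReal k φ ψ (A • τ) (coordAct A x) := by
  obtain ⟨p, q⟩ := x
  have h1 : φ τ (realPt τ p q) = L.slashSL k φ A τ (realPt τ p q) := by rw [hφ]
  rw [omegaReal_eq, omegaReal_eq, h1]
  simp only [slashSL_eq, realPt_smul, coordAct_apply]
  set j := jfac A τ with hj
  have hj0 : j ≠ 0 := jfac_ne_zero A τ
  set E := eFun (-(A 1 0 : ℂ) * L.quad (realPt τ p q) / j) with hE
  set p' := (A 1 1 : ℝ) • p - (A 1 0 : ℝ) • q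
  set z' := realPt (A • τ) p' ((A 0 0 : ℝ) • q - (A 0 1 : ℝ) • p)
  have h2 : (j ^ (-k) * E) * (starRingEnd ℂ) (j ^ (-k) * E) *
      ((τ.im ^ k * Real.exp (-4 * Real.pi * τ.im * L.quad p) : ℝ) : ℂ) =
      (((A • τ).im ^ k * Real.exp (-4 * Real.pi * (A • τ).im * L.quad p') : ℝ) : ℂ) := by
    rw [Complex.mul_conj, ← Complex.ofReal_mul]
    congr 1
    have hN : Complex.normSq j ≠ 0 := by simpa using hj0
    rw [Complex.normSq_mul, Complex.normSq_eq_norm_sq E, hE, L.norm_eFun_automorphy A τ p q,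
      map_zpow₀, im_smul_eq, ← hj, div_zpow, _root_.zpow_neg]
    have h3 : Real.exp (2 * Real.pi * τ.im * L.quad p) ^ 2 *
        Real.exp (-4 * Real.pi * τ.im * L.quad p) = 1 := by
      rw [← Real.exp_nat_mul, ← Real.exp_add, ← Real.exp_zero]; congr 1; push_cast; ring
    have h4 : Real.exp (-2 * Real.pi * (τ.im / Complex.normSq j) * L.quad p') ^ 2 =
        Real.exp (-4 * Real.pi * (τ.im / Complex.normSq j) * L.quad p') := by
      rw [← Real.exp_nat_mul]; congr 1; push_cast; ring
    rw [mul_pow, h4]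
    linear_combination ((Complex.normSq j ^ k)⁻¹ * τ.im ^ k *
      Real.exp (-4 * Real.pi * (τ.im / Complex.normSq j) * L.quad p')) * h3
  rw [← h2]
  simp only [map_mul]
  ring

theorem quad_ratVecReal_add_intVec (a : Fin n → ℤ) (p : Fin n → ℝ) :
    ratVecReal (intVec ℚ a) + p = intVec ℝ a + p := by
  ext i; simp [ratVecReal, intVec]

/-- Invariance under the Heisenberg group makes `ω_{φ,ψ}` periodic in the real coordinates. -/
theorem omegaReal_periodic {k : ℤ} {φ ψ : ℍ → (Fin n → ℂ) → ℂ} {a b : Fin n → ℤ}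
    (hφ : L.slashH φ a b = φ) (hψ : L.slashH ψ a b = ψ) (τ : ℍ)
    (x : (Fin n → ℝ) × (Fin n → ℝ)) : L.omegaReal k φ ψ τ ((intVec ℝ a, intVec ℝ b) + x) =
      L.omegaReal k φ ψ τ x := by
  obtain ⟨p, q⟩ := x
  have hz : realPt τ (intVec ℝ a + p) (intVec ℝ b + q) =
      realPt τ p q + (τ : ℂ) • intVec ℂ a + intVec ℂ b := by
    ext i; simp [realPt, realVec, intVec]; ring
  set E := eFun ((τ : ℂ) * L.quad (intVec ℂ a) + L.bil (intVec ℂ a) (realPt τ p q)) with hE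
  have hEg : ‖E‖ = Real.exp (2 * Real.pi * τ.im * L.quad p) *
      Real.exp (-2 * Real.pi * τ.im * L.quad (intVec ℝ a + p)) := by
    have h := L.norm_gFun_realPt (intVec ℚ a) τ p q
    have h' : ratVec (intVec ℚ a) = intVec ℂ a := by ext i; simp [ratVec, intVec]
    rwa [gFun, h', quad_ratVecReal_add_intVec] at h
  have h1 : ∀ χ : ℍ → (Fin n → ℂ) → ℂ, L.slashH χ a b = χ →
      χ τ (realPt τ p q) = χ τ (realPt τ (intVec ℝ a + p) (intVec ℝ b + q)) * E := by
    intro χ hχ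
    conv_lhs => rw [← hχ]
    rw [hz]; rfl
  rw [omegaReal_eq, omegaReal_eq]
  simp only [Prod.mk_add_mk]
  rw [h1 φ hφ, h1 ψ hψ]
  have h2 : E * (starRingEnd ℂ) E *
      ((τ.im ^ k * Real.exp (-4 * Real.pi * τ.im * L.quad p) : ℝ) : ℂ) =
      ((τ.im ^ k * Real.exp (-4 * Real.pi * τ.im * L.quad (intVec ℝ a + p)) : ℝ) : ℂ) := by
    rw [Complex.mul_conj, ← Complex.ofReal_mul, Complex.normSq_eq_norm_sq, hEg, mul_pow,
      ← Real.exp_nat_mul, ← Real.exp_nat_mul]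
    congr 1
    rw [mul_left_comm, ← Real.exp_add, ← Real.exp_add]
    congr 2
    push_cast
    ring
  rw [← h2, map_mul]
  ring

/-- The integral of `ω_{φ,ψ}(τ, z)` over `z` in the torus `ℂⁿ / (τ ℤⁿ + ℤⁿ)`. -/
noncomputable def torusIntegral (k : ℤ) (φ ψ : ℍ → (Fin n → ℂ) → ℂ) (τ : ℍ) : ℂ :=
  ∫ x in unitBox n, L.omegaReal k φ ψ τ x

theorem IsJacobiForm.slashSL_eq_self {k : ℤ} {φ : ℍ → (Fin n → ℂ) → ℂ} {L : EvenLattice n}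
    (hφ : L.IsJacobiForm k φ) (A : SL(2, ℤ)) : L.slashSL k φ A = φ := by
  have h := hφ.invariant ⟨A, 0, 0⟩
  rwa [slash, slashH_zero] at h

theorem IsJacobiForm.slashH_eq_self {k : ℤ} {φ : ℍ → (Fin n → ℂ) → ℂ} {L : EvenLattice n}
    (hφ : L.IsJacobiForm k φ) (a b : Fin n → ℤ) : L.slashH φ a b = φ := by
  have h := hφ.invariant ⟨1, a, b⟩
  rwa [slash, hφ.slashSL_eq_self] at h

/-- The change of variables `(p, q) ↦ coordAct A (p, q)` reduces the integral to the theta series at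
`A τ`. -/
theorem torusIntegral_fiberSum {k : ℤ} {φ : ℍ → (Fin n → ℂ) → ℂ} (hφ : L.IsJacobiForm k φ)
    (r : L.isotropic) (A : SL(2, ℤ)) (τ : ℍ) :
    ∫ x in unitBox n, L.omegaReal k φ (L.fiberSum k r (SLCosets.mk A)) τ x =
      L.torusIntegral k φ (L.theta r) (A • τ) := by
  rw [fiberSum_eq_slashSL]
  simp only [L.omegaReal_slashSL (hφ.slashSL_eq_self A)]
  exact setIntegral_unitBox_coordAct A fun a b x =>
    L.omegaReal_periodic (hφ.slashH_eq_self a b) (L.slashH_theta r a b) (A • τ) x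

theorem torusIntegral_T_zpow {k : ℤ} {φ : ℍ → (Fin n → ℂ) → ℂ} (hφ : L.IsJacobiForm k φ)
    (r : L.isotropic) (m : ℤ) (τ : ℍ) : L.torusIntegral k φ (L.theta r) (ModularGroup.T ^ m • τ) =
      L.torusIntegral k φ (L.theta r) τ := by
  have h : SLCosets.mk (ModularGroup.T ^ m) = SLCosets.mk 1 := by
    rw [SLCosets.mk_eq_iff]; simp [ModularGroup.coe_T_zpow]
  rw [← L.torusIntegral_fiberSum hφ r, h, L.torusIntegral_fiberSum hφ r, one_smul]

theorem continuous_of_differentiableOn {φ : ℍ → (Fin n → ℂ) → ℂ}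
    (h : DifferentiableOn ℂ (fun w : ℂ × (Fin n → ℂ) => φ (ofComplex w.1) w.2)
      {w | 0 < w.1.im}) : Continuous fun w : ℍ × (Fin n → ℂ) => φ w.1 w.2 := by
  have h1 := h.continuousOn.comp_continuous
    (f := fun w : ℍ × (Fin n → ℂ) => ((w.1 : ℂ), w.2))
    ((continuous_coe.comp continuous_fst).prodMk continuous_snd) fun w => w.1.im_pos
  simpa only [Function.comp_def, ofComplex_apply] using h1

theorem continuous_omegaReal (k : ℤ) {φ ψ : ℍ → (Fin n → ℂ) → ℂ}
    (hφ : Continuous fun w : ℍ × (Fin n → ℂ) => φ w.1 w.2)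
    (hψ : Continuous fun w : ℍ × (Fin n → ℂ) => ψ w.1 w.2) :
    Continuous fun w : ℍ × ((Fin n → ℝ) × (Fin n → ℝ)) => L.omegaReal k φ ψ w.1 w.2 := by
  simp only [omegaReal_eq]
  have hz : Continuous fun w : ℍ × ((Fin n → ℝ) × (Fin n → ℝ)) =>
      (w.1, realPt w.1 w.2.1 w.2.2) := continuous_fst.prodMk continuous_realPt
  have hi : Continuous fun w : ℍ × ((Fin n → ℝ) × (Fin n → ℝ)) => w.1.im :=
    continuous_im.comp continuous_fst
  refine ((hφ.comp hz).mul (Complex.continuous_conj.comp (hψ.comp hz))).mul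
    (Complex.continuous_ofReal.comp ?_)
  refine (hi.zpow₀ k fun w => Or.inl w.1.im_ne_zero).mul (Real.continuous_exp.comp ?_)
  exact (continuous_const.mul hi).mul (L.continuous_quad_real.comp (continuous_fst.comp continuous_snd))

/-- A summable majorant of the products of a cusp form with the partial sums of the Eisenstein
series, on the whole fundamental domain. -/
theorem exists_omegaReal_bound {k : ℤ} (hk : (n : ℚ) / 2 + 2 < k) (r : L.isotropic)
    {φ : ℍ → (Fin n → ℂ) → ℂ} (hφ : L.IsCuspForm k φ) : ∃ u : SLCosets → ℝ, Summable u ∧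
      ∀ q, ∀ τ ∈ 𝒟, ∀ x ∈ unitBox n, ‖L.omegaReal k φ (L.fiberSum k r q) τ x‖ ≤ u q := by
  have hα := rank_div_two_add_two_lt hk
  set α : ℝ := (k : ℝ) - n / 2 with hαd
  have hk0 := weight_pos hk
  obtain ⟨C₁, δ, hC₁, hδ, h₁⟩ := L.exists_cusp_bound hφ
  obtain ⟨C₂, hC₂, h₂⟩ := L.exists_norm_fiberSum_le k hk0.le
  obtain ⟨C₃, hC₃, h₃⟩ := L.exists_absTheta_bound (B := 1 / 2) (by norm_num)
  have hB : (0 : ℝ) < 1 / 2 := by norm_num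
  set ρ := EisensteinSeries.r ⟨⟨1 / 2, 1 / 2⟩, hB⟩ with hρ
  have hρ0 : 0 < ρ := EisensteinSeries.r_pos _
  set M : ℝ := ((k : ℝ) / δ) ^ (k : ℝ) with hM
  refine ⟨fun q => C₁ * C₂ * ρ ^ (-α) * C₃ * M * ‖q.row‖ ^ (-α),
    (summable_row_norm hα).mul_left _, ?_⟩
  rintro q τ hτ ⟨p, y⟩ hx
  have hv0 := τ.im_pos
  have hv : 1 / 2 ≤ τ.im := by
    nlinarith [ModularGroup.three_le_four_mul_im_sq_of_mem_fd hτ]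
  have e1 := h₁ τ p y hv fun i => ⟨(hx i).1.1, (hx i).1.2.le⟩
  have e2 := h₂ r q.out τ (realPt τ p y)
  rw [q.mk_out] at e2
  have e3 := h₃ τ (realPt τ p y) hv
  rw [coordP_realPt] at e3
  have e4 := jfac_rpow_le (by linarith : 0 ≤ α) q.out τ
  have e5 : EisensteinSeries.r τ ^ (-α) ≤ ρ ^ (-α) :=
    Real.rpow_le_rpow_of_nonpos hρ0
      (EisensteinSeries.r_lower_bound_on_verticalStrip τ hB ⟨hτ.2, hv⟩) (by linarith)
  have e6 : τ.im ^ k * Real.exp (-δ * τ.im) ≤ M := by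
    rw [← Real.rpow_intCast]
    exact rpow_mul_exp_neg_le (by exact_mod_cast hk0) hδ hv0.le
  have e7 : ‖jfac q.out τ‖ ^ (-α) ≤ ρ ^ (-α) * ‖q.row‖ ^ (-α) :=
    e4.trans (mul_le_mul_of_nonneg_right e5 (by positivity))
  -- The growth of `φ` and of the partial sum in `p` is cancelled by the weight
  -- `exp(-4π β(y) / v) = exp(-4π v β(p))`.
  have hexp : Real.exp (2 * Real.pi * τ.im * L.quad p) * Real.exp (2 * Real.pi * τ.im * L.quad p) *
      Real.exp (-4 * Real.pi * τ.im * L.quad p) = 1 := by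
    rw [← Real.exp_add, ← Real.exp_add, ← Real.exp_zero]; congr 1; ring
  rw [norm_omegaReal]
  set X := Real.exp (2 * Real.pi * τ.im * L.quad p)
  set Y := Real.exp (-4 * Real.pi * τ.im * L.quad p)
  have h0 := L.absTheta_nonneg τ (realPt τ p y)
  calc ‖φ τ (realPt τ p y)‖ * ‖L.fiberSum k r q τ (realPt τ p y)‖ * (τ.im ^ k * Y)
      ≤ (C₁ * Real.exp (-δ * τ.im) * X) *
          (C₂ * (ρ ^ (-α) * ‖q.row‖ ^ (-α)) * (C₃ * X)) * (τ.im ^ k * Y) := by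
        have e8 : C₂ * ‖jfac q.out τ‖ ^ (-α) * L.absTheta τ (realPt τ p y) ≤
            C₂ * (ρ ^ (-α) * ‖q.row‖ ^ (-α)) * (C₃ * X) := by gcongr
        exact mul_le_mul_of_nonneg_right (mul_le_mul e1 (e2.trans e8) (norm_nonneg _)
          (by positivity)) (by positivity)
    _ = C₁ * C₂ * ρ ^ (-α) * C₃ * (τ.im ^ k * Real.exp (-δ * τ.im)) * ‖q.row‖ ^ (-α) *
          (X * X * Y) := by ring
    _ ≤ _ := by
        rw [hexp, mul_one]
        exact mul_le_mul_of_nonneg_right (mul_le_mul_of_nonneg_left e6 (by positivity))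
          (by positivity)

/-- The integral of `ω_{φ,E}` over the fundamental domain converges absolutely and unfolds to an
absolutely convergent integral over the strip. -/
theorem integral_omegaReal_eisenstein {k : ℤ} (hk : (n : ℚ) / 2 + 2 < k) (r : L.isotropic)
    {φ : ℍ → (Fin n → ℂ) → ℂ} (hφ : L.IsCuspForm k φ) :
    IntegrableOn (fun w : ℍ × ((Fin n → ℝ) × (Fin n → ℝ)) =>
      L.omegaReal k φ (L.eisenstein k r) w.1 w.2) (𝒟 ×ˢ unitBox n) ∧
    IntegrableOn (L.torusIntegral k φ (L.theta r)) {τ : ℍ | τ.re ∈ Set.Ico (0 : ℝ) 1} ∧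
    ∫ w in 𝒟 ×ˢ unitBox n, L.omegaReal k φ (L.eisenstein k r) w.1 w.2 =
      ∫ τ in {τ : ℍ | τ.re ∈ Set.Ico (0 : ℝ) 1}, L.torusIntegral k φ (L.theta r) τ := by
  obtain ⟨u, hu, hbound⟩ := L.exists_omegaReal_bound hk r hφ
  have hφc := continuous_of_differentiableOn hφ.holomorphic
  have hEc := continuous_of_differentiableOn (L.differentiable_eisenstein hk r)
  have hFc := fun q => continuous_of_differentiableOn (L.differentiable_fiberSum hk r q)
  have hQm := measurableSet_unitBox n
  have hDQ : MeasurableSet ((𝒟 : Set ℍ) ×ˢ unitBox n) := measurableSet_fd.prod hQm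
  have hfin : volume ((𝒟 : Set ℍ) ×ˢ unitBox n) < ⊤ := by
    rw [Measure.volume_eq_prod, Measure.prod_prod, volume_unitBox, mul_one]
    exact volume_fd_lt_top
  have hFint : ∀ q, IntegrableOn (fun w : ℍ × ((Fin n → ℝ) × (Fin n → ℝ)) =>
      L.omegaReal k φ (L.fiberSum k r q) w.1 w.2) (𝒟 ×ˢ unitBox n) := fun q =>
    Measure.integrableOn_of_bounded hfin.ne
      (L.continuous_omegaReal k hφc (hFc q)).aestronglyMeasurable
      ((ae_restrict_iff' hDQ).mpr (Filter.Eventually.of_forall fun w hw =>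
        hbound q w.1 hw.1 w.2 hw.2))
  have hnorm : ∀ q, ∫ w in (𝒟 : Set ℍ) ×ˢ unitBox n, ‖L.omegaReal k φ (L.fiberSum k r q) w.1 w.2‖ ≤
      u q * volume.real ((𝒟 : Set ℍ) ×ˢ unitBox n) := by
    intro q
    have := norm_setIntegral_le_of_norm_le_const (μ := volume) hfin
      (f := fun w : ℍ × ((Fin n → ℝ) × (Fin n → ℝ)) =>
        ‖L.omegaReal k φ (L.fiberSum k r q) w.1 w.2‖) (C := u q)
      fun w hw => by rw [norm_norm]; exact hbound q w.1 hw.1 w.2 hw.2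
    rwa [Real.norm_of_nonneg (integral_nonneg fun w => norm_nonneg _)] at this
  have hsum : Summable fun q =>
      ∫ w in (𝒟 : Set ℍ) ×ˢ unitBox n, ‖L.omegaReal k φ (L.fiberSum k r q) w.1 w.2‖ :=
    Summable.of_nonneg_of_le (fun q => integral_nonneg fun w => norm_nonneg _) hnorm
      (hu.mul_right _)
  have hpoint : ∀ w : ℍ × ((Fin n → ℝ) × (Fin n → ℝ)),
      ∑' q, L.omegaReal k φ (L.fiberSum k r q) w.1 w.2 =
        2 * L.omegaReal k φ (L.eisenstein k r) w.1 w.2 := by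
    intro w
    simp only [omegaReal_eq]
    rw [tsum_mul_right, tsum_mul_left, ← Complex.conj_tsum, ← two_mul_eisenstein, map_mul, map_ofNat]
    ring
  have h1 := hasSum_integral_of_summable_integral_norm hFint hsum
  simp only [hpoint] at h1
  rw [integral_const_mul] at h1
  -- the inner integrals over the torus
  have hinner : ∀ q (τ : ℍ), ∫ x in unitBox n, L.omegaReal k φ (L.fiberSum k r q) τ x =
      L.torusIntegral k φ (L.theta r) (q.out • τ) := by
    intro q τ
    rw [← L.torusIntegral_fiberSum hφ.toIsJacobiForm r, q.mk_out]
  have hFint' : ∀ q, Integrable (fun w : ℍ × ((Fin n → ℝ) × (Fin n → ℝ)) =>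
      L.omegaReal k φ (L.fiberSum k r q) w.1 w.2)
      ((volume.restrict 𝒟).prod (volume.restrict (unitBox n))) := by
    intro q
    rw [Measure.prod_restrict, ← Measure.volume_eq_prod]; exact hFint q
  have hfub : ∀ q, ∫ w in 𝒟 ×ˢ unitBox n, L.omegaReal k φ (L.fiberSum k r q) w.1 w.2 =
      ∫ τ in 𝒟, L.torusIntegral k φ (L.theta r) (q.out • τ) := by
    intro q
    rw [Measure.volume_eq_prod, ← Measure.prod_restrict, integral_prod _ (hFint' q)]
    simp only [hinner]
  have hint : ∀ q : SLCosets,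
      IntegrableOn (fun τ => L.torusIntegral k φ (L.theta r) (q.out • τ)) 𝒟 := by
    intro q
    have := (hFint' q).integral_prod_left
    simp only [hinner] at this
    exact this
  have hsum' : Summable fun q : SLCosets =>
      ∫ τ in 𝒟, ‖L.torusIntegral k φ (L.theta r) (q.out • τ)‖ := by
    refine Summable.of_nonneg_of_le (fun q => integral_nonneg fun w => norm_nonneg _)
      (fun q => ?_) hsum
    rw [Measure.volume_eq_prod, ← Measure.prod_restrict, integral_prod _ (hFint' q).norm]
    refine integral_mono (hint q).norm (hFint' q).norm.integral_prod_left fun τ => ?_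
    change ‖_‖ ≤ _
    rw [← hinner]
    exact norm_integral_le_integral_norm _
  have h2 := hasSum_setIntegral_fd (L.torusIntegral_T_zpow hφ.toIsJacobiForm r) hint hsum'
  simp only [hfub] at h1
  refine ⟨?_, h2.1, mul_left_cancel₀ two_ne_zero (h1.unique h2.2)⟩
  refine Measure.integrableOn_of_bounded (M := 1 / 2 * ∑' q, u q) hfin.ne
    (L.continuous_omegaReal k hφc hEc).aestronglyMeasurable
    ((ae_restrict_iff' hDQ).mpr (Filter.Eventually.of_forall fun w hw => ?_))
  have h3 := tsum_of_norm_bounded hu.hasSum fun q => hbound q w.1 hw.1 w.2 hw.2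
  rw [hpoint, norm_mul, RCLike.norm_ofNat] at h3
  linarith

end EvenLattice

/-! ### Vanishing of the unfolded integral -/

theorem setIntegral_eFun_int {m : ℤ} (hm : m ≠ 0) :
    ∫ u in Set.Ico (0 : ℝ) 1, eFun ((m : ℝ) * u) = 0 := by
  have hc : 2 * Real.pi * Complex.I * m ≠ 0 := by
    simp [Complex.I_ne_zero, Real.pi_ne_zero, hm]
  rw [integral_Ico_eq_integral_Ioc, ← intervalIntegral.integral_of_le zero_le_one]
  have h := integral_exp_mul_complex (a := 0) (b := 1) hc
  have h1 : Complex.exp (2 * Real.pi * Complex.I * m) = 1 :=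
    Complex.exp_eq_one_iff.mpr ⟨m, by ring⟩
  simp only [Complex.ofReal_one, mul_one, Complex.ofReal_zero, mul_zero, Complex.exp_zero, h1,
    sub_self, zero_div] at h
  rw [← h]
  congr 1
  ext u
  rw [eFun]
  congr 1
  push_cast
  ring

theorem setIntegral_unitCube_eFun {n : ℕ} (b : Fin n → ℝ)
    (hb : ∃ j, ∃ m : ℤ, m ≠ 0 ∧ b j = m) :
    ∫ q in unitCube n, eFun ((∑ j, b j * q j : ℝ) : ℂ) = 0 := by
  obtain ⟨j, m, hm, hj⟩ := hb
  rw [unitCube, volume_pi, Measure.restrict_pi_pi]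
  have h : ∀ q : Fin n → ℝ, eFun ((∑ j, b j * q j : ℝ) : ℂ) = ∏ j, eFun ((b j : ℂ) * (q j : ℝ)) := by
    intro q; rw [← eFun_sum]; push_cast; rfl
  simp only [h]
  rw [integral_fintype_prod_eq_prod (fun j (x : ℝ) => eFun ((b j : ℂ) * x))]
  refine Finset.prod_eq_zero (Finset.mem_univ j) ?_
  rw [hj]
  exact setIntegral_eFun_int hm

theorem integrableOn_box {n : ℕ} {F : (Fin n → ℝ) × ℝ → ℂ} (hF : Continuous F) :
    Integrable F ((volume.restrict (unitCube n)).prod (volume.restrict (Set.Ico (0 : ℝ) 1))) := by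
  rw [Measure.prod_restrict, ← Measure.volume_eq_prod]
  refine (hF.integrableOn_Icc (a := (0, 0)) (b := (1, 1))).mono_set ?_
  rintro ⟨q, u⟩ ⟨hq, hu⟩
  exact ⟨⟨fun i => (hq i trivial).1, hu.1⟩, ⟨fun i => (hq i trivial).2.le, hu.2.le⟩⟩

/-- Term by term integration of an absolutely convergent trigonometric series over a unit cube. -/
theorem integral_trigonometric_series_eq_zero {n : ℕ} {ι : Type*} [Countable ι] {K : ι → ℂ}
    (hK : Summable fun i => ‖K i‖) (a : ι → ℝ) (b : ι → Fin n → ℝ)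
    (h0 : ∀ i, K i = 0 ∨ (∃ m : ℤ, m ≠ 0 ∧ a i = m) ∨ ∃ j, ∃ m : ℤ, m ≠ 0 ∧ b i j = m) :
    ∫ q in unitCube n, ∫ u in Set.Ico (0 : ℝ) 1, ∑' i,
      K i * (eFun ((∑ j, b i j * q j : ℝ) : ℂ) * eFun ((a i : ℂ) * (u : ℝ))) = 0 := by
  set T : ι → (Fin n → ℝ) × ℝ → ℂ := fun i w =>
    K i * (eFun ((∑ j, b i j * w.1 j : ℝ) : ℂ) * eFun ((a i : ℂ) * (w.2 : ℝ))) with hT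
  have hTc : ∀ i, Continuous (T i) := by
    intro i
    have h1 : Continuous fun w : (Fin n → ℝ) × ℝ => ((∑ j, b i j * w.1 j : ℝ) : ℂ) := by fun_prop
    have h2 : Continuous fun w : (Fin n → ℝ) × ℝ => (a i : ℂ) * (w.2 : ℝ) := by fun_prop
    exact continuous_const.mul ((continuous_eFun.comp h1).mul (continuous_eFun.comp h2))
  have hTn : ∀ i w, ‖T i w‖ = ‖K i‖ := by
    intro i w
    rw [hT]
    dsimp only
    rw [norm_mul, norm_mul, norm_eFun_ofReal, ← Complex.ofReal_mul, norm_eFun_ofReal, mul_one,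
      mul_one]
  have hsumc : Continuous fun w => ∑' i, T i w := continuous_tsum hTc hK fun i w => (hTn i w).le
  have h1 := integral_prod _ (integrableOn_box hsumc)
  refine h1.symm.trans ?_
  have h2 := hasSum_integral_of_summable_integral_norm (fun i => integrableOn_box (hTc i)) (by
    simp only [hTn, integral_const, smul_eq_mul]
    exact hK.mul_left _)
  refine h2.unique ?_
  have h3 : ∀ i, ∫ w, T i w ∂((volume.restrict (unitCube n)).prod
      (volume.restrict (Set.Ico (0 : ℝ) 1))) = 0 := by
    intro i
    rw [hT]
    dsimp only
    rw [integral_const_mul, integral_prod_mul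
      (fun q : Fin n → ℝ => eFun ((∑ j, b i j * q j : ℝ) : ℂ)) (fun u : ℝ => eFun ((a i : ℂ) * u))]
    rcases h0 i with h | ⟨m, hm, ha⟩ | h
    · rw [h, zero_mul]
    · rw [ha, Complex.ofReal_intCast, show ((m : ℂ)) = ((m : ℝ) : ℂ) by simp,
        setIntegral_eFun_int hm, mul_zero, mul_zero]
    · rw [setIntegral_unitCube_eFun _ h, zero_mul, mul_zero]
  simp only [h3]
  exact hasSum_zero

/-- The point `u + iv` of the upper half-plane. -/
def mkPoint {v : ℝ} (hv : 0 < v) (u : ℝ) : ℍ := ⟨⟨u, v⟩, hv⟩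

theorem mkPoint_coe {v : ℝ} (hv : 0 < v) (u : ℝ) : (mkPoint hv u : ℂ) = u + v * Complex.I :=
  Complex.mk_eq_add_mul_I u v

theorem mkPoint_im {v : ℝ} (hv : 0 < v) (u : ℝ) : (mkPoint hv u).im = v := rfl

theorem continuous_mkPoint {v : ℝ} (hv : 0 < v) : Continuous (mkPoint hv) := by
  rw [isEmbedding_coe.continuous_iff]
  have : (UpperHalfPlane.coe ∘ mkPoint hv) = fun u : ℝ => (u : ℂ) + v * Complex.I :=
    funext (mkPoint_coe hv)
  rw [this]
  fun_prop

namespace EvenLattice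

variable {n : ℕ} (L : EvenLattice n)

/-- On a horizontal line, `e(aτ + β(s, pτ + q))` is a constant times a character of `(q, u)`. -/
theorem eFun_mkPoint {v : ℝ} (hv : 0 < v) (a : ℝ) (s : Fin n → ℚ) (p q : Fin n → ℝ) (u : ℝ) :
    eFun ((a : ℂ) * mkPoint hv u + L.bil (ratVec s) (realPt (mkPoint hv u) p q)) =
      eFun ((a : ℂ) * mkPoint hv 0 + L.bil (ratVec s) (realPt (mkPoint hv 0) p 0)) *
        (eFun ((L.bil (ratVecReal s) q : ℝ) : ℂ) *
          eFun (((a + L.bil (ratVecReal s) p : ℝ) : ℂ) * (u : ℝ))) := by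
  rw [← eFun_add, ← eFun_add]
  congr 1
  have h0 : L.bil (ratVecReal s) (0 : Fin n → ℝ) = 0 := by simp [bil]
  simp only [ratVec_eq_realVec, realPt, bil_add_right, bil_smul_right, bil_realVec, mkPoint_coe, h0]
  push_cast
  ring

theorem isotropic_shift_quad (r : L.isotropic) (l : Fin n → ℤ) :
    ∃ N : ℤ, L.quad ((r : Fin n → ℚ) + intVec ℚ l) = N := (L.isotropic_add r.2 l).2

/-- The difference of two dual vectors pairs with `ℝⁿ` through an integral vector, which is
nonzero if the vectors differ. -/
theorem exists_bil_sub_eq {s t : Fin n → ℚ} (hs : s ∈ L.dual) (ht : t ∈ L.dual) :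
    ∃ a : Fin n → ℤ, (∀ q : Fin n → ℝ, L.bil (ratVecReal s) q - L.bil (ratVecReal t) q =
      ∑ j, (a j : ℝ) * q j) ∧ (a = 0 → s = t) := by
  obtain ⟨x, hx⟩ := L.dualEquiv.surjective ⟨s, hs⟩
  obtain ⟨y, hy⟩ := L.dualEquiv.surjective ⟨t, ht⟩
  have hx' : s = L.dualVec x := by
    have := congrArg Subtype.val hx; simpa using this.symm
  have hy' : t = L.dualVec y := by
    have := congrArg Subtype.val hy; simpa using this.symm
  refine ⟨x - y, fun q => ?_, fun h => by rw [hx', hy', sub_eq_zero.mp h]⟩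
  have e1 := L.bil_real_dualVec x q
  have e2 := L.bil_real_dualVec y q
  rw [← hx'] at e1
  rw [← hy'] at e2
  change L.bil (fun i => (s i : ℝ)) q - L.bil (fun i => (t i : ℝ)) q = _
  rw [e1, e2, ← sub_dotProduct]
  simp [dotProduct, intVec]

/-- On a horizontal line, the integral over `u` and `q` of a cusp form against the theta series
vanishes: the `q`-integral isolates the exponents `s ∈ r + L`, and for those the `u`-integral
isolates the singular exponents, where the coefficients of the cusp form are zero. -/
theorem integral_horizontal_eq_zero {k : ℤ} {φ : ℍ → (Fin n → ℂ) → ℂ} (hφ : L.IsCuspForm k φ)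
    (r : L.isotropic) {v : ℝ} (hv : 0 < v) (p : Fin n → ℝ) :
    ∫ q in unitCube n, ∫ u in Set.Ico (0 : ℝ) 1,
      φ (mkPoint hv u) (realPt (mkPoint hv u) p q) *
        (starRingEnd ℂ) (L.theta r (mkPoint hv u) (realPt (mkPoint hv u) p q)) = 0 := by
  obtain ⟨c, hc, hcusp⟩ := hφ.cusp
  set ι := {x : ℤ × (Fin n → ℚ) // x.2 ∈ L.dual ∧ L.quad x.2 ≤ x.1}
  set t : (Fin n → ℤ) → (Fin n → ℚ) := fun l => (r : Fin n → ℚ) + intVec ℚ l with ht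
  have htd : ∀ l, t l ∈ L.dual := fun l => (L.isotropic_add r.2 l).1
  set f : ι → ℝ → (Fin n → ℝ) → ℂ := fun x u q => c x.1.1 x.1.2 *
    eFun ((x.1.1 : ℂ) * mkPoint hv u + L.bil (ratVec x.1.2) (realPt (mkPoint hv u) p q)) with hf
  set g : (Fin n → ℤ) → ℝ → (Fin n → ℝ) → ℂ := fun l u q =>
    L.gFun (t l) (mkPoint hv u) (realPt (mkPoint hv u) p q) with hg
  have hfs : ∀ u q, HasSum (fun x => f x u q) (φ (mkPoint hv u) (realPt (mkPoint hv u) p q)) :=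
    fun u q => hc _ _
  have hgs : ∀ u q, Summable fun l => ‖g l u q‖ := fun u q => L.summable_norm_gFun_shift r.2.1 _ _
  have hfe : ∀ x u q, f x u q = f x 0 0 * (eFun ((L.bil (ratVecReal x.1.2) q : ℝ) : ℂ) *
      eFun ((((x.1.1 : ℝ) + L.bil (ratVecReal x.1.2) p : ℝ) : ℂ) * (u : ℝ))) := by
    intro x u q
    have := L.eFun_mkPoint hv (x.1.1 : ℝ) x.1.2 p q u
    rw [Complex.ofReal_intCast] at this
    simp only [hf]
    rw [this]
    ring
  have hge : ∀ l u q, g l u q = g l 0 0 * (eFun ((L.bil (ratVecReal (t l)) q : ℝ) : ℂ) *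
      eFun (((((L.quad (t l) : ℚ) : ℝ) + L.bil (ratVecReal (t l)) p : ℝ) : ℂ) * (u : ℝ))) := by
    intro l u q
    have := L.eFun_mkPoint hv ((L.quad (t l) : ℚ) : ℝ) (t l) p q u
    simp only [hg, gFun, quad_ratVec]
    rw [mul_comm _ ((L.quad (t l) : ℚ) : ℂ), mul_comm _ ((L.quad (t l) : ℚ) : ℂ)]
    rw [Complex.ofReal_ratCast] at this
    exact this
  -- `K i` is the coefficient of the product at the pair of exponents `i`.
  set K : ι × (Fin n → ℤ) → ℂ := fun i => f i.1 0 0 * (starRingEnd ℂ) (g i.2 0 0) with hK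
  have hgs' : ∀ u q, Summable fun l => ‖(starRingEnd ℂ) (g l u q)‖ := fun u q =>
    (hgs u q).congr fun l => (RCLike.norm_conj _).symm
  have hKs : Summable fun i => ‖K i‖ :=
    Summable.mul_norm (f := fun x => f x 0 0) (g := fun l => (starRingEnd ℂ) (g l 0 0))
      (hfs 0 0).summable.norm (hgs' 0 0)
  have hdiff : ∀ i : ι × (Fin n → ℤ), ∃ a : Fin n → ℤ, (∀ q : Fin n → ℝ,
      L.bil (ratVecReal i.1.1.2) q - L.bil (ratVecReal (t i.2)) q = ∑ j, (a j : ℝ) * q j) ∧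
      (a = 0 → i.1.1.2 = t i.2) := fun i => L.exists_bil_sub_eq i.1.2.1 (htd i.2)
  choose b hb hb0 using hdiff
  set a : ι × (Fin n → ℤ) → ℝ := fun i => ((i.1.1.1 : ℝ) + L.bil (ratVecReal i.1.1.2) p) -
    (((L.quad (t i.2) : ℚ) : ℝ) + L.bil (ratVecReal (t i.2)) p) with ha
  have hprod : ∀ u q, φ (mkPoint hv u) (realPt (mkPoint hv u) p q) *
      (starRingEnd ℂ) (L.theta r (mkPoint hv u) (realPt (mkPoint hv u) p q)) =
      ∑' i, K i * (eFun ((∑ j, (b i j : ℝ) * q j : ℝ) : ℂ) * eFun ((a i : ℂ) * (u : ℝ))) := by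
    intro u q
    have h1 : (starRingEnd ℂ) (L.theta r (mkPoint hv u) (realPt (mkPoint hv u) p q)) =
        ∑' l, (starRingEnd ℂ) (g l u q) := by rw [← Complex.conj_tsum]; rfl
    rw [← (hfs u q).tsum_eq, h1, tsum_mul_tsum_of_summable_norm (hfs u q).summable.norm (hgs' u q)]
    refine tsum_congr fun i => ?_
    rw [hfe, hge, ← hb i q, hK, ha]
    simp only [map_mul]
    rw [conj_eFun, conj_eFun]
    have e1 : eFun ((L.bil (ratVecReal i.1.1.2) q - L.bil (ratVecReal (t i.2)) q : ℝ) : ℂ) =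
        eFun ((L.bil (ratVecReal i.1.1.2) q : ℝ) : ℂ) *
          eFun (-(starRingEnd ℂ) ((L.bil (ratVecReal (t i.2)) q : ℝ) : ℂ)) := by
      rw [← eFun_add, Complex.conj_ofReal]; congr 1; push_cast; ring
    rw [e1, ← Complex.ofReal_mul, ← Complex.ofReal_mul, ← Complex.ofReal_mul, Complex.conj_ofReal,
      Complex.conj_ofReal, sub_mul, Complex.ofReal_sub, sub_eq_add_neg, eFun_add]
    ring
  have h0 : ∀ i, K i = 0 ∨ (∃ m : ℤ, m ≠ 0 ∧ a i = m) ∨ ∃ j, ∃ m : ℤ, m ≠ 0 ∧ (b i j : ℝ) = m := by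
    intro i
    by_cases hbi : b i = 0
    · have hst : i.1.1.2 = t i.2 := hb0 _ hbi
      obtain ⟨N, hN⟩ := L.isotropic_shift_quad r i.2
      by_cases hmN : i.1.1.1 = N
      · left
        have h0 : c i.1.1.1 i.1.1.2 = 0 := hcusp _ i.1.2.1 _ (by rw [hst, hmN]; exact hN)
        have h1 : f i.1 0 0 = 0 := mul_eq_zero_of_left h0 _
        exact mul_eq_zero_of_left h1 _
      · right; left
        refine ⟨i.1.1.1 - N, sub_ne_zero.mpr hmN, ?_⟩
        simp only [ha]
        rw [hst, show L.quad (t i.2) = (N : ℚ) from hN]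
        push_cast
        ring
    · right; right
      obtain ⟨j, hj⟩ := Function.ne_iff.mp hbi
      exact ⟨j, _, hj, rfl⟩
  clear_value K a
  have hfin := integral_trigonometric_series_eq_zero hKs a (fun i j => (b i j : ℝ)) h0
  simp only [hprod]
  exact hfin

theorem continuous_theta {k : ℤ} (hk : (n : ℚ) / 2 + 2 < k) (r : L.isotropic) :
    Continuous fun w : ℍ × (Fin n → ℂ) => L.theta r w.1 w.2 := by
  have h := continuous_of_differentiableOn (L.differentiable_fiberSum hk r (SLCosets.mk 1))
  have h1 : L.fiberSum k r (SLCosets.mk 1) = L.theta r := by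
    funext τ z; rw [fiberSum_one]; rfl
  rwa [h1] at h

/-- After Fubini, the integrals over `q` and `u` are taken first. -/
theorem integral_torusIntegral_horizontal {k : ℤ} (hk : (n : ℚ) / 2 + 2 < k)
    {φ : ℍ → (Fin n → ℂ) → ℂ} (hφ : L.IsCuspForm k φ) (r : L.isotropic) {v : ℝ} (hv : 0 < v) :
    ∫ u in Set.Ico (0 : ℝ) 1, L.torusIntegral k φ (L.theta r) (mkPoint hv u) = 0 := by
  have hc : Continuous fun w : ℝ × ((Fin n → ℝ) × (Fin n → ℝ)) =>
      L.omegaReal k φ (L.theta r) (mkPoint hv w.1) w.2 :=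
    (L.continuous_omegaReal k (continuous_of_differentiableOn hφ.holomorphic)
      (L.continuous_theta hk r)).comp
      (((continuous_mkPoint hv).comp continuous_fst).prodMk continuous_snd)
  have hint : Integrable (Function.uncurry fun (u : ℝ) (x : (Fin n → ℝ) × (Fin n → ℝ)) =>
      L.omegaReal k φ (L.theta r) (mkPoint hv u) x)
      ((volume.restrict (Set.Ico (0 : ℝ) 1)).prod (volume.restrict (unitBox n))) := by
    rw [Measure.prod_restrict, ← Measure.volume_eq_prod]
    refine (hc.integrableOn_Icc (a := (0, 0, 0)) (b := (1, 1, 1))).mono_set ?_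
    rintro ⟨u, p, q⟩ ⟨hu, hx⟩
    exact ⟨⟨hu.1, fun i => (hx i).1.1, fun i => (hx i).2.1⟩,
      ⟨hu.2.le, fun i => (hx i).1.2.le, fun i => (hx i).2.2.le⟩⟩
  simp only [torusIntegral]
  rw [integral_integral_swap hint]
  have hint' := hint.integral_prod_right
  rw [unitBox_eq_prod, Measure.volume_eq_prod, ← Measure.prod_restrict] at hint' ⊢
  simp only [Function.uncurry_apply_pair] at hint'
  rw [integral_prod _ hint']
  refine integral_eq_zero_of_ae (Filter.Eventually.of_forall fun p => ?_)
  simp only [omegaReal_eq, mkPoint_im, integral_mul_const]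
  rw [L.integral_horizontal_eq_zero hφ r hv p, zero_mul]
  rfl

/-- Fubini on the strip, with the integral over `u` first. -/
theorem integral_torusIntegral_strip {k : ℤ} (hk : (n : ℚ) / 2 + 2 < k)
    {φ : ℍ → (Fin n → ℂ) → ℂ} (hφ : L.IsCuspForm k φ) (r : L.isotropic)
    (hi : IntegrableOn (L.torusIntegral k φ (L.theta r)) {τ : ℍ | τ.re ∈ Set.Ico (0 : ℝ) 1}) :
    ∫ τ in {τ : ℍ | τ.re ∈ Set.Ico (0 : ℝ) 1}, L.torusIntegral k φ (L.theta r) τ = 0 := by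
  set f := L.torusIntegral k φ (L.theta r)
  set g : ℝ × ℝ → ℂ := fun x => f (ofComplex ⟨x.1, x.2⟩) with hg
  have hfg : ∀ τ : ℍ, f τ = g (τ.re, τ.im) := by
    intro τ
    have : (⟨τ.re, τ.im⟩ : ℂ) = (τ : ℂ) := Complex.ext rfl rfl
    simp only [hg]
    rw [this, ofComplex_apply]
  have hemb : MeasurableEmbedding fun τ : ℍ => (τ.re, τ.im) :=
    Complex.measurableEquivRealProd.measurableEmbedding.comp measurableEmbedding_coe
  have h1 := measurePreserving_re_im.setIntegral_preimage_emb hemb g (Set.Ico 0 1 ×ˢ Set.univ)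
  have hset : (fun τ : ℍ => (τ.re, τ.im)) ⁻¹' (Set.Ico 0 1 ×ˢ Set.univ) =
      {τ : ℍ | τ.re ∈ Set.Ico (0 : ℝ) 1} := by
    ext τ; simp
  have hS : MeasurableSet (Set.Ico (0 : ℝ) 1 ×ˢ (Set.univ : Set ℝ)) :=
    measurableSet_Ico.prod MeasurableSet.univ
  have hd : Measurable fun x : ℝ × ℝ => (1 / ‖x.2‖₊) ^ 2 := by fun_prop
  rw [hset] at h1
  have hint : Integrable (fun x : ℝ × ℝ => (1 / ‖x.2‖₊) ^ 2 • g x)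
      ((volume.restrict (Set.Ico (0 : ℝ) 1)).prod (volume.restrict (Set.Ioi (0 : ℝ)))) := by
    have h3 := (measurePreserving_re_im.integrableOn_comp_preimage hemb (f := g)
      (s := Set.Ico 0 1 ×ˢ Set.univ)).mp (by
        rw [hset]; exact hi.congr_fun (fun τ _ => hfg τ) (continuous_re.measurable measurableSet_Ico))
    rw [IntegrableOn, restrict_withDensity hS, integrable_withDensity_iff_integrable_smul hd,
      Measure.restrict_restrict hS, Set.prod_inter_prod, Set.inter_univ, Set.univ_inter,
      Measure.volume_eq_prod, ← Measure.prod_restrict] at h3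
    exact h3
  simp only [hfg]
  rw [h1, setIntegral_withDensity_eq_setIntegral_smul hd _ hS, Measure.restrict_restrict hS,
    Set.prod_inter_prod, Set.inter_univ, Set.univ_inter, Measure.volume_eq_prod,
    ← Measure.prod_restrict]
  rw [integral_prod_symm _ hint]
  refine setIntegral_eq_zero_of_forall_eq_zero fun v hv => ?_
  have hv' : 0 < v := hv
  have h2 : ∀ u : ℝ, g (u, v) = f (mkPoint hv' u) := by
    intro u
    rw [hfg]; rfl
  simp only [h2]
  simp only [NNReal.smul_def, Complex.real_smul, integral_const_mul]
  rw [L.integral_torusIntegral_horizontal hk hφ r hv', mul_zero]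

theorem petersson_eisenstein {k : ℤ} (hk : (n : ℚ) / 2 + 2 < k)
    {φ : ℍ → (Fin n → ℂ) → ℂ} (hφ : L.IsCuspForm k φ) (r : L.isotropic) :
    IntegrableOn (L.petIntegrand k φ (L.eisenstein k r)) (jacobiDomain n) ∧
      L.petersson k φ (L.eisenstein k r) = 0 := by
  obtain ⟨h1, h2⟩ := petIntegrand_real (L.omega k φ (L.eisenstein k r))
  obtain ⟨h3, hi, h4⟩ := L.integral_omegaReal_eisenstein hk r hφ
  refine ⟨h1.mpr h3, ?_⟩
  have h5 : ∫ w in jacobiDomain n, L.petIntegrand k φ (L.eisenstein k r) w = 0 :=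
    h2.trans (h4.trans (L.integral_torusIntegral_strip hk hφ r hi))
  rw [petersson, h5, mul_zero]

end EvenLattice

theorem theoremT {n : ℕ} (L : EvenLattice n) (k : ℤ) (hk : (n : ℚ) / 2 + 2 < k)
    (r : L.isotropic) :
    -- absolute and locally uniform convergence of the inner and of the outer series
    (∀ q : SLCosets, ConvergesAbsUnif
      (fun p : {p : JacobiCosets n // p.toSL = q} => L.seriesTerm k r p) (L.fiberSum k r q)) ∧
    ConvergesAbsUnif (L.fiberSum k r) (fun τ z => 2 * L.eisenstein k r τ z) ∧
    -- in the range where the series over all cosets converges absolutely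
    ((n : ℤ) + 2 < k →
      ConvergesAbsUnif (L.seriesTerm k r) (fun τ z => 2 * L.eisenstein k r τ z)) ∧
    -- modularity
    L.IsJacobiForm k (L.eisenstein k r) ∧
    -- orthogonality to cusp forms
    (∀ φ : UpperHalfPlane → (Fin n → ℂ) → ℂ, L.IsCuspForm k φ →
      MeasureTheory.IntegrableOn (L.petIntegrand k φ (L.eisenstein k r)) (EvenLattice.jacobiDomain n) ∧
      L.petersson k φ (L.eisenstein k r) = 0) ∧
    -- Fourier expansion
    (∀ p ∈ L.negSupport, Summable (L.coeffTerm k r p.1 p.2)) ∧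
    (∀ (τ : UpperHalfPlane) (z : Fin n → ℂ),
      Summable (L.singularTerm k r τ z) ∧ Summable (L.nonsingularTerm k r τ z) ∧
      L.eisenstein k r τ z =
        1 / 2 * ∑' r' : L.isotropic, L.singularTerm k r τ z r' +
          ∑' p : L.negSupport, L.nonsingularTerm k r τ z p) := by
  refine ⟨L.convergesAbsUnif_fiber hk r, L.convergesAbsUnif_fiberSum hk r,
    fun hk' => L.convergesAbsUnif_seriesTerm hk hk' r, L.isJacobiForm_eisenstein hk r, fun φ hφ => L.petersson_eisenstein hk hφ r,
    fun p hp => L.summable_coeffTerm hk r p.1 hp.1, L.eisenstein_fourier hk r⟩
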